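/- Theorem 4.1. Let $d\ge 2$, $k\ge 0$, $T>0$, $L>0$, and let $\Omega\subset\mathbb R^d$ be a bounded polyhedral domain partitioned by a conforming simplicial mesh $\mathcal T_h$ that is shape regular with constant $\sigma$ (every element $K$ contains a ball of radius $\rho_K$ with $\operatorname{diam}K\le\sigma\rho_K$). Let $F:\mathbb R^d\times\mathbb R\to\mathbb R$ satisfy $|F(p,v)-F(r,w)|\le L(|p-r|+|v-w|)$, and let $u$ solve $$\partial_t u-\Delta u+F(\nabla u,u)=f\ \text{ in }\Omega\times(0,T],\qquad u=0\ \text{ on }\partial\Omega\times(0,T],\qquad u(\cdot,0)=u_0,$$ with $f(t)\in L^2(\Omega)$, where $u$, $q=-\nabla u$, $u_t$, $q_t$ are continuous on $[0,T]\times\overline\Omega$ and the equation is read with the weak divergence of $q$. Notation. $(a,b)_{\mathcal T_h}=\sum_K\int_K ab$, $\langle a,b\rangle_{\partial\mathcal T_h}=\sum_K\int_{\partial K}ab$, $\|\cdot\|_{\mathcal T_h}$ is the norm of $(\cdot,\cdot)_{\mathcal T_h}$, and $n$ is the outward unit normal of each element. $V_h$, $W_h$ are the spaces of vector and scalar functions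 that are polynomials of degree at most $k$ on each element, and $M_h$ is the space of functions on the faces of the mesh that are polynomials of degree at most $k$ on each face and vanish on faces in $\partial\Omega$. Let $\tau>0$ be constant on each face of each element (possibly with different values on the two sides of a face). On each $K$ fix the Lagrange nodes obtained from one unisolvent set of nodes for polynomials of degree at most $k$ on a closed reference simplex by an affine map onto $K$; $\mathcal I_h$ is the elementwise nodal interpolation (componentwise for vector fields). The HDG projection $(\Pi_Vq,\Pi_Wu)\in V_h\times W_h$ of a pair $(q,u)$ is determined on each $K$ by $(\Pi_Vq-q,r)_K=0$ for $r\in[\mathcal P_{k-1}(K)]^d$, $(\Pi_Wu-u,w)_K=0$ for $w\in\mathcal P_{k-1}(K)$, and $\langle(\Pi_Vq-q)\cdot n+\tau(\Pi_Wu-u),\mu\rangle_e=0$ for $\mu\in\mathcal P_k(e)$ and every face $e$ of $K$ (with $\mathcal P_{-1}=\{0\}$); $(\Pi_Vq_t,\Pi_Wu_t)$ is the projection of $(q_t,u_t)$. Let $(q_h,u_h,\widehat u_h)(t)\in V_h\times W_h\times M_h$ solve the semidiscrete Interpolatory HDG equations: for $t\in(0,T]$ and all $(r,w,\mu)\in V_h\times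 W_h\times M_h$, $$(q_h,r)_{\mathcal T_h}-(u_h,\nabla\cdot r)_{\mathcal T_h}+\langle\widehat u_h,r\cdot n\rangle_{\partial\mathcal T_h}=0,$$ $$(\partial_tu_h,w)_{\mathcal T_h}-(q_h,\nabla w)_{\mathcal T_h}+\langle\widehat q_h\cdot n,w\rangle_{\partial\mathcal T_h}+(\mathcal I_hF(-q_h,u_h),w)_{\mathcal T_h}=(f,w)_{\mathcal T_h},$$ $$\langle\widehat q_h\cdot n,\mu\rangle_{\partial\mathcal T_h\setminus\partial\Omega}=0,\qquad \widehat q_h\cdot n:=q_h\cdot n+\tau(u_h-\widehat u_h),$$ with $u_h$ continuous on $[0,T]$, differentiable on $(0,T]$, and $u_h(0)=\Pi_Wu_0$, where $\Pi_W u_0$ is the scalar component of the HDG projection of $(q(0),u_0)$. Put $$\mathcal E=\|F(-q,u)-\mathcal I_hF(-q,u)\|_{\mathcal T_h}^2+\|\Pi_Wu_t-u_t\|_{\mathcal T_h}^2+\|\Pi_Vq-q\|_{\mathcal T_h}^2+\|\Pi_Wu-u\|_{\mathcal T_h}^2+\|\mathcal I_hq-q\|_{\mathcal T_h}^2+\|\mathcal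 I_hu-u\|_{\mathcal T_h}^2 .$$ Then there is a constant $C>0$, depending only on $d$, $k$, the reference nodes, $\sigma$, $L$ and $T$, such that for all $0<t\le T$ $$\|q(t)-q_h(t)\|_{\mathcal T_h}^2\le C\,\|(\Pi_Vq-q)(0)\|_{\mathcal T_h}^2+C\int_0^t\big(\mathcal E+\|\Pi_Vq_t-q_t\|_{\mathcal T_h}^2\big)\,ds,$$ $$\|u(t)-u_h(t)\|_{\mathcal T_h}^2\le C\,\|(\Pi_Wu-u)(0)\|_{\mathcal T_h}^2+C\int_0^t\mathcal E\,ds,$$ and also $$\|u(t)-u_h(t)\|_{\mathcal T_h}^2\le C\Big(1+\frac1t\Big)\int_0^t\mathcal E\,ds .$$ -/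

import Mathlib

open Set MeasureTheory
open scoped ContDiff

noncomputable section

namespace HDG

/-- Euclidean space `ℝ^d`. -/
abbrev E (d : ℕ) : Type := EuclideanSpace ℝ (Fin d)

/-! ### Polynomial functions -/

/-- `w` is a polynomial function on `ℝ^d` of total degree at most `k`. -/
def IsPoly {d : ℕ} (k : ℕ) (w : E d → ℝ) : Prop :=
  ∃ p : MvPolynomial (Fin d) ℝ, p.totalDegree ≤ k ∧ ∀ x, w x = MvPolynomial.eval (fun i => x i) p

/-- `w` is a polynomial function of degree at most `k - 1`; for `k = 0` this is the zero space
(for `k = 0` the only such function is `w = 0`). -/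
def IsPolyPred {d : ℕ} (k : ℕ) (w : E d → ℝ) : Prop :=
  w = 0 ∨ ∃ m, m + 1 = k ∧ IsPoly m w

/-- Every component of the vector field `r` is a polynomial of degree at most `k`. -/
def IsPolyVec {d : ℕ} (k : ℕ) (r : E d → E d) : Prop :=
  ∀ i, IsPoly k (fun x => r x i)

/-- Every component of the vector field `r` is a polynomial of degree at most `k - 1`. -/
def IsPolyVecPred {d : ℕ} (k : ℕ) (r : E d → E d) : Prop :=
  ∀ i, IsPolyPred k (fun x => r x i)

/-- The divergence `∑ i, ∂ rᵢ / ∂ xᵢ`. -/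
def div {d : ℕ} (r : E d → E d) (x : E d) : ℝ :=
  ∑ i, (fderiv ℝ r x (EuclideanSpace.single i 1)) i

/-! ### Simplices -/

/-- A nondegenerate `d`-simplex in `ℝ^d`, given by its (ordered) vertices. -/
abbrev Simplex (d : ℕ) : Type := Affine.Simplex ℝ (E d) d

/-- The closed simplex. -/
def body {d : ℕ} (S : Simplex d) : Set (E d) := convexHull ℝ (range S.points)

/-- The closed face of `S` opposite to vertex `i`. -/
def face {d : ℕ} (S : Simplex d) (i : Fin (d + 1)) : Set (E d) :=
  convexHull ℝ (S.points '' {i}ᶜ)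

/-- The outward unit normal on the face opposite to vertex `i`: the direction from that vertex
to its orthogonal projection onto the hyperplane of the face. -/
def normal {d : ℕ} [NeZero d] (S : Simplex d) (i : Fin (d + 1)) : E d :=
  ‖S.altitudeFoot i - S.points i‖⁻¹ • (S.altitudeFoot i - S.points i)

/-- Integral over the face opposite to vertex `i` with respect to `(d-1)`-dimensional surface
measure, i.e. the Hausdorff measure normalised to agree with Lebesgue measure on hyperplanes. -/
def faceInt {d : ℕ} (S : Simplex d) (i : Fin (d + 1)) (g : E d → ℝ) : ℝ :=
  ∫ x in face S i, g x ∂(Measure.euclideanHausdorffMeasure (d - 1) : Measure (E d))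

/-! ### Nodal elements and interpolation -/

/-- The reference simplex `{x : 0 ≤ xᵢ, ∑ xᵢ ≤ 1}`. -/
def refSimplex (d : ℕ) : Set (E d) := {x | (∀ i, 0 ≤ x i) ∧ ∑ i, x i ≤ 1}

/-- The affine map from the reference simplex onto `S` that maps `0, e₁, …, e_d` to the vertices
of `S`. -/
def refMap {d : ℕ} (S : Simplex d) (x : E d) : E d :=
  S.points 0 + ∑ i : Fin d, x i • (S.points i.succ - S.points 0)

/-- A Lagrange finite element of degree `k` on the reference simplex: nodal points together with
the nodal basis of the polynomials of degree at most `k`. -/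
structure NodalElement (d k : ℕ) where
  card : ℕ
  node : Fin card → E d
  shape : Fin card → E d → ℝ
  node_mem : ∀ j, node j ∈ refSimplex d
  shape_poly : ∀ j, IsPoly k (shape j)
  shape_node : ∀ i j, shape j (node i) = if i = j then 1 else 0
  shape_span : ∀ p, IsPoly k p → p ∈ Submodule.span ℝ (range shape)

/-- Nodal interpolation on `S`: nodes are the images of the reference nodes, and the nodal basis
functions are the reference ones composed with the inverse of `refMap S`. -/
def interp {d k : ℕ} (R : NodalElement d k) (S : Simplex d) {V : Type} [AddCommGroup V] [Module ℝ V]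
    (g : E d → V) (x : E d) : V :=
  ∑ j, R.shape j (Function.invFun (refMap S) x) • g (refMap S (R.node j))

/-! ### The HDG projection -/

/-- `(pq, pu)` satisfies the equations of the HDG projection of `(q, u)` on the simplex `S` with
stabilisation parameters `τ i` on the faces. -/
structure IsHDGProjection {d : ℕ} [NeZero d] (k : ℕ) (S : Simplex d) (τ : Fin (d + 1) → ℝ)
    (q : E d → E d) (u : E d → ℝ) (pq : E d → E d) (pu : E d → ℝ) : Prop where
  poly_q : IsPolyVec k pq
  poly_u : IsPoly k pu
  orth_q : ∀ r, IsPolyVecPred k r →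
    ∫ x in body S, inner ℝ (pq x) (r x) = ∫ x in body S, inner ℝ (q x) (r x)
  orth_u : ∀ w, IsPolyPred k w → ∫ x in body S, pu x * w x = ∫ x in body S, u x * w x
  orth_face : ∀ i, ∀ μ, IsPoly k μ →
    faceInt S i (fun x => (inner ℝ (pq x) (normal S i) + τ i * pu x) * μ x) =
      faceInt S i (fun x => (inner ℝ (q x) (normal S i) + τ i * u x) * μ x)

/-- The HDG projection `(Π_V q, Π_W u)` on `S`: the solution of the equations above (which is
unique for positive `τ`). -/
def hdgProj {d : ℕ} [NeZero d] (k : ℕ) (S : Simplex d) (τ : Fin (d + 1) → ℝ)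
    (q : E d → E d) (u : E d → ℝ) : (E d → E d) × (E d → ℝ) :=
  Classical.epsilon fun p => IsHDGProjection k S τ q u p.1 p.2

/-! ### Meshes -/

/-- A conforming simplicial mesh with `N` elements: the elements have disjoint interiors and two
closed elements intersect in the convex hull of their common vertices. -/
structure Mesh (d N : ℕ) where
  elem : Fin N → Simplex d
  disjoint : ∀ K K', K ≠ K' → Disjoint (interior (body (elem K))) (interior (body (elem K')))
  conforming : ∀ K K', body (elem K) ∩ body (elem K') =
    convexHull ℝ (range (elem K).points ∩ range (elem K').points)

/-- The open set `Ω` is partitioned by the mesh. -/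
def Mesh.Partitions {d N : ℕ} (𝒯 : Mesh d N) (Ω : Set (E d)) : Prop :=
  Ω = interior (⋃ K, body (𝒯.elem K))

/-- Shape regularity: every element contains a ball of radius `ρ` with `h_K ≤ σ ρ`. -/
def Mesh.ShapeRegular {d N : ℕ} (𝒯 : Mesh d N) (σ : ℝ) : Prop :=
  ∀ K, ∃ x : E d, ∃ ρ : ℝ, 0 < ρ ∧ Metric.closedBall x ρ ⊆ body (𝒯.elem K) ∧
    Metric.diam (body (𝒯.elem K)) ≤ σ * ρ

/-- A boundary face is a face contained in the boundary of `Ω`. -/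
def IsBoundaryFace {d : ℕ} (Ω e : Set (E d)) : Prop := e ⊆ frontier Ω

/-- `∑_K ∫_K g_K`. -/
def Mesh.volInt {d N : ℕ} (𝒯 : Mesh d N) (g : Fin N → E d → ℝ) : ℝ :=
  ∑ K, ∫ x in body (𝒯.elem K), g K x

/-- `∑_K ∫_{∂K} g_K`, where `g K i` is the integrand on the `i`-th face of `K`. -/
def Mesh.bdryInt {d N : ℕ} (𝒯 : Mesh d N) (g : Fin N → Fin (d + 1) → E d → ℝ) : ℝ :=
  ∑ K, ∑ i, faceInt (𝒯.elem K) i (g K i)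

open Classical in
/-- `∑_K ∫_{∂K \ ∂Ω} g_K`: as `Mesh.bdryInt`, with the boundary faces left out. -/
def Mesh.interiorBdryInt {d N : ℕ} (𝒯 : Mesh d N) (Ω : Set (E d))
    (g : Fin N → Fin (d + 1) → E d → ℝ) : ℝ :=
  ∑ K, ∑ i, if IsBoundaryFace Ω (face (𝒯.elem K) i) then 0 else faceInt (𝒯.elem K) i (g K i)

/-- The squared broken `L²` norm `‖g‖²_{𝒯_h} = ∑_K ∫_K |g_K|²`. -/
def Mesh.normSq {d N : ℕ} (𝒯 : Mesh d N) {V : Type} [NormedAddCommGroup V]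
    (g : Fin N → E d → V) : ℝ :=
  𝒯.volInt fun K x => ‖g K x‖ ^ 2

/-! ### Discrete spaces

An element of `V_h` or `W_h` is given by its polynomial restriction to each element `K`, and an
element of `M_h` by a function on each (closed) face. -/

/-- Membership in `V_h`. -/
def MemV {d N : ℕ} (k : ℕ) (r : Fin N → E d → E d) : Prop := ∀ K, IsPolyVec k (r K)

/-- Membership in `W_h`. -/
def MemW {d N : ℕ} (k : ℕ) (w : Fin N → E d → ℝ) : Prop := ∀ K, IsPoly k (w K)

/-- Membership in `M_h`: a polynomial of degree at most `k` on every face of the mesh, the same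
from both sides of the face, and zero on boundary faces. -/
def MemM {d N : ℕ} (k : ℕ) (𝒯 : Mesh d N) (Ω : Set (E d)) (μ : Set (E d) → E d → ℝ) : Prop :=
  ∀ K i, (∃ p : E d → ℝ, IsPoly k p ∧ EqOn (μ (face (𝒯.elem K) i)) p (face (𝒯.elem K) i)) ∧
    (IsBoundaryFace Ω (face (𝒯.elem K) i) →
      ∀ x ∈ face (𝒯.elem K) i, μ (face (𝒯.elem K) i) x = 0)

/-- The normal component `q̂_h · n = q_h · n + τ (u_h - û_h)` of the numerical flux on the `i`-th
face of `K`. -/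
def numFlux {d N : ℕ} [NeZero d] (𝒯 : Mesh d N) (τ : Fin N → Fin (d + 1) → ℝ)
    (qh : Fin N → E d → E d) (uh : Fin N → E d → ℝ) (uhat : Set (E d) → E d → ℝ)
    (K : Fin N) (i : Fin (d + 1)) (x : E d) : ℝ :=
  inner ℝ (qh K x) (normal (𝒯.elem K) i) +
    τ K i * (uh K x - uhat (face (𝒯.elem K) i) x)

/-! ### The continuous and the semidiscrete problem -/

/-- `∇ · v = g` in `Ω` in the sense of distributions. -/
def HasWeakDiv {d : ℕ} (Ω : Set (E d)) (v : E d → E d) (g : E d → ℝ) : Prop :=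
  ∀ φ : E d → ℝ, ContDiff ℝ ∞ φ → HasCompactSupport φ → tsupport φ ⊆ Ω →
    ∫ x in Ω, inner ℝ (v x) (gradient φ x) = - ∫ x in Ω, g x * φ x

/-- `u` solves `∂ₜu - Δu + F(∇u, u) = f` in `Ω × (0, T]`, `u = 0` on `∂Ω`, `u(0) = u₀`, with flux
`q = -∇u` and time derivatives `ut`, `qt` of `u`, `q`, all four being continuous on
`[0, T] × closure Ω`. The right-hand side is square integrable in space, and the equation
`∂ₜu + ∇·q + F(-q, u) = f` holds with the weak divergence of `q`. -/
structure IsExactSolution {d : ℕ} (Ω : Set (E d)) (F : E d → ℝ → ℝ) (f : ℝ → E d → ℝ)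
    (u₀ : E d → ℝ) (T : ℝ) (u ut : ℝ → E d → ℝ) (q qt : ℝ → E d → E d) : Prop where
  cont_u : ContinuousOn (fun p : ℝ × E d => u p.1 p.2) (Icc 0 T ×ˢ closure Ω)
  cont_ut : ContinuousOn (fun p : ℝ × E d => ut p.1 p.2) (Icc 0 T ×ˢ closure Ω)
  cont_q : ContinuousOn (fun p : ℝ × E d => q p.1 p.2) (Icc 0 T ×ˢ closure Ω)
  cont_qt : ContinuousOn (fun p : ℝ × E d => qt p.1 p.2) (Icc 0 T ×ˢ closure Ω)
  deriv_u : ∀ t ∈ Icc 0 T, ∀ x ∈ closure Ω,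
    HasDerivWithinAt (fun s => u s x) (ut t x) (Icc 0 T) t
  deriv_q : ∀ t ∈ Icc 0 T, ∀ x ∈ closure Ω,
    HasDerivWithinAt (fun s => q s x) (qt t x) (Icc 0 T) t
  source : ∀ t ∈ Ioc 0 T, MemLp (f t) 2 (volume.restrict Ω)
  flux : ∀ t ∈ Ioc 0 T, ∀ x ∈ Ω, HasGradientAt (u t) (-(q t x)) x
  equation : ∀ t ∈ Ioc 0 T,
    HasWeakDiv Ω (q t) (fun x => f t x - ut t x - F (-(q t x)) (u t x))
  boundary : ∀ t ∈ Ioc 0 T, ∀ x ∈ frontier Ω, u t x = 0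
  initial : ∀ x ∈ closure Ω, u 0 x = u₀ x

/-- `(qh, uh, uhat)` solves the semidiscrete Interpolatory HDG equations on `(0, T]` with initial
value `uh(0) = u0h`. -/
structure IsInterpolatoryHDGSolution {d k N : ℕ} [NeZero d] (R : NodalElement d k)
    (𝒯 : Mesh d N) (Ω : Set (E d)) (τ : Fin N → Fin (d + 1) → ℝ) (F : E d → ℝ → ℝ)
    (f : ℝ → E d → ℝ) (T : ℝ) (u0h : Fin N → E d → ℝ)
    (qh : ℝ → Fin N → E d → E d) (uh : ℝ → Fin N → E d → ℝ)
    (uhat : ℝ → Set (E d) → E d → ℝ) : Prop where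
  mem_V : ∀ t ∈ Ioc 0 T, MemV k (qh t)
  mem_W : ∀ t ∈ Icc 0 T, MemW k (uh t)
  mem_M : ∀ t ∈ Ioc 0 T, MemM k 𝒯 Ω (uhat t)
  cont : ∀ K x, ContinuousOn (fun s => uh s K x) (Icc 0 T)
  diff : ∀ t ∈ Ioc 0 T, ∀ K x, DifferentiableWithinAt ℝ (fun s => uh s K x) (Icc 0 T) t
  eq_flux : ∀ t ∈ Ioc 0 T, ∀ r, MemV k r →
    𝒯.volInt (fun K x => inner ℝ (qh t K x) (r K x))
      - 𝒯.volInt (fun K x => uh t K x * div (r K) x)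
      + 𝒯.bdryInt (fun K i x =>
          uhat t (face (𝒯.elem K) i) x * inner ℝ (r K x) (normal (𝒯.elem K) i)) = 0
  eq_scalar : ∀ t ∈ Ioc 0 T, ∀ w, MemW k w →
    𝒯.volInt (fun K x => derivWithin (fun s => uh s K x) (Icc 0 T) t * w K x)
      - 𝒯.volInt (fun K x => inner ℝ (qh t K x) (gradient (w K) x))
      + 𝒯.bdryInt (fun K i x => numFlux 𝒯 τ (qh t) (uh t) (uhat t) K i x * w K x)
      + 𝒯.volInt (fun K x =>
          interp R (𝒯.elem K) (fun y => F (-(qh t K y)) (uh t K y)) x * w K x)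
      = 𝒯.volInt (fun K x => f t x * w K x)
  eq_trace : ∀ t ∈ Ioc 0 T, ∀ μ, MemM k 𝒯 Ω μ →
    𝒯.interiorBdryInt Ω (fun K i x =>
      numFlux 𝒯 τ (qh t) (uh t) (uhat t) K i x * μ (face (𝒯.elem K) i) x) = 0
  initial : uh 0 = u0h

/-! ### Projection and interpolation errors (squared broken `L²` norms) -/

/-- `‖Π_V q - q‖²`, with `Π_V` the flux component of the HDG projection of `(q, u)`. -/
def errProjV {d N : ℕ} [NeZero d] (k : ℕ) (𝒯 : Mesh d N) (τ : Fin N → Fin (d + 1) → ℝ)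
    (q : E d → E d) (u : E d → ℝ) : ℝ :=
  𝒯.normSq fun K x => (hdgProj k (𝒯.elem K) (τ K) q u).1 x - q x

/-- `‖Π_W u - u‖²`, with `Π_W` the scalar component of the HDG projection of `(q, u)`. -/
def errProjW {d N : ℕ} [NeZero d] (k : ℕ) (𝒯 : Mesh d N) (τ : Fin N → Fin (d + 1) → ℝ)
    (q : E d → E d) (u : E d → ℝ) : ℝ :=
  𝒯.normSq fun K x => (hdgProj k (𝒯.elem K) (τ K) q u).2 x - u x

/-- `‖I_h g - g‖²` for a scalar function or a vector field `g`. -/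
def errInterp {d k N : ℕ} (R : NodalElement d k) (𝒯 : Mesh d N) {V : Type}
    [NormedAddCommGroup V] [NormedSpace ℝ V] (g : E d → V) : ℝ :=
  𝒯.normSq fun K x => interp R (𝒯.elem K) g x - g x

end HDG

end

open HDG

set_option linter.unusedSectionVars false

noncomputable section

namespace HDG

section

/-! ### Polynomial functions -/

variable {d k : ℕ}

/-! The discrete solution is compared with the projection of the exact one. Put p = Π_V q - q_h, w =
Π_W u - u_h, δ = Π_V q - q, and μ = P u - û_h with P the facewise L² projection (`traceProj`). The
HDG projection is made so that its numerical flux has the same face moments as q·n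
(`faceInt_numFlux_proj`). Hence (p, w, μ) solves the HDG flux equation with the residual (δ, r) and
has a continuous normal flux (`isErrorState_proj`). Write D(v) for the weak divergence of its
numerical flux tested with v (`fluxRes`, summed over the elements). Then D(v) = -(M, v) - (w_t, v),
where M = F(-q, u) - I_h F(-q_h, u_h) - (Π_W u_t - u_t).

The energy identity `IsErrorState.energy` says that A := (δ, p) + D(w) = ‖p‖² + ⟨τ(w - μ), w - μ⟩,
so that ‖p‖² ≤ A. The term M is controlled by the projection and interpolation errors together with
‖p‖ and ‖w‖ (`exists_nonlinear_bound`). At a node F(-q, u) sees only the nodal values of q and u, so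
the Lipschitz bound may be applied to the polynomials I_h q and I_h u. Nodal interpolation of such
differences is stable in L² with a constant of the reference element (`exists_interp_bound`).
Young's inequality absorbs ‖p‖² into A, and Y = ‖w‖² satisfies Y' ≤ C(G + Y), where G is the sum of
errors called 𝓔 in the statement.

The flux estimate needs the derivative of A, although neither q_h nor û_h is assumed differentiable
in time. The polarised energy identity is symmetric, and the data (δ, w) determine p and the flux
moments linearly (`stateData_symm`, `stateOutput_eq_zero`). Therefore A' = 2((δ_t, p) + D(w_t)) =
2((δ_t, p) - (M, w_t) - ‖w_t‖²) (`exists_output_of_symmetric`, `exists_energy`), and the last term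
absorbs w_t. No discrete flux is given at t = 0, but A extends continuously, and w(0) = 0 forces
A(0) ≤ ‖δ(0)‖². Gronwall's inequality for Y, and then for A + Y, bounds the discrete errors.

The triangle inequality leaves the projection errors at time t. They are bounded by their values at
an earlier time s plus the integral of their squared norms and those of their time derivatives.
Taking s = 0 gives the first two estimates, and averaging over s in [0, t] gives the one with the
factor 1 + 1/t.

The analytic basis consists of a divergence theorem on simplices for continuous fields with a weak
divergence (`integral_eq_sum_faceInt_of_weakDiv`), the cancellation of normals across interior faces
(`Mesh.Partitions.sum_normal_eq_zero`), and unisolvence of the HDG projection with its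
differentiability in time (`isHDGProjection_zero`, `isC1On_hdgProj_fst`, `isC1On_hdgProj_snd`). -/

theorem IsPoly.mono {m : ℕ} {w : E d → ℝ} (h : IsPoly k w) (hkm : k ≤ m) : IsPoly m w := by
  obtain ⟨p, hp, hw⟩ := h
  exact ⟨p, hp.trans hkm, hw⟩

theorem isPoly_const (k : ℕ) (c : ℝ) : IsPoly k (fun _ : E d => c) :=
  ⟨MvPolynomial.C c, by simp, by simp⟩

theorem isPoly_zero (k : ℕ) : IsPoly k (0 : E d → ℝ) := isPoly_const k 0

theorem IsPoly.add {v w : E d → ℝ} (hv : IsPoly k v) (hw : IsPoly k w) : IsPoly k (v + w) := by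
  obtain ⟨p, hp, hv⟩ := hv
  obtain ⟨q, hq, hw⟩ := hw
  exact ⟨p + q, (MvPolynomial.totalDegree_add _ _).trans (max_le hp hq), fun x => by
    simp [hv, hw]⟩

theorem IsPoly.mul {m : ℕ} {v w : E d → ℝ} (hv : IsPoly k v) (hw : IsPoly m w) :
    IsPoly (k + m) (v * w) := by
  obtain ⟨p, hp, hv⟩ := hv
  obtain ⟨q, hq, hw⟩ := hw
  exact ⟨p * q, (MvPolynomial.totalDegree_mul _ _).trans (add_le_add hp hq), fun x => by
    simp [hv, hw]⟩

theorem IsPoly.smul {w : E d → ℝ} (c : ℝ) (hw : IsPoly k w) : IsPoly k (c • w) := by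
  have := (isPoly_const (d := d) 0 c).mul hw
  rw [zero_add] at this
  exact this

theorem isPoly_coord (i : Fin d) : IsPoly 1 (fun x : E d => x i) :=
  ⟨MvPolynomial.X i, by simp, by simp⟩

/-- The space of polynomial functions of degree at most `k`. -/
def polySpace (d k : ℕ) : Submodule ℝ (E d → ℝ) where
  carrier := {w | IsPoly k w}
  add_mem' := IsPoly.add
  zero_mem' := isPoly_zero k
  smul_mem' := fun c _ h => h.smul c

theorem mem_polySpace {w : E d → ℝ} : w ∈ polySpace d k ↔ IsPoly k w := Iff.rfl

theorem IsPoly.sub {v w : E d → ℝ} (hv : IsPoly k v) (hw : IsPoly k w) : IsPoly k (v - w) :=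
  (polySpace d k).sub_mem hv hw

theorem IsPoly.sum {ι : Type*} {s : Finset ι} {w : ι → E d → ℝ} (h : ∀ i ∈ s, IsPoly k (w i)) :
    IsPoly k (∑ i ∈ s, w i) :=
  (polySpace d k).sum_mem h

/-- Induction over the degree of a polynomial function. -/
theorem IsPoly.induction {Q : ℕ → (E d → ℝ) → Prop} (const : ∀ k c, Q k fun _ => c)
    (add : ∀ k v w, Q k v → Q k w → Q k (v + w))
    (mul : ∀ k i w, IsPoly k w → Q k w → Q (k + 1) fun x => x i * w x)
    {w : E d → ℝ} (hw : IsPoly k w) : Q k w := by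
  obtain ⟨p, hp, hw⟩ := hw
  have mono : ∀ (m : Fin d →₀ ℕ) (c : ℝ) (k : ℕ), (m.sum fun _ e => e) ≤ k →
      Q k (fun x => MvPolynomial.eval (fun i => x i) (MvPolynomial.monomial m c)) ∧
      IsPoly k (fun x : E d => MvPolynomial.eval (fun i => x i) (MvPolynomial.monomial m c)) := by
    intro m c k hk
    refine ⟨?_, MvPolynomial.monomial m c, (MvPolynomial.totalDegree_monomial_le _ _).trans hk,
      fun x => rfl⟩
    -- Induction on the degree of the monomial: a nonconstant monomial contains some `X i`, and
    -- removing one factor `X i` lowers both the degree and the admissible bound by one.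
    induction hn : (m.sum fun _ e => e) generalizing m k with
    | zero =>
      have : m = 0 := by
        ext i
        by_contra h
        have h0 : m i ≠ 0 := by simpa using h
        have := (Finset.sum_eq_zero_iff.1 hn) i (Finsupp.mem_support_iff.2 h0)
        exact h0 this
      subst this
      simpa using const k c
    | succ n ih =>
      have hm : m ≠ 0 := by rintro rfl; simp at hn
      obtain ⟨i, hi⟩ := Finsupp.ne_iff.1 hm
      have hi' : 1 ≤ m i := Nat.one_le_iff_ne_zero.2 (by simpa using hi)
      have hle : Finsupp.single i 1 ≤ m := by simpa using hi'
      have hsum : ((m - Finsupp.single i 1).sum fun _ e => e) = n := by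
        have h1 : m = Finsupp.single i 1 + (m - Finsupp.single i 1) := (add_tsub_cancel_of_le hle).symm
        have h2 : (m.sum fun _ e => e) = 1 + ((m - Finsupp.single i 1).sum fun _ e => e) := by
          conv_lhs => rw [h1]
          rw [Finsupp.sum_add_index' (by simp) (by simp)]
          simp
        omega
      obtain ⟨k, rfl⟩ : ∃ k', k = k' + 1 := ⟨k - 1, by omega⟩
      have key := mul k i _ ⟨MvPolynomial.monomial (m - Finsupp.single i 1) c,
        (MvPolynomial.totalDegree_monomial_le _ _).trans (hsum.le.trans (by omega)), fun x => rfl⟩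
        (ih (m - Finsupp.single i 1) k (by omega) hsum)
      convert key using 2 with x
      have h1 : m = Finsupp.single i 1 + (m - Finsupp.single i 1) := (add_tsub_cancel_of_le hle).symm
      conv_lhs => rw [h1, ← one_mul c, ← MvPolynomial.monomial_mul]
      simp only [map_mul]
      congr 1
      exact MvPolynomial.eval_X (f := fun i => x i) i
  have hsum : ∀ s : Finset (Fin d →₀ ℕ), s ⊆ p.support → Q k (∑ m ∈ s, fun x =>
      MvPolynomial.eval (fun i => x i) (MvPolynomial.monomial m (p.coeff m))) := by
    intro s
    induction s using Finset.induction_on with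
    | empty => exact fun _ => const k 0
    | insert a s ha ih =>
      intro hs
      rw [Finset.sum_insert ha]
      exact add _ _ _ (mono _ _ _ ((MvPolynomial.le_totalDegree
        (hs (Finset.mem_insert_self a s))).trans hp)).1
        (ih (Finset.Subset.trans (Finset.subset_insert _ _) hs))
  convert hsum p.support subset_rfl using 1
  ext x
  rw [hw, Finset.sum_apply]
  conv_lhs => rw [p.as_sum, map_sum]

theorem IsPoly.contDiff {w : E d → ℝ} (hw : IsPoly k w) : ContDiff ℝ ∞ w := by
  refine hw.induction (Q := fun _ w => ContDiff ℝ ∞ w) (fun _ c => contDiff_const)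
    (fun _ v w hv hw => hv.add hw) (fun _ i w _ hw => ?_)
  exact ContDiff.mul (by fun_prop) hw

theorem IsPoly.continuous {w : E d → ℝ} (hw : IsPoly k w) : Continuous w :=
  hw.contDiff.continuous

theorem IsPoly.differentiable {w : E d → ℝ} (hw : IsPoly k w) : Differentiable ℝ w :=
  hw.contDiff.differentiable (by simp)

theorem IsPolyPred.isPoly {w : E d → ℝ} (hw : IsPolyPred k w) : IsPoly k w := by
  obtain rfl | ⟨m, rfl, hm⟩ := hw
  · exact isPoly_zero k
  · exact hm.mono (Nat.le_succ m)

theorem isPolyPred_succ {w : E d → ℝ} : IsPolyPred (k + 1) w ↔ IsPoly k w := by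
  constructor
  · rintro (rfl | ⟨m, hm, h⟩)
    · exact isPoly_zero k
    · obtain rfl : m = k := by omega
      exact h
  · exact fun h => Or.inr ⟨k, rfl, h⟩

theorem isPolyPred_zero {w : E d → ℝ} : IsPolyPred 0 w ↔ w = 0 :=
  ⟨by rintro (rfl | ⟨m, hm, _⟩); exacts [rfl, by omega], Or.inl⟩

/-- The space of polynomial functions of degree at most `k - 1`. -/
def polySpacePred (d k : ℕ) : Submodule ℝ (E d → ℝ) where
  carrier := {w | IsPolyPred k w}
  add_mem' := by
    cases k with
    | zero => intro a b ha hb; simp_all [isPolyPred_zero]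
    | succ k => intro a b ha hb; simp only [mem_ofPred_eq, isPolyPred_succ] at *; exact ha.add hb
  zero_mem' := Or.inl rfl
  smul_mem' := by
    cases k with
    | zero => intro c a ha; simp_all [isPolyPred_zero]
    | succ k => intro c a ha; simp only [mem_ofPred_eq, isPolyPred_succ] at *; exact ha.smul c

theorem polySpacePred_le : polySpacePred d k ≤ polySpace d k := fun _ h => IsPolyPred.isPoly h

instance polySpace_finite : FiniteDimensional ℝ (polySpace d k) := by
  let φ : MvPolynomial (Fin d) ℝ →ₗ[ℝ] (E d → ℝ) :=
    LinearMap.pi fun x => (MvPolynomial.aeval (fun i => x i)).toLinearMap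
  have h : polySpace d k = (MvPolynomial.restrictTotalDegree (Fin d) ℝ k).map φ := by
    ext w
    simp only [mem_polySpace, Submodule.mem_map, MvPolynomial.mem_restrictTotalDegree]
    constructor
    · rintro ⟨p, hp, hw⟩
      exact ⟨p, hp, by ext x; simp [φ, hw, MvPolynomial.aeval_eq_eval]⟩
    · rintro ⟨p, hp, rfl⟩
      exact ⟨p, hp, fun x => by simp [φ, MvPolynomial.aeval_eq_eval]⟩
  have : Module.Finite ℝ (MvPolynomial.restrictTotalDegree (Fin d) ℝ k) := by
    have hfin : {n : Fin d →₀ ℕ | (n.sum fun _ e => e) ≤ k}.Finite :=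
      Finsupp.finite_of_degree_le k
    have := hfin.to_subtype
    exact Module.Finite.of_basis (MvPolynomial.basisRestrictSupport ℝ _)
  rw [h]
  infer_instance

instance polySpacePred_finite : FiniteDimensional ℝ (polySpacePred d k) :=
  Submodule.finiteDimensional_of_le polySpacePred_le

theorem IsPolyPred.coord_mul {w : E d → ℝ} (hw : IsPolyPred k w) (i : Fin d) :
    IsPoly k (fun x => x i * w x) := by
  obtain rfl | ⟨m, rfl, hm⟩ := hw
  · simpa using isPoly_const k 0
  · have := (isPoly_coord i).mul hm
    rw [add_comm] at this
    exact this

theorem IsPolyPred.add {v w : E d → ℝ} (hv : IsPolyPred k v) (hw : IsPolyPred k w) :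
    IsPolyPred k (v + w) :=
  (polySpacePred d k).add_mem hv hw

theorem IsPolyPred.sum {ι : Type*} {s : Finset ι} {w : ι → E d → ℝ}
    (h : ∀ i ∈ s, IsPolyPred k (w i)) : IsPolyPred k (∑ i ∈ s, w i) :=
  (polySpacePred d k).sum_mem h

theorem IsPolyPred.smul {w : E d → ℝ} (c : ℝ) (hw : IsPolyPred k w) : IsPolyPred k (c • w) :=
  (polySpacePred d k).smul_mem c hw

theorem IsPoly.fderiv_apply {w : E d → ℝ} (hw : IsPoly k w) (v : E d) :
    IsPolyPred k (fun x => fderiv ℝ w x v) := by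
  -- Differentiability is carried through the induction because the sum and product rules need it
  -- for the factors.
  suffices h : Differentiable ℝ w ∧ IsPolyPred k (fun x => fderiv ℝ w x v) from h.2
  refine hw.induction
    (Q := fun k w => Differentiable ℝ w ∧ IsPolyPred k (fun x => fderiv ℝ w x v)) ?_ ?_ ?_
  · intro k c
    refine ⟨differentiable_const c, Or.inl ?_⟩
    ext x
    simp
  · rintro k v₁ v₂ ⟨h₁, h₁'⟩ ⟨h₂, h₂'⟩
    refine ⟨h₁.add h₂, ?_⟩
    convert h₁'.add h₂' using 1
    ext x
    simp [fderiv_add (h₁ x) (h₂ x)]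
  · rintro k i w hw ⟨h, h'⟩
    have hc : Differentiable ℝ (fun x : E d => x i) := by fun_prop
    refine ⟨hc.mul h, isPolyPred_succ.2 ?_⟩
    convert (h'.coord_mul i).add (hw.smul (v i)) using 1
    ext x
    rw [fderiv_fun_mul (hc x) (h x)]
    have : fderiv ℝ (fun x : E d => x i) x v = v i := by
      rw [show (fun x : E d => x i) = (EuclideanSpace.proj i : E d →L[ℝ] ℝ) from rfl,
        ContinuousLinearMap.fderiv]
      rfl
    simp [this, mul_comm]

/-- Composition with a map whose components are polynomials of degree one. -/
theorem IsPoly.comp_affine {w : E d → ℝ} (hw : IsPoly k w) {n : ℕ} {A : E n → E d}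
    (hA : ∀ i, IsPoly 1 (fun x => A x i)) : IsPoly k (w ∘ A) := by
  refine hw.induction (Q := fun k w => IsPoly k (w ∘ A)) (fun k c => isPoly_const k c)
    (fun k v w hv hw => hv.add hw) (fun k i w _ hw => ?_)
  have := (hA i).mul hw
  rw [add_comm] at this
  exact this

/-- Reduces uniqueness questions to one variable, where a nonzero polynomial has only finitely many
roots. -/
theorem IsPoly.exists_line {w : E d → ℝ} (hw : IsPoly k w) (x v : E d) :
    ∃ p : Polynomial ℝ, ∀ t : ℝ, w (x + t • v) = p.eval t := by
  refine hw.induction (Q := fun _ w => ∃ p : Polynomial ℝ, ∀ t : ℝ, w (x + t • v) = p.eval t)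
    (fun k c => ⟨Polynomial.C c, by simp⟩) ?_ ?_
  · rintro k v₁ v₂ ⟨p, hp⟩ ⟨q, hq⟩
    exact ⟨p + q, fun t => by simp [hp, hq]⟩
  · rintro k i w - ⟨p, hp⟩
    exact ⟨(Polynomial.C (x i) + Polynomial.X * Polynomial.C (v i)) * p, fun t => by
      simpa [hp] using Or.inl (mul_comm _ _)⟩

/-- A polynomial function that vanishes near `x` on the line through `x` and `y` vanishes
at `y`. -/
theorem IsPoly.eq_zero_of_line {w : E d → ℝ} (hw : IsPoly k w) {x y : E d}
    (h : ∃ ε > 0, ∀ t : ℝ, |t| < ε → w (x + t • (y - x)) = 0) : w y = 0 := by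
  obtain ⟨p, hp⟩ := hw.exists_line x (y - x)
  obtain ⟨ε, hε, h⟩ := h
  have hp0 : p = 0 := by
    refine Polynomial.eq_zero_of_infinite_isRoot p (Set.Infinite.mono ?_ (Ioo_infinite hε))
    intro t ht
    have := h t (by rw [abs_of_pos ht.1]; exact ht.2)
    rwa [hp] at this
  have := hp 1
  simpa [hp0] using this

/-- Every point lies on a line through a fixed point of `U`, and that line stays in `U` for small
parameters. -/
theorem IsPoly.eq_zero_of_open {w : E d → ℝ} (hw : IsPoly k w) {U : Set (E d)} (hU : IsOpen U)
    (hne : U.Nonempty) (h : ∀ x ∈ U, w x = 0) : w = 0 := by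
  obtain ⟨x, hx⟩ := hne
  ext y
  refine hw.eq_zero_of_line (x := x) ?_
  have hc : Continuous fun t : ℝ => x + t • (y - x) := by fun_prop
  have h0 : (fun t : ℝ => x + t • (y - x)) ⁻¹' U ∈ nhds 0 :=
    hc.continuousAt.preimage_mem_nhds (hU.mem_nhds (by simpa using hx))
  obtain ⟨ε, hε, hb⟩ := Metric.mem_nhds_iff.1 h0
  exact ⟨ε, hε, fun t ht => h _ (hb (by simpa using ht))⟩

/-- Subtracting from a polynomial its values on the zero set of an affine function `l`, pulled back
along the projection in direction `a`, gives a multiple of `l`. -/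
theorem IsPoly.exists_sub_eq_mul {w : E d → ℝ} (hw : IsPoly k w) {l : E d → ℝ} (hl : IsPoly 1 l)
    (a : E d) : ∃ g, IsPolyPred k g ∧ ∀ x, w x - w (x - l x • a) = l x * g x := by
  have hA : ∀ i, IsPoly 1 (fun x : E d => (x - l x • a) i) := by
    intro i
    convert (isPoly_coord i).sub (hl.smul (a i)) using 1
    ext x
    simp [mul_comm]
  refine hw.induction
    (Q := fun k w => ∃ g, IsPolyPred k g ∧ ∀ x, w x - w (x - l x • a) = l x * g x) ?_ ?_ ?_
  · exact fun k c => ⟨0, Or.inl rfl, by simp⟩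
  · rintro k v w ⟨g, hg, hv⟩ ⟨g', hg', hw⟩
    refine ⟨g + g', hg.add hg', fun x => ?_⟩
    have := hv x
    have := hw x
    simp only [Pi.add_apply]
    linarith
  · rintro k i w hw ⟨g, hg, h⟩
    -- With A x = x - l(x) a one has x_i w(x) - (A x)_i w(A x) = x_i (w(x) - w(A x)) + l(x) a_i w(A
    -- x). Both summands are multiples of l.
    refine ⟨(fun x => x i * g x) + a i • (w ∘ fun x => x - l x • a), isPolyPred_succ.2
      ((hg.coord_mul i).add ((hw.comp_affine hA).smul _)), fun x => ?_⟩
    have := h x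
    simp only [PiLp.sub_apply, PiLp.smul_apply, smul_eq_mul, Pi.add_apply, Pi.smul_apply,
      Function.comp_apply]
    linear_combination x i * this

end

section

/-! ### Barycentric coordinates -/

variable {d : ℕ}

/-- The vertices of a simplex as an affine basis. -/
def vertexBasis (S : Simplex d) : AffineBasis (Fin (d + 1)) ℝ (E d) :=
  ⟨S.points, S.independent, by
    rw [S.independent.affineSpan_eq_top_iff_card_eq_finrank_add_one]; simp⟩

/-- The `i`-th barycentric coordinate. -/
def bary (S : Simplex d) (i : Fin (d + 1)) : E d → ℝ := (vertexBasis S).coord i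

variable (S : Simplex d) (i : Fin (d + 1))

theorem bary_lineMap (x y : E d) (t : ℝ) :
    bary S i (x + t • (y - x)) = bary S i x + t * (bary S i y - bary S i x) := by
  have := ((vertexBasis S).coord i).apply_lineMap x y t
  rw [AffineMap.lineMap_apply, AffineMap.lineMap_apply] at this
  simp only [vsub_eq_sub, vadd_eq_add, smul_eq_mul] at this
  rw [bary, add_comm x, this]
  ring

theorem sum_bary (x : E d) : ∑ j, bary S j x = 1 := (vertexBasis S).sum_coord_apply_eq_one x

theorem sum_bary_smul (x : E d) : ∑ j, bary S j x • S.points j = x :=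
  (vertexBasis S).linear_combination_coord_eq_self x

theorem bary_point [DecidableEq (Fin (d + 1))] (j : Fin (d + 1)) :
    bary S i (S.points j) = if i = j then 1 else 0 :=
  (vertexBasis S).coord_apply i j

theorem bary_point_self : bary S i (S.points i) = 1 := (vertexBasis S).coord_apply_eq i

theorem bary_point_ne {i j : Fin (d + 1)} (h : i ≠ j) : bary S i (S.points j) = 0 :=
  (vertexBasis S).coord_apply_ne h

theorem body_eq : body S = {x | ∀ j, 0 ≤ bary S j x} :=
  (vertexBasis S).convexHull_eq_nonneg_coord

theorem mem_body {x : E d} : x ∈ body S ↔ ∀ j, 0 ≤ bary S j x := by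
  rw [body_eq]; rfl

theorem interior_body : interior (body S) = {x | ∀ j, 0 < bary S j x} :=
  (vertexBasis S).interior_convexHull

theorem mem_interior_body {x : E d} : x ∈ interior (body S) ↔ ∀ j, 0 < bary S j x := by
  rw [interior_body]; rfl

/-- An affine function is determined by its values at the origin and at the unit vectors. -/
theorem isPoly_bary : IsPoly 1 (bary S i) := by
  have h : bary S i = (fun _ => bary S i 0) +
      ∑ m, (bary S i (EuclideanSpace.single m 1) - bary S i 0) • fun x : E d => x m := by
    ext x
    have hlin : ∀ v : E d, bary S i v = ((vertexBasis S).coord i).linear v + bary S i 0 := by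
      intro v
      have := ((vertexBasis S).coord i).map_vadd 0 v
      rwa [vadd_eq_add, add_zero, vadd_eq_add] at this
    have hx : x = ∑ m, x m • EuclideanSpace.single m (1 : ℝ) := by
      ext m
      simp [Finset.sum_apply, Pi.single_apply]
    rw [hlin x]
    conv_lhs => rw [hx, map_sum]
    simp only [map_smul, Pi.add_apply, Finset.sum_apply, Pi.smul_apply, smul_eq_mul, hlin
      (EuclideanSpace.single _ (1 : ℝ))]
    simp only [add_sub_cancel_right]
    rw [add_comm]
    congr 1
    exact Finset.sum_congr rfl fun m _ => mul_comm _ _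
  rw [h]
  exact (isPoly_const _ _).add (IsPoly.sum fun m _ => (isPoly_coord m).smul _)

theorem continuous_bary : Continuous (bary S i) := (isPoly_bary S i).continuous

theorem isCompact_body : IsCompact (body S) :=
  (finite_range _).isCompact_convexHull ℝ

theorem convex_body : Convex ℝ (body S) := convex_convexHull _ _

theorem measurableSet_body : MeasurableSet (body S) := (isCompact_body S).measurableSet

theorem interior_body_nonempty : (interior (body S)).Nonempty :=
  ⟨_, (vertexBasis S).centroid_mem_interior_convexHull⟩

theorem closure_interior_body : closure (interior (body S)) = body S := by
  rw [(convex_body S).closure_interior_eq_closure_of_nonempty_interior (interior_body_nonempty S),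
    (isCompact_body S).isClosed.closure_eq]

/-- If the `i`-th coordinate vanishes, the barycentric representation is already a convex
combination of the other vertices. This turns faces into sets cut out by affine inequalities. -/
theorem mem_face {x : E d} : x ∈ face S i ↔ (∀ j, 0 ≤ bary S j x) ∧ bary S i x = 0 := by
  constructor
  · intro hx
    have h1 : x ∈ body S := convexHull_mono (image_subset_range _ _) hx
    refine ⟨(mem_body S).1 h1, ?_⟩
    have hc : Convex ℝ {y : E d | bary S i y = 0} :=
      (convex_singleton (0 : ℝ)).affine_preimage ((vertexBasis S).coord i)
    refine convexHull_min ?_ hc hx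
    rintro _ ⟨j, hj, rfl⟩
    exact bary_point_ne S (Ne.symm hj)
  · rintro ⟨h0, hi⟩
    have hs : ∑ j ∈ Finset.univ.erase i, bary S j x = 1 := by
      rw [← sum_bary S x, ← Finset.add_sum_erase _ _ (Finset.mem_univ i), hi, zero_add]
    have hx : ∑ j ∈ Finset.univ.erase i, bary S j x • S.points j = x := by
      conv_rhs => rw [← sum_bary_smul S x, ← Finset.add_sum_erase _ _ (Finset.mem_univ i), hi,
        zero_smul, zero_add]
    rw [← hx]
    exact (convex_convexHull ℝ _).sum_mem (fun j _ => h0 j) hs fun j hj =>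
      subset_convexHull _ _ ⟨j, by simpa using hj, rfl⟩

theorem face_subset_body : face S i ⊆ body S := fun _ hx => (mem_body S).2 ((mem_face S i).1 hx).1

theorem isCompact_face : IsCompact (face S i) :=
  ((toFinite _).image _).isCompact_convexHull ℝ

theorem measurableSet_face : MeasurableSet (face S i) := (isCompact_face S i).measurableSet

section Normal

variable [NeZero d]

theorem height_eq : S.height i = ‖S.altitudeFoot i - S.points i‖ := by
  rw [Affine.Simplex.height, dist_comm, dist_eq_norm]

theorem normal_eq : normal S i = (S.height i)⁻¹ • (S.altitudeFoot i - S.points i) := by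
  rw [height_eq]; rfl

theorem norm_normal : ‖normal S i‖ = 1 := by
  rw [normal_eq, norm_smul, ← height_eq, norm_inv, Real.norm_of_nonneg (S.height_pos i).le,
    inv_mul_cancel₀ (S.height_pos i).ne']

theorem altitudeFoot_eq : S.altitudeFoot i = S.points i + S.height i • normal S i := by
  rw [normal_eq, smul_smul, mul_inv_cancel₀ (S.height_pos i).ne', one_smul, add_sub_cancel]

/-- Expand the foot minus `x` in the differences between the foot and the vertices. Those for the
vertices of the face are orthogonal to the normal, so only the `i`-th term survives. In particular
the gradient of the coordinate is minus the unit normal divided by the height. -/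
theorem bary_eq_inner (x : E d) : bary S i x =
    inner ℝ (S.altitudeFoot i - x) (normal S i) / S.height i := by
  have hx : S.altitudeFoot i - x = ∑ j, bary S j x • (S.altitudeFoot i - S.points j) := by
    simp only [smul_sub, Finset.sum_sub_distrib, ← Finset.sum_smul, sum_bary, sum_bary_smul,
      one_smul]
  have hh := S.height_pos i
  rw [hx, sum_inner, Finset.sum_eq_single i]
  · rw [real_inner_smul_left, normal_eq, real_inner_smul_right, real_inner_self_eq_norm_sq,
      ← height_eq]
    field_simp
  · intro j _ hj
    have : inner ℝ (S.points j - S.altitudeFoot i) (S.points i - S.altitudeFoot i) = 0 :=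
      S.inner_vsub_altitudeFoot_vsub_altitudeFoot_eq_zero hj.symm
    rw [← neg_sub, ← neg_sub (S.altitudeFoot i), inner_neg_neg] at this
    rw [real_inner_smul_left, normal_eq, real_inner_smul_right, this]
    simp
  · simp

theorem bary_add (x v : E d) :
    bary S i (x + v) = bary S i x - inner ℝ v (normal S i) / S.height i := by
  rw [bary_eq_inner, bary_eq_inner, ← sub_sub, inner_sub_left, sub_div]

theorem bary_altitudeFoot : bary S i (S.altitudeFoot i) = 0 := by
  rw [bary_eq_inner]; simp

theorem hasFDerivAt_bary (x : E d) :
    HasFDerivAt (bary S i) (-((S.height i)⁻¹ • innerSL ℝ (normal S i))) x := by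
  have h : bary S i = fun x => bary S i 0 + (-((S.height i)⁻¹ • innerSL ℝ (normal S i))) x := by
    ext x
    have := bary_add S i 0 x
    rw [zero_add] at this
    rw [this]
    simp [real_inner_comm, div_eq_inv_mul, sub_eq_add_neg]
  rw [h]
  exact (ContinuousLinearMap.hasFDerivAt _).const_add _

/-! ### Coordinates adapted to a face -/

/-- The direction of the hyperplane of the `i`-th face. -/
abbrev FaceDir : Submodule ℝ (E d) := (Submodule.span ℝ {normal S i})ᗮ

theorem inner_faceDir (y : FaceDir S i) : inner ℝ (y : E d) (normal S i) = 0 := by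
  rw [real_inner_comm]
  exact Submodule.mem_orthogonal_singleton_iff_inner_right.1 y.2

theorem bary_foot_add (t : ℝ) (y : FaceDir S i) :
    bary S i (S.altitudeFoot i + (t • normal S i + y)) = -t / S.height i := by
  rw [bary_add, bary_altitudeFoot, inner_add_left, inner_faceDir, real_inner_smul_left,
    real_inner_self_eq_norm_sq, norm_normal]
  ring

theorem finrank_faceDir : Module.finrank ℝ (FaceDir S i) = d - 1 := by
  have h := (Submodule.span ℝ {normal S i}).finrank_add_finrank_orthogonal
  have hn : normal S i ≠ 0 := by
    intro h0
    have := norm_normal S i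
    simp [h0] at this
  rw [finrank_span_singleton hn, finrank_euclideanSpace_fin] at h
  have h' : 1 + Module.finrank ℝ (FaceDir S i) = d := h
  omega

/-- The orthogonal splitting into the normal line and the direction of the face, with the normal
line identified isometrically with ℝ. This is the form in which Fubini is applied. -/
theorem measurePreserving_normalCoord : MeasurePreserving
    (fun z : ℝ × FaceDir S i => S.altitudeFoot i + (z.1 • normal S i + (z.2 : E d))) := by
  have h1 := ((Submodule.span ℝ {normal S i}).measurePreserving_measurableEquivProd
    (S.altitudeFoot i)).symm
  have h2 := (LinearIsometryEquiv.toSpanUnitSingleton (𝕜 := ℝ) (normal S i)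
    (norm_normal S i)).measurePreserving
  have h3 : MeasurePreserving (Prod.map (LinearIsometryEquiv.toSpanUnitSingleton (𝕜 := ℝ)
      (normal S i) (norm_normal S i)) (id : FaceDir S i → FaceDir S i)) volume volume :=
    h2.prod (MeasurePreserving.id _)
  rw [InnerProductSpace.euclideanHausdorffMeasure_eq_volume] at h1
  have h4 : (fun z : ℝ × FaceDir S i => S.altitudeFoot i + (z.1 • normal S i + (z.2 : E d))) =
      ⇑((Submodule.span ℝ {normal S i}).measurableEquivProd (S.altitudeFoot i)).symm ∘
      Prod.map (LinearIsometryEquiv.toSpanUnitSingleton (𝕜 := ℝ)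
      (normal S i) (norm_normal S i)) id := by
    funext z
    simp [add_comm]
  rw [h4]
  exact h1.comp h3

theorem isometry_faceCoord :
    Isometry (fun y : FaceDir S i => S.altitudeFoot i + (y : E d)) :=
  (IsometryEquiv.addLeft (S.altitudeFoot i)).isometry.comp isometry_subtype_coe

theorem range_faceCoord :
    range (fun y : FaceDir S i => S.altitudeFoot i + (y : E d)) = {x | bary S i x = 0} := by
  ext x
  constructor
  · rintro ⟨y, rfl⟩
    have := bary_foot_add S i 0 y
    simpa using this
  · intro hx
    refine ⟨⟨x - S.altitudeFoot i, ?_⟩, by simp⟩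
    rw [Submodule.mem_orthogonal_singleton_iff_inner_right, real_inner_comm]
    have h := bary_eq_inner S i x
    rw [mem_ofPred_eq] at hx
    rw [hx, eq_comm, div_eq_zero_iff, or_iff_left (S.height_pos i).ne'] at h
    rw [← neg_sub, inner_neg_left, h, neg_zero]

/-- Surface measure on the `i`-th face. -/
def faceMeasure : Measure (E d) :=
  (Measure.euclideanHausdorffMeasure (d - 1) : Measure (E d)).restrict (face S i)

theorem faceInt_eq (g : E d → ℝ) : faceInt S i g = ∫ x, g x ∂faceMeasure S i := rfl

/-- Hausdorff measure is transported by isometries and agrees with Lebesgue measure on the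
(d-1)-dimensional direction space, so face integrals become ordinary Lebesgue integrals. -/
theorem faceMeasure_eq_map : faceMeasure S i =
    ((volume : Measure (FaceDir S i)).restrict
      ((fun y : FaceDir S i => S.altitudeFoot i + (y : E d)) ⁻¹' face S i)).map
      (fun y : FaceDir S i => S.altitudeFoot i + (y : E d)) := by
  have hm := (isometry_faceCoord S i).map_euclideanHausdorffMeasure (d := d - 1)
  have hv : (Measure.euclideanHausdorffMeasure (d - 1) : Measure (FaceDir S i)) = volume := by
    rw [← finrank_faceDir S i, InnerProductSpace.euclideanHausdorffMeasure_eq_volume]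
  have hsub : face S i ⊆ range (fun y : FaceDir S i => S.altitudeFoot i + (y : E d)) := by
    rw [range_faceCoord]
    exact fun x hx => ((mem_face S i).1 hx).2
  rw [← Measure.restrict_map (isometry_faceCoord S i).continuous.measurable
    (measurableSet_face S i), ← hv, hm, Measure.restrict_restrict (measurableSet_face S i),
    inter_eq_left.2 hsub, faceMeasure]

theorem measurableEmbedding_faceCoord :
    MeasurableEmbedding (fun y : FaceDir S i => S.altitudeFoot i + (y : E d)) :=
  (isometry_faceCoord S i).isClosedEmbedding.measurableEmbedding

theorem faceInt_eq_setIntegral (g : E d → ℝ) : faceInt S i g =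
    ∫ y in (fun y : FaceDir S i => S.altitudeFoot i + (y : E d)) ⁻¹' face S i,
      g (S.altitudeFoot i + y) := by
  rw [faceInt_eq, faceMeasure_eq_map, (measurableEmbedding_faceCoord S i).integral_map]

theorem isCompact_preimage_face :
    IsCompact ((fun y : FaceDir S i => S.altitudeFoot i + (y : E d)) ⁻¹' face S i) :=
  (isometry_faceCoord S i).isClosedEmbedding.isCompact_preimage (isCompact_face S i)

instance isFiniteMeasure_faceMeasure : IsFiniteMeasure (faceMeasure S i) := by
  rw [faceMeasure_eq_map]
  have : IsFiniteMeasure ((volume : Measure (FaceDir S i)).restrict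
      ((fun y : FaceDir S i => S.altitudeFoot i + (y : E d)) ⁻¹' face S i)) :=
    ⟨by simpa using (isCompact_preimage_face S i).measure_lt_top⟩
  infer_instance

theorem faceMeasure_ae_mem : ∀ᵐ x ∂faceMeasure S i, x ∈ face S i :=
  ae_restrict_mem (measurableSet_face S i)

end Normal

end

section

/-! ### Integration over simplices and faces -/

variable {d : ℕ} (S : Simplex d) (i : Fin (d + 1))

theorem exists_bary_eq (c : Fin (d + 1) → ℝ) (hc : ∑ j, c j = 1) : ∃ x, ∀ j, bary S j x = c j :=
  ⟨Finset.univ.affineCombination ℝ (vertexBasis S) c, fun j =>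
    (vertexBasis S).coord_apply_combination_of_mem (Finset.mem_univ j) hc⟩

/-- The barycentre of the face, with all d remaining coordinates equal to 1/d. It serves as a point
of the relative interior. -/
theorem exists_faceCenter [NeZero d] : ∃ x, bary S i x = 0 ∧ ∀ j, j ≠ i → 0 < bary S j x := by
  classical
  have hd : (0 : ℝ) < d := Nat.cast_pos.2 (NeZero.pos d)
  obtain ⟨x, hx⟩ := exists_bary_eq S (fun j => if j = i then 0 else 1 / (d : ℝ)) (by
    rw [← Finset.add_sum_erase _ _ (Finset.mem_univ i), if_pos rfl, zero_add,
      Finset.sum_congr rfl (g := fun _ => 1 / (d : ℝ))]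
    · simp [Finset.card_erase_of_mem]
    · intro j hj
      rw [if_neg (Finset.ne_of_mem_erase hj)])
  refine ⟨x, by simp [hx], fun j hj => ?_⟩
  rw [hx, if_neg hj]
  positivity

theorem integrable_faceMeasure [NeZero d] {V : Type*} [NormedAddCommGroup V] {g : E d → V}
    (hg : ContinuousOn g (face S i)) : Integrable g (faceMeasure S i) := by
  have hfin : (Measure.euclideanHausdorffMeasure (d - 1) : Measure (E d)) (face S i) ≠ ⊤ := by
    have := (isFiniteMeasure_faceMeasure S i).measure_univ_lt_top
    rw [faceMeasure, Measure.restrict_apply_univ] at this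
    exact this.ne
  obtain ⟨C, hC⟩ := (isCompact_face S i).exists_bound_of_continuousOn hg
  refine Integrable.of_bound (hg.aestronglyMeasurable (measurableSet_face S i)) C ?_
  filter_upwards [faceMeasure_ae_mem S i] with x hx using hC x hx

theorem integrableOn_body {V : Type*} [NormedAddCommGroup V] {g : E d → V}
    (hg : ContinuousOn g (body S)) : IntegrableOn g (body S) :=
  hg.integrableOn_compact (isCompact_body S)

/-- A nonnegative continuous function with zero integral over a face vanishes on the face. -/
theorem eq_zero_of_faceInt_eq_zero [NeZero d] {g : E d → ℝ} (hg : ContinuousOn g (face S i))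
    (h0 : ∀ x ∈ face S i, 0 ≤ g x) (h : faceInt S i g = 0) : ∀ x ∈ face S i, g x = 0 := by
  set ι : FaceDir S i → E d := fun y => S.altitudeFoot i + (y : E d) with hι
  have hιc : Continuous ι := (isometry_faceCoord S i).continuous
  set P := ι ⁻¹' face S i with hP
  have hPm : MeasurableSet P := hιc.measurable (measurableSet_face S i)
  have hgc : ContinuousOn (g ∘ ι) P := hg.comp hιc.continuousOn (mapsTo_preimage _ _)
  have hb0 : ∀ y, bary S i (ι y) = 0 := fun y => by
    have : ι y ∈ range ι := mem_range_self y
    rw [hι, range_faceCoord] at this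
    exact this
  have hconv : Convex ℝ P := by
    have : P = (AffineMap.const ℝ (FaceDir S i) (S.altitudeFoot i) +
      ((FaceDir S i).subtype.toAffineMap)) ⁻¹' face S i := rfl
    rw [this]
    exact (convex_convexHull ℝ _).affine_preimage _
  have hint : (interior P).Nonempty := by
    obtain ⟨x, hx0, hx⟩ := exists_faceCenter S i
    obtain ⟨y, rfl⟩ : x ∈ range ι := by rw [hι, range_faceCoord]; exact hx0
    refine ⟨y, mem_interior.2 ⟨ι ⁻¹' {z | ∀ j, j ≠ i → 0 < bary S j z}, ?_, ?_, hx⟩⟩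
    · intro z hz
      refine (mem_face S i).2 ⟨fun j => ?_, hb0 z⟩
      by_cases hj : j = i
      · subst hj; exact (hb0 z).ge
      · exact (hz j hj).le
    · refine IsOpen.preimage hιc ?_
      simp only [ofPred_forall]
      exact isOpen_iInter_of_finite fun j => isOpen_iInter_of_finite fun _ =>
        isOpen_lt continuous_const (continuous_bary S j)
  -- Passing from almost everywhere to everywhere needs each point of the face to be a limit of
  -- relative interior points. A convex set with nonempty interior has this property.
  have hcl : P ⊆ closure (interior P) := by
    rw [hconv.closure_interior_eq_closure_of_nonempty_interior hint]
    exact subset_closure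
  have hae : g ∘ ι =ᵐ[volume.restrict P] 0 := by
    rw [faceInt_eq_setIntegral] at h
    refine (setIntegral_eq_zero_iff_of_nonneg_ae ?_ ?_).1 h
    · filter_upwards [ae_restrict_mem hPm] with y hy using h0 _ hy
    · exact hgc.integrableOn_compact (isCompact_preimage_face S i)
  have hEq := Measure.eqOn_of_ae_eq hae hgc continuousOn_const hcl
  intro x hx
  obtain ⟨y, rfl⟩ : x ∈ range ι := by rw [hι, range_faceCoord]; exact ((mem_face S i).1 hx).2
  exact hEq hx

theorem eq_zero_of_setIntegral_body_eq_zero {g : E d → ℝ} (hg : ContinuousOn g (body S))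
    (h0 : ∀ x ∈ body S, 0 ≤ g x) (h : ∫ x in body S, g x = 0) : ∀ x ∈ body S, g x = 0 := by
  have hae : g =ᵐ[volume.restrict (body S)] 0 := by
    refine (setIntegral_eq_zero_iff_of_nonneg_ae ?_ (integrableOn_body S hg)).1 h
    filter_upwards [ae_restrict_mem (measurableSet_body S)] with y hy using h0 _ hy
  exact Measure.eqOn_of_ae_eq hae hg continuousOn_const (closure_interior_body S).ge

/-- Within the hyperplane of the face the zero set of the `j`-th coordinate is a proper affine
subspace, since vertex `j` lies in the hyperplane and has coordinate one. Hence it is a null set. -/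
theorem faceMeasure_ae_bary_pos [NeZero d] {j : Fin (d + 1)} (hj : j ≠ i) :
    ∀ᵐ x ∂faceMeasure S i, 0 < bary S j x := by
  have hae : ∀ᵐ y : FaceDir S i, bary S j (S.altitudeFoot i + (y : E d)) ≠ 0 := by
    let f : FaceDir S i →ᵃ[ℝ] ℝ := ((vertexBasis S).coord j).comp
      (AffineMap.const ℝ (FaceDir S i) (S.altitudeFoot i) + (FaceDir S i).subtype.toAffineMap)
    let A := (AffineSubspace.mk' (0 : ℝ) ⊥).comap f
    have hA : A ≠ ⊤ := by
      intro htop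
      obtain ⟨y, hy⟩ : S.points j ∈ range (fun y : FaceDir S i => S.altitudeFoot i + (y : E d)) := by
        rw [range_faceCoord]
        exact bary_point_ne S hj.symm
      have hyA : y ∈ A := htop ▸ AffineSubspace.mem_top _ _ _
      have hf : f y = 0 := by simpa [A] using hyA
      have : f y = bary S j (S.altitudeFoot i + (y : E d)) := rfl
      rw [this] at hf
      simp only at hy
      rw [hy, bary_point_self] at hf
      exact one_ne_zero hf
    have := Measure.addHaar_affineSubspace volume A hA
    rw [ae_iff]
    convert this using 2
    ext y
    simp only [ne_eq, not_not, mem_ofPred_eq, A, SetLike.mem_coe, AffineSubspace.mem_comap,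
      AffineSubspace.mem_mk', vsub_eq_sub, sub_zero, Submodule.mem_bot]
    rfl
  rw [faceMeasure_eq_map, (measurableEmbedding_faceCoord S i).ae_map_iff]
  have hm : MeasurableSet ((fun y : FaceDir S i => S.altitudeFoot i + (y : E d)) ⁻¹' face S i) :=
    (isometry_faceCoord S i).continuous.measurable (measurableSet_face S i)
  filter_upwards [ae_restrict_of_ae hae, ae_restrict_mem hm] with y hy hy'
  exact lt_of_le_of_ne (((mem_face S i).1 hy').1 j) (Ne.symm hy)

theorem bary_cone (j : Fin (d + 1)) (y : E d) (s : ℝ) :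
    bary S j (y + s • (S.points i - y)) =
      (1 - s) * bary S j y + s * bary S j (S.points i) := by
  rw [bary_lineMap]; ring

/-- Moving towards vertex `i` multiplies every other barycentric coordinate by 1 - s > 0, so signs
are preserved. -/
theorem cone_mem_body_iff {y : E d} (hy : bary S i y = 0) {s : ℝ} (h0 : 0 ≤ s) (h1 : s < 1) :
    y + s • (S.points i - y) ∈ body S ↔ y ∈ face S i := by
  rw [mem_body, mem_face]
  constructor
  · intro h
    refine ⟨fun j => ?_, hy⟩
    by_cases hj : j = i
    · subst hj; exact hy.ge
    · have := h j
      rw [bary_cone, bary_point_ne S hj, mul_zero, add_zero] at this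
      exact nonneg_of_mul_nonneg_right this (by linarith)
  · rintro ⟨h, -⟩ j
    rw [bary_cone]
    have hp : 0 ≤ bary S j (S.points i) :=
      (mem_body S).1 (subset_convexHull ℝ _ (mem_range_self i)) j
    have := h j
    have : 0 ≤ 1 - s := by linarith
    positivity

/-- Integration over a simplex in cone coordinates with apex at the `i`-th vertex. -/
theorem setIntegral_body_eq_cone [NeZero d] {g : E d → ℝ} (hg : ContinuousOn g (body S)) :
    ∫ x in body S, g x = S.height i * ∫ s in Ioo (0 : ℝ) 1,
      (1 - s) ^ (d - 1) * faceInt S i (fun y => g (y + s • (S.points i - y))) := by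
  have hh := S.height_pos i
  set G := (body S).indicator g with hG
  have hGi : Integrable G := (integrable_indicator_iff (measurableSet_body S)).2
    (integrableOn_body S hg)
  have hmp := measurePreserving_normalCoord S i
  set φ := fun z : ℝ × FaceDir S i => S.altitudeFoot i + (z.1 • normal S i + (z.2 : E d)) with hφ
  have hφe : MeasurableEmbedding φ := by
    have h := ((Submodule.span ℝ {normal S i}).measurableEquivProd
      (S.altitudeFoot i)).symm.measurableEmbedding
    have h3 := (((LinearIsometryEquiv.toSpanUnitSingleton (𝕜 := ℝ) (normal S i)
      (norm_normal S i)).toHomeomorph.prodCongr (Homeomorph.refl (FaceDir S i)))).measurableEmbedding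
    have h4 : φ = ⇑((Submodule.span ℝ {normal S i}).measurableEquivProd (S.altitudeFoot i)).symm ∘
        ((LinearIsometryEquiv.toSpanUnitSingleton (𝕜 := ℝ) (normal S i)
      (norm_normal S i)).toHomeomorph.prodCongr (Homeomorph.refl (FaceDir S i))) := by
      funext z
      simp [hφ, add_comm]
    rw [h4]
    exact h.comp h3
  rw [← integral_indicator (measurableSet_body S), ← hG, ← hmp.integral_comp hφe,
    Measure.volume_eq_prod, integral_prod (fun z => G (φ z)) ((hmp.integrable_comp_emb hφe).2 hGi)]
  -- The substitution t = -h s along the normal makes the parameter equal to the `i`-th barycentric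
  -- coordinate and produces the factor h.
  have hsub := Measure.integral_comp_mul_left (fun t => ∫ y : FaceDir S i, G (φ (t, y)))
    (-S.height i)
  rw [abs_inv, abs_neg, abs_of_pos hh, eq_comm, smul_eq_mul, inv_mul_eq_iff_eq_mul₀ hh.ne'] at hsub
  rw [hsub]
  congr 1
  rw [← integral_indicator measurableSet_Ioo]
  refine integral_congr_ae ?_
  have hne : ∀ᵐ s : ℝ, s ≠ 0 ∧ s ≠ 1 := by
    have h0 : ∀ᵐ s : ℝ, s ≠ 0 := by simp [ae_iff]
    have h1 : ∀ᵐ s : ℝ, s ≠ 1 := by simp [ae_iff]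
    exact h0.and h1
  filter_upwards [hne] with s hs
  have hbi : ∀ y : FaceDir S i, bary S i (φ (-S.height i * s, y)) = s := fun y => by
    rw [hφ, bary_foot_add]; field_simp
  by_cases hs' : s ∈ Ioo (0 : ℝ) 1
  · rw [indicator_of_mem hs']
    have h1s : 0 < 1 - s := by linarith [hs'.2]
    -- The slice at level s is the face shrunk by 1 - s. Scaling back in dimension d - 1 gives the
    -- weight (1 - s)^(d-1).
    have hsc := Measure.integral_comp_smul (volume : Measure (FaceDir S i))
      (fun y => G (φ (-S.height i * s, y))) (1 - s)
    rw [finrank_faceDir, abs_of_pos (by positivity), eq_comm, smul_eq_mul,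
      inv_mul_eq_iff_eq_mul₀ (by positivity)] at hsc
    rw [hsc]
    congr 1
    rw [faceInt_eq_setIntegral, ← integral_indicator
      ((isometry_faceCoord S i).continuous.measurable (measurableSet_face S i))]
    congr 1
    funext z
    have hx : φ (-S.height i * s, (1 - s) • z) = S.altitudeFoot i + (z : E d) +
        s • (S.points i - (S.altitudeFoot i + (z : E d))) := by
      simp only [hφ, altitudeFoot_eq, Submodule.coe_smul]
      module
    have hz : bary S i (S.altitudeFoot i + (z : E d)) = 0 := by
      simpa using bary_foot_add S i 0 z
    rw [hx, hG]
    by_cases hm : S.altitudeFoot i + (z : E d) ∈ face S i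
    · rw [indicator_of_mem ((cone_mem_body_iff S i hz hs'.1.le hs'.2).2 hm),
        indicator_of_mem (by exact hm)]
    · rw [indicator_of_notMem (fun h => hm ((cone_mem_body_iff S i hz hs'.1.le hs'.2).1 h)),
        indicator_of_notMem (by exact hm)]
  -- Barycentric coordinates of points of the simplex lie in [0, 1], so the other slices are empty.
  -- The two endpoint values of s were discarded as a null set.
  · rw [indicator_of_notMem hs']
    have : ∀ y : FaceDir S i, G (φ (-S.height i * s, y)) = 0 := by
      intro y
      refine indicator_of_notMem (fun hm => hs' ?_) _
      have h0 := (mem_body S).1 hm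
      have h1 := sum_bary S (φ (-S.height i * s, y))
      have h2 : bary S i (φ (-S.height i * s, y)) ≤ 1 := by
        rw [← h1]
        exact Finset.single_le_sum (fun j _ => h0 j) (Finset.mem_univ i)
      have h3 := h0 i
      rw [hbi] at h2 h3
      exact ⟨lt_of_le_of_ne h3 (Ne.symm hs.1), lt_of_le_of_ne h2 hs.2⟩
    simp only [this, integral_zero]

end

section

/-! ### The divergence theorem on a simplex for fields with a weak divergence -/

open Filter Topology

/-- A smooth cutoff that vanishes on `(-∞, 1/2]` and equals one on `[1, ∞)`. -/
def cutoff (s : ℝ) : ℝ := Real.smoothTransition (2 * s - 1)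

theorem contDiff_cutoff : ContDiff ℝ ∞ cutoff :=
  Real.smoothTransition.contDiff.comp (by fun_prop)

theorem cutoff_nonneg (s : ℝ) : 0 ≤ cutoff s := Real.smoothTransition.nonneg _

theorem cutoff_le_one (s : ℝ) : cutoff s ≤ 1 := Real.smoothTransition.le_one _

theorem cutoff_of_le {s : ℝ} (h : s ≤ 1 / 2) : cutoff s = 0 :=
  Real.smoothTransition.zero_of_nonpos (by linarith)

theorem cutoff_of_ge {s : ℝ} (h : 1 ≤ s) : cutoff s = 1 :=
  Real.smoothTransition.one_of_one_le (by linarith)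

theorem continuous_deriv_cutoff : Continuous (deriv cutoff) :=
  contDiff_cutoff.continuous_deriv (by simp)

theorem deriv_cutoff_of_one_lt {s : ℝ} (h : 1 < s) : deriv cutoff s = 0 := by
  have : cutoff =ᶠ[𝓝 s] fun _ => 1 := by
    filter_upwards [lt_mem_nhds h] with t ht using cutoff_of_ge ht.le
  rw [this.deriv_eq, deriv_const]

/-- The total mass one is what turns the boundary layers of the cut-off functions into face
integrals without an extra factor. -/
theorem integral_deriv_cutoff : ∫ s in Ioo (0 : ℝ) 1, deriv cutoff s = 1 := by
  rw [← integral_Ioc_eq_integral_Ioo, ← intervalIntegral.integral_of_le zero_le_one,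
    intervalIntegral.integral_deriv_eq_sub
      (fun x _ => contDiff_cutoff.differentiable (by simp) x)
      (continuous_deriv_cutoff.intervalIntegrable _ _), cutoff_of_ge le_rfl,
    cutoff_of_le (by norm_num), sub_zero]

variable {d : ℕ} [NeZero d] (S : Simplex d)

/-- A smooth cutoff to the interior of the simplex, approaching its indicator as `c → ∞`. -/
def bodyCutoff (c : ℝ) (x : E d) : ℝ := ∏ j, cutoff (c * bary S j x)

theorem contDiff_bodyCutoff (c : ℝ) : ContDiff ℝ ∞ (bodyCutoff S c) :=
  contDiff_prod fun j _ => contDiff_cutoff.comp (contDiff_const.mul (isPoly_bary S j).contDiff)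

theorem tsupport_bodyCutoff {c : ℝ} (hc : 0 < c) :
    tsupport (bodyCutoff S c) ⊆ interior (body S) := by
  -- The cutoff vanishes up to 1/2 and not only up to 0. The support therefore lies in this closed
  -- set, which stays away from the faces.
  have hcl : IsClosed {x | ∀ j, 1 / 2 ≤ c * bary S j x} := by
    simp only [ofPred_forall]
    exact isClosed_iInter fun j =>
      isClosed_le continuous_const (continuous_const.mul (continuous_bary S j))
  have hsub : Function.support (bodyCutoff S c) ⊆ {x | ∀ j, 1 / 2 ≤ c * bary S j x} := by
    intro x hx j
    by_contra hlt
    exact hx (Finset.prod_eq_zero (Finset.mem_univ j) (cutoff_of_le (not_le.1 hlt).le))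
  refine (closure_minimal hsub hcl).trans fun x hx => (mem_interior_body S).2 fun j => ?_
  have : 0 < c * bary S j x := lt_of_lt_of_le (by norm_num) (hx j)
  exact pos_of_mul_pos_right this hc.le

theorem hasCompactSupport_bodyCutoff {c : ℝ} (hc : 0 < c) :
    HasCompactSupport (bodyCutoff S c) :=
  (isCompact_body S).of_isClosed_subset (isClosed_tsupport _)
    ((tsupport_bodyCutoff S hc).trans interior_subset)

/-- Product rule with the gradient -n_i/h_i of the `i`-th barycentric coordinate: one boundary layer
for each face, directed along its inward normal. -/
theorem inner_gradient_bodyCutoff (c : ℝ) (x v : E d) :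
    inner ℝ v (gradient (bodyCutoff S c) x) = ∑ i, -((S.height i)⁻¹ * (c *
      (deriv cutoff (c * bary S i x) * (∏ j ∈ Finset.univ.erase i, cutoff (c * bary S j x)) *
        inner ℝ v (normal S i)))) := by
  have h1 : ∀ i ∈ Finset.univ, HasFDerivAt (fun x => cutoff (c * bary S i x))
      (deriv cutoff (c * bary S i x) • (c • (-((S.height i)⁻¹ • innerSL ℝ (normal S i))))) x := by
    intro i _
    have h2 : HasDerivAt cutoff (deriv cutoff (c * bary S i x)) (c * bary S i x) :=
      (contDiff_cutoff.differentiable (by simp) _).hasDerivAt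
    exact HasDerivAt.comp_hasFDerivAt (h₂ := cutoff) x h2 ((hasFDerivAt_bary S i x).const_mul c)
  have h3 := HasFDerivAt.finsetProd h1
  have h4 : HasFDerivAt (bodyCutoff S c) _ x := h3
  rw [real_inner_comm, gradient, InnerProductSpace.toDual_symm_apply, h4.fderiv]
  simp only [sum_apply, smul_apply,
    neg_apply, innerSL_apply_apply, smul_eq_mul, real_inner_comm v]
  exact Finset.sum_congr rfl fun i _ => by ring

theorem prod_cutoff_mem_Icc {ι : Type*} (s : Finset ι) (a : ι → ℝ) :
    ∏ j ∈ s, cutoff (a j) ∈ Icc (0 : ℝ) 1 :=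
  ⟨Finset.prod_nonneg fun _ _ => cutoff_nonneg _,
    Finset.prod_le_one (fun _ _ => cutoff_nonneg _) fun _ _ => cutoff_le_one _⟩

/-- The integrand over a face that arises when a cut-off function is integrated in cone
coordinates. -/
def coneIntegrand (i : Fin (d + 1)) (g : E d → ℝ) (c s : ℝ) (y : E d) : ℝ :=
  (∏ j ∈ Finset.univ.erase i, cutoff (c * bary S j (y + (s / c) • (S.points i - y)))) *
    g (y + (s / c) • (S.points i - y))

theorem cone_mem_body {i : Fin (d + 1)} {y : E d} (hy : y ∈ face S i) {s c : ℝ}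
    (hs : s ∈ Icc (0 : ℝ) 1) (hc : 1 < c) : y + (s / c) • (S.points i - y) ∈ body S :=
  (cone_mem_body_iff S i ((mem_face S i).1 hy).2 (div_nonneg hs.1 (by linarith))
    ((div_lt_one (by linarith)).2 (hs.2.trans_lt hc))).2 hy

theorem continuousOn_coneIntegrand (i : Fin (d + 1)) {g : E d → ℝ}
    (hg : ContinuousOn g (body S)) {c : ℝ} (hc : 1 < c) :
    ContinuousOn (fun p : ℝ × E d => coneIntegrand S i g c p.1 p.2) (Icc 0 1 ×ˢ face S i) := by
  have hcone : Continuous fun p : ℝ × E d => p.2 + (p.1 / c) • (S.points i - p.2) := by fun_prop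
  refine ContinuousOn.mul (Continuous.continuousOn ?_) (hg.comp hcone.continuousOn ?_)
  · exact continuous_finsetProd _ fun j _ => contDiff_cutoff.continuous.comp
      (continuous_const.mul ((continuous_bary S j).comp hcone))
  · exact fun p hp => cone_mem_body S hp.2 hp.1 hc

theorem abs_coneIntegrand_le {i : Fin (d + 1)} {g : E d → ℝ} {M : ℝ}
    (hM : ∀ x ∈ body S, ‖g x‖ ≤ M) {y : E d} (hy : y ∈ face S i) {s c : ℝ}
    (hs : s ∈ Icc (0 : ℝ) 1) (hc : 1 < c) : ‖coneIntegrand S i g c s y‖ ≤ M := by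
  have hp := prod_cutoff_mem_Icc (Finset.univ.erase i)
    (fun j => c * bary S j (y + (s / c) • (S.points i - y)))
  rw [coneIntegrand, norm_mul, Real.norm_of_nonneg hp.1]
  exact (mul_le_of_le_one_left (norm_nonneg _) hp.2).trans (hM _ (cone_mem_body S hy hs hc))

/-- Dominated convergence. At almost every point of the face the other barycentric coordinates are
positive, so the remaining cutoffs are eventually equal to one there, while the point of evaluation
converges to the face. -/
theorem tendsto_faceInt_cone (i : Fin (d + 1)) {g : E d → ℝ} (hg : ContinuousOn g (body S))
    {s : ℝ} (hs : s ∈ Icc (0 : ℝ) 1) :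
    Tendsto (fun c : ℝ => faceInt S i (coneIntegrand S i g c s)) atTop (𝓝 (faceInt S i g)) := by
  obtain ⟨M, hM⟩ := (isCompact_body S).exists_bound_of_continuousOn hg
  refine tendsto_integral_filter_of_dominated_convergence (μ := faceMeasure S i) (fun _ => M)
    ?_ ?_ (integrable_const M) ?_
  · filter_upwards [eventually_gt_atTop 1] with c hc
    refine (integrable_faceMeasure S i ?_).aestronglyMeasurable
    exact (continuousOn_coneIntegrand S i hg hc).comp (f := fun y => (s, y))
      (by fun_prop) fun y hy => ⟨hs, hy⟩
  · filter_upwards [eventually_gt_atTop 1] with c hc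
    filter_upwards [faceMeasure_ae_mem S i] with y hy using abs_coneIntegrand_le S hM hy hs hc
  · have hpos : ∀ᵐ y ∂faceMeasure S i, ∀ j, j ≠ i → 0 < bary S j y :=
      ae_all_iff.2 fun j => by
        by_cases hj : j = i
        · exact ae_of_all _ fun y h => absurd hj h
        · filter_upwards [faceMeasure_ae_bary_pos S i hj] with y hy _ using hy
    filter_upwards [faceMeasure_ae_mem S i, hpos] with y hy hpos
    have hlim : Tendsto (fun c : ℝ => y + (s / c) • (S.points i - y)) atTop (𝓝 y) := by
      have h0 : Tendsto (fun c : ℝ => s / c) atTop (𝓝 0) := tendsto_const_nhds.div_atTop tendsto_id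
      simpa using (h0.smul_const (S.points i - y)).const_add y
    have hlim' : Tendsto (fun c : ℝ => y + (s / c) • (S.points i - y)) atTop (𝓝[body S] y) := by
      refine tendsto_nhdsWithin_iff.2 ⟨hlim, ?_⟩
      filter_upwards [eventually_gt_atTop 1] with c hc using cone_mem_body S hy hs hc
    have hgl := (hg y (face_subset_body S i hy)).tendsto.comp hlim'
    refine hgl.congr' ?_
    have : ∀ᶠ c : ℝ in atTop, ∀ j, j ≠ i →
        1 ≤ c * bary S j (y + (s / c) • (S.points i - y)) := by
      refine eventually_all.2 fun j => ?_
      by_cases hj : j = i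
      · exact Eventually.of_forall fun c h => absurd hj h
      · have := tendsto_id.atTop_mul_pos (hpos j hj) (((continuous_bary S j).tendsto y).comp hlim)
        filter_upwards [this.eventually_ge_atTop 1] with c hc _ using hc
    filter_upwards [this] with c hc
    rw [coneIntegrand, Finset.prod_eq_one fun j hj =>
      cutoff_of_ge (hc j (Finset.ne_of_mem_erase hj)), one_mul]
    rfl

/-- The layer has thickness of order 1/c. In cone coordinates, stretched by c, its integrand is the
derivative of the cutoff times an almost constant face integral. The weight (1 - s/c)^(d-1) tends to
one. -/
theorem tendsto_boundaryLayer (i : Fin (d + 1)) {g : E d → ℝ} (hg : ContinuousOn g (body S)) :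
    Tendsto (fun c : ℝ => (S.height i)⁻¹ * (c * ∫ x in body S, deriv cutoff (c * bary S i x) *
      (∏ j ∈ Finset.univ.erase i, cutoff (c * bary S j x)) * g x)) atTop
      (𝓝 (faceInt S i g)) := by
  obtain ⟨M, hM⟩ := (isCompact_body S).exists_bound_of_continuousOn hg
  obtain ⟨M', hM'⟩ := isCompact_Icc.exists_bound_of_continuousOn
    (continuous_deriv_cutoff.continuousOn (s := Icc (0 : ℝ) 1))
  have hlim : Tendsto (fun c : ℝ => ∫ s in Ioc (0 : ℝ) 1,
      (1 - s / c) ^ (d - 1) * (deriv cutoff s * faceInt S i (coneIntegrand S i g c s))) atTop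
      (𝓝 (∫ s in Ioc (0 : ℝ) 1, 1 ^ (d - 1) * (deriv cutoff s * faceInt S i g))) := by
    refine tendsto_integral_filter_of_dominated_convergence
      (fun _ => 1 * (M' * (M * (faceMeasure S i).real univ))) ?_ ?_ (integrable_const _) ?_
    · filter_upwards [eventually_gt_atTop 1] with c hc
      refine ContinuousOn.aestronglyMeasurable ?_ measurableSet_Ioc
      refine ContinuousOn.mul (by fun_prop) (continuous_deriv_cutoff.continuousOn.mul ?_)
      refine ContinuousOn.mono ?_ Ioc_subset_Icc_self
      refine continuousOn_of_dominated (μ := faceMeasure S i) (bound := fun _ => M) ?_ ?_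
        (integrable_const M) ?_
      · intro s hs
        refine (integrable_faceMeasure S i ?_).aestronglyMeasurable
        exact (continuousOn_coneIntegrand S i hg hc).comp (f := fun y => (s, y))
          (by fun_prop) fun y hy => ⟨hs, hy⟩
      · intro s hs
        filter_upwards [faceMeasure_ae_mem S i] with y hy using abs_coneIntegrand_le S hM hy hs hc
      · filter_upwards [faceMeasure_ae_mem S i] with y hy
        exact (continuousOn_coneIntegrand S i hg hc).comp (f := fun s => (s, y))
          (by fun_prop) fun s hs => ⟨hs, hy⟩
    · filter_upwards [eventually_gt_atTop 1] with c hc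
      filter_upwards [ae_restrict_mem measurableSet_Ioc] with s hs
      have hs' := Ioc_subset_Icc_self hs
      have hsc : s / c ∈ Icc (0 : ℝ) 1 :=
        ⟨div_nonneg hs'.1 (by linarith), (div_le_one (by linarith)).2 (hs'.2.trans hc.le)⟩
      rw [norm_mul, norm_mul, norm_pow]
      refine mul_le_mul (pow_le_one₀ (norm_nonneg _) ?_) (mul_le_mul (hM' s hs') ?_
        (norm_nonneg _) ((norm_nonneg _).trans (hM' s hs'))) (by positivity) zero_le_one
      · rw [Real.norm_of_nonneg (by linarith [hsc.2])]
        linarith [hsc.1]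
      · refine norm_integral_le_of_norm_le_const (μ := faceMeasure S i) ?_
        filter_upwards [faceMeasure_ae_mem S i] with y hy using abs_coneIntegrand_le S hM hy hs' hc
    · filter_upwards [ae_restrict_mem measurableSet_Ioc] with s hs
      refine Tendsto.mul (Tendsto.pow ?_ _) (tendsto_const_nhds.mul
        (tendsto_faceInt_cone S i hg (Ioc_subset_Icc_self hs)))
      have h0 : Tendsto (fun c : ℝ => s / c) atTop (𝓝 0) := tendsto_const_nhds.div_atTop tendsto_id
      simpa using h0.const_sub 1
  have hval : ∫ s in Ioc (0 : ℝ) 1, 1 ^ (d - 1) * (deriv cutoff s * faceInt S i g) =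
      faceInt S i g := by
    simp only [one_pow, one_mul]
    rw [integral_mul_const, integral_Ioc_eq_integral_Ioo, integral_deriv_cutoff, one_mul]
  rw [hval] at hlim
  refine hlim.congr' ?_
  filter_upwards [eventually_gt_atTop 1] with c hc
  have hc0 : 0 < c := by linarith
  have hcont : ContinuousOn (fun x => deriv cutoff (c * bary S i x) *
      (∏ j ∈ Finset.univ.erase i, cutoff (c * bary S j x)) * g x) (body S) := by
    refine ContinuousOn.mul (Continuous.continuousOn ?_) hg
    refine (continuous_deriv_cutoff.comp (continuous_const.mul (continuous_bary S i))).mul ?_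
    exact continuous_finsetProd _ fun j _ =>
      contDiff_cutoff.continuous.comp (continuous_const.mul (continuous_bary S j))
  rw [setIntegral_body_eq_cone S i hcont, mul_left_comm c, inv_mul_cancel_left₀ (S.height_pos i).ne',
    ← integral_Ioc_eq_integral_Ioo]
  -- The stretching s ↦ s/c consumes the prefactor c. The integral then runs over (0, c] and reduces
  -- to (0, 1], where the derivative of the cutoff lives.
  have hsub := intervalIntegral.integral_comp_div (a := 0) (b := c) (fun s => (1 - s) ^ (d - 1) *
    faceInt S i (fun y => deriv cutoff (c * bary S i (y + s • (S.points i - y))) *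
      (∏ j ∈ Finset.univ.erase i, cutoff (c * bary S j (y + s • (S.points i - y)))) *
        g (y + s • (S.points i - y)))) hc0.ne'
  rw [zero_div, div_self hc0.ne', smul_eq_mul, intervalIntegral.integral_of_le hc0.le,
    intervalIntegral.integral_of_le zero_le_one] at hsub
  rw [← hsub]
  have hface : ∀ s : ℝ, faceInt S i (fun y =>
      deriv cutoff (c * bary S i (y + (s / c) • (S.points i - y))) *
      (∏ j ∈ Finset.univ.erase i, cutoff (c * bary S j (y + (s / c) • (S.points i - y)))) *
        g (y + (s / c) • (S.points i - y))) =
      deriv cutoff s * faceInt S i (coneIntegrand S i g c s) := by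
    intro s
    rw [faceInt_eq, faceInt_eq, ← integral_const_mul]
    refine integral_congr_ae ?_
    filter_upwards [faceMeasure_ae_mem S i] with y hy
    have : c * bary S i (y + (s / c) • (S.points i - y)) = s := by
      rw [bary_cone, ((mem_face S i).1 hy).2, bary_point_self]
      field_simp
      ring
    rw [this, mul_assoc, coneIntegrand]
  simp only [hface]
  refine (setIntegral_eq_of_subset_of_forall_sdiff_eq_zero measurableSet_Ioc
    (Ioc_subset_Ioc_right hc.le) ?_).symm
  intro s hs
  have : 1 < s := by
    by_contra h
    exact hs.2 ⟨hs.1.1, not_lt.1 h⟩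
  rw [deriv_cutoff_of_one_lt this]
  simp

/-- Test the weak divergence with the smooth cutoffs of the simplex. As c → ∞ the right side tends
to the integral of the divergence by dominated convergence, and the gradient of the cutoff
concentrates on the faces. -/
theorem integral_eq_sum_faceInt_of_weakDiv {v : E d → E d} {g : E d → ℝ}
    (hv : ContinuousOn v (body S)) (hg : IntegrableOn g (body S))
    (h : ∀ φ : E d → ℝ, ContDiff ℝ ∞ φ → HasCompactSupport φ → tsupport φ ⊆ interior (body S) →
      ∫ x in body S, inner ℝ (v x) (gradient φ x) = - ∫ x in body S, g x * φ x) :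
    ∫ x in body S, g x = ∑ i, faceInt S i (fun x => inner ℝ (v x) (normal S i)) := by
  have hvn : ∀ i, ContinuousOn (fun x => inner ℝ (v x) (normal S i)) (body S) :=
    fun i => hv.inner continuousOn_const
  have h1 : Tendsto (fun c : ℝ => ∫ x in body S, g x * bodyCutoff S c x) atTop
      (𝓝 (∫ x in body S, g x)) := by
    refine tendsto_integral_filter_of_dominated_convergence (fun x => ‖g x‖) ?_ ?_ hg.norm ?_
    · exact Eventually.of_forall fun c => hg.aestronglyMeasurable.mul
        (contDiff_bodyCutoff S c).continuous.aestronglyMeasurable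
    · refine Eventually.of_forall fun c => ae_of_all _ fun x => ?_
      rw [norm_mul]
      refine mul_le_of_le_one_right (norm_nonneg _) ?_
      have h0 : 0 ≤ bodyCutoff S c x := Finset.prod_nonneg fun j _ => cutoff_nonneg _
      rw [Real.norm_of_nonneg h0]
      exact Finset.prod_le_one (fun j _ => cutoff_nonneg _) fun j _ => cutoff_le_one _
    · have hint : ∀ᵐ x ∂volume.restrict (body S), x ∈ interior (body S) := by
        have := (convex_body S).addHaar_frontier volume
        rw [(isCompact_body S).isClosed.frontier_eq] at this
        rw [ae_restrict_iff' (measurableSet_body S)]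
        filter_upwards [compl_mem_ae_iff.2 this] with x hx hxb
        by_contra hn
        exact hx ⟨hxb, hn⟩
      filter_upwards [hint] with x hx
      rw [mem_interior_body] at hx
      refine tendsto_const_nhds.congr' ?_
      have : ∀ᶠ c : ℝ in atTop, ∀ j, 1 ≤ c * bary S j x :=
        eventually_all.2 fun j =>
          (tendsto_id.atTop_mul_const (hx j)).eventually_ge_atTop 1
      filter_upwards [this] with c hc
      rw [bodyCutoff, Finset.prod_eq_one fun j _ => cutoff_of_ge (hc j), mul_one]
  have h2 : Tendsto (fun c : ℝ => - ∫ x in body S, inner ℝ (v x) (gradient (bodyCutoff S c) x))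
      atTop (𝓝 (∑ i, faceInt S i (fun x => inner ℝ (v x) (normal S i)))) := by
    refine (tendsto_finsetSum Finset.univ fun i _ => tendsto_boundaryLayer S i (hvn i)).congr ?_
    intro c
    simp only [inner_gradient_bodyCutoff]
    rw [integral_finsetSum, ← Finset.sum_neg_distrib]
    · refine Finset.sum_congr rfl fun i _ => ?_
      rw [integral_neg, neg_neg, integral_const_mul, integral_const_mul]
    · intro i _
      refine integrableOn_body S (ContinuousOn.neg (continuousOn_const.mul
        (continuousOn_const.mul (ContinuousOn.mul (Continuous.continuousOn ?_) (hvn i)))))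
      refine (continuous_deriv_cutoff.comp (continuous_const.mul (continuous_bary S i))).mul ?_
      exact continuous_finsetProd _ fun j _ =>
        contDiff_cutoff.continuous.comp (continuous_const.mul (continuous_bary S j))
  refine tendsto_nhds_unique h1 (h2.congr' ?_)
  filter_upwards [eventually_gt_atTop 0] with c hc
  rw [h _ (contDiff_bodyCutoff S c) (hasCompactSupport_bodyCutoff S hc)
    (tsupport_bodyCutoff S hc), neg_neg]

end

section

/-! ### Integration by parts on a simplex -/

variable {d k : ℕ}

theorem IsPolyVec.continuous {r : E d → E d} (hr : IsPolyVec k r) : Continuous r := by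
  have : r = fun x => WithLp.toLp 2 fun i => r x i := rfl
  rw [this]
  exact (PiLp.continuous_toLp 2 _).comp (continuous_pi fun i => (hr i).continuous)

theorem IsPolyVec.differentiable {r : E d → E d} (hr : IsPolyVec k r) : Differentiable ℝ r :=
  differentiable_euclidean.2 fun i => (hr i).differentiable

theorem IsPolyVec.fderiv_coord {r : E d → E d} (hr : IsPolyVec k r) (x v : E d) (i : Fin d) :
    (fderiv ℝ r x v) i = fderiv ℝ (fun y => r y i) x v := by
  have h := ((EuclideanSpace.proj (𝕜 := ℝ) i : E d →L[ℝ] ℝ).hasFDerivAt.comp x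
    (hr.differentiable x).hasFDerivAt).fderiv
  rw [show (fun y => r y i) = (EuclideanSpace.proj (𝕜 := ℝ) i : E d →L[ℝ] ℝ) ∘ r from rfl, h]
  rfl

theorem IsPolyVec.div_eq {r : E d → E d} (hr : IsPolyVec k r) (x : E d) :
    div r x = ∑ i, fderiv ℝ (fun y => r y i) x (EuclideanSpace.single i 1) :=
  Finset.sum_congr rfl fun i _ => hr.fderiv_coord x _ i

theorem IsPolyVec.div {r : E d → E d} (hr : IsPolyVec k r) : IsPolyPred k (HDG.div r) := by
  have : HDG.div r = ∑ i, fun x => fderiv ℝ (fun y => r y i) x (EuclideanSpace.single i 1) := by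
    ext x
    rw [hr.div_eq, Finset.sum_apply]
  rw [this]
  exact IsPolyPred.sum fun i _ => (hr i).fderiv_apply _

theorem IsPoly.gradient_coord {w : E d → ℝ} (x : E d) (i : Fin d) :
    gradient w x i = fderiv ℝ w x (EuclideanSpace.single i 1) := by
  rw [← InnerProductSpace.toDual_symm_apply (𝕜 := ℝ), EuclideanSpace.inner_single_right]
  simp [gradient]

theorem IsPoly.gradient {w : E d → ℝ} (hw : IsPoly k w) : IsPolyVecPred k (gradient w) := by
  intro i
  simp only [IsPoly.gradient_coord]
  exact hw.fderiv_apply _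

theorem IsPolyVecPred.isPolyVec {r : E d → E d} (hr : IsPolyVecPred k r) : IsPolyVec k r :=
  fun i => (hr i).isPoly

theorem IsPoly.hasGradientAt {w : E d → ℝ} (hw : IsPoly k w) (x : E d) :
    HasGradientAt w (_root_.gradient w x) x :=
  (hw.differentiable x).hasGradientAt

variable [NeZero d] (S : Simplex d)

/-- Integration by parts against a polynomial vector field for a function with continuous
gradient `-q`. -/
theorem integral_by_parts_of_gradient {u : E d → ℝ} {q r : E d → E d}
    (hu : ContinuousOn u (body S)) (hq : ContinuousOn q (body S))
    (hgrad : ∀ x ∈ interior (body S), HasGradientAt u (-(q x)) x) (hr : IsPolyVec k r) :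
    ∫ x in body S, (u x * div r x - inner ℝ (q x) (r x)) =
      ∑ i, faceInt S i (fun x => u x * inner ℝ (r x) (normal S i)) := by
  have hrc := hr.continuous
  have hdc := hr.div.isPoly.continuous.continuousOn (s := body S)
  -- The field u r has weak divergence u div r - q·r. What remains is to verify this against test
  -- functions supported in the open simplex.
  rw [integral_eq_sum_faceInt_of_weakDiv S (v := fun x => u x • r x) (hu.smul hrc.continuousOn)
    (g := fun x => u x * HDG.div r x - inner ℝ (q x) (r x)) (integrableOn_body S ((hu.mul hdc).sub (hq.inner (𝕜 := ℝ) hrc.continuousOn)))]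
  · simp only [real_inner_smul_left]
  intro φ hφ hφc hφs
  have hsub : tsupport φ ⊆ body S := hφs.trans interior_subset
  have hext : ∀ f : E d → ℝ, (∀ x, x ∉ tsupport φ → f x = 0) →
      ∫ x in body S, f x = ∫ x, f x := fun f hf =>
    setIntegral_eq_integral_of_forall_compl_eq_zero fun x hx => hf x fun h => hx (hsub h)
  have hcs : ∀ f : E d → ℝ, ContinuousOn f (body S) → (∀ x, x ∉ tsupport φ → f x = 0) →
      Integrable f := fun f hf hf0 => by
    refine (integrableOn_iff_integrable_of_support_subset ?_).1 (integrableOn_body S hf)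
    exact fun x hx => hsub (by by_contra h; exact hx (hf0 x h))
  have hφd : Differentiable ℝ φ := hφ.differentiable (by simp)
  have hφg : ∀ v, Continuous fun x => fderiv ℝ φ x v := fun v =>
    (hφ.continuous_fderiv (by simp)).clm_apply continuous_const
  have h0 : ∀ x, x ∉ tsupport φ → φ x = 0 := fun x hx => image_eq_zero_of_notMem_tsupport hx
  have h0' : ∀ x, x ∉ tsupport φ → ∀ v, fderiv ℝ φ x v = 0 := fun x hx v => by
    rw [fderiv_of_notMem_tsupport (𝕜 := ℝ) hx]; rfl
  have hud : ∀ x ∈ tsupport φ, HasFDerivAt u (-(innerSL ℝ (q x))) x := fun x hx => by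
    have := (hgrad x (hφs hx)).hasFDerivAt
    have heq : (InnerProductSpace.toDual ℝ (E d)) (-(q x)) = -(innerSL ℝ (q x)) := by
      ext v
      simp
    rwa [heq] at this
  have key : ∀ i, ∫ x in body S, (u x * r x i) * fderiv ℝ φ x (EuclideanSpace.single i 1) =
      - ∫ x in body S, (u x * fderiv ℝ (fun y => r y i) x (EuclideanSpace.single i 1) -
        q x i * r x i) * φ x := by
    intro i
    have hri := (hr i).continuous.continuousOn (s := body S)
    have hqi : ContinuousOn (fun x => q x i) (body S) :=
      (EuclideanSpace.proj (𝕜 := ℝ) i).continuous.comp_continuousOn hq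
    have hrd := ((hr i).fderiv_apply (EuclideanSpace.single i 1)).isPoly.continuous.continuousOn
      (s := body S)
    rw [hext _ (fun x hx => by rw [h0' x hx, mul_zero]), hext _ (fun x hx => by
      rw [h0 x hx, mul_zero])]
    have hfd : ∀ x, fderiv ℝ (fun x => u x * r x i) x (EuclideanSpace.single i 1) * φ x =
        (u x * fderiv ℝ (fun y => r y i) x (EuclideanSpace.single i 1) -
          q x i * r x i) * φ x := by
      intro x
      by_cases hx : x ∈ tsupport φ
      · rw [fderiv_fun_mul (hud x hx).differentiableAt ((hr i).differentiable x), (hud x hx).fderiv]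
        simp only [add_apply, smul_apply, neg_apply, innerSL_apply_apply, smul_eq_mul,
          EuclideanSpace.inner_single_right, one_mul, conj_trivial]
        ring
      · rw [h0 x hx, mul_zero, mul_zero]
    rw [← integral_congr_ae (ae_of_all _ hfd)]
    -- Integration by parts over all of space. Differentiability of `u` is required only on the
    -- support of the test function, which lies in the open simplex.
    refine integral_mul_fderiv_eq_neg_fderiv_mul_of_integrable ?_ ?_ ?_ ?_ ?_
    · refine Integrable.congr ?_ (ae_of_all _ fun x => (hfd x).symm)
      exact hcs _ (((hu.mul hrd).sub (hqi.mul hri)).mul hφ.continuous.continuousOn)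
        fun x hx => by rw [h0 x hx, mul_zero]
    · exact hcs _ ((hu.mul hri).mul (hφg _).continuousOn)
        fun x hx => by rw [h0' x hx, mul_zero]
    · exact hcs _ ((hu.mul hri).mul hφ.continuous.continuousOn)
        fun x hx => by rw [h0 x hx, mul_zero]
    · exact fun x hx => (hud x hx).differentiableAt.mul ((hr i).differentiable x)
    · exact fun x _ => hφd x
  have h1 : ∀ x, inner ℝ (u x • r x) (_root_.gradient φ x) =
      ∑ i, (u x * r x i) * fderiv ℝ φ x (EuclideanSpace.single i 1) := by
    intro x
    rw [PiLp.inner_apply]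
    refine Finset.sum_congr rfl fun i _ => ?_
    rw [IsPoly.gradient_coord]
    simp [mul_comm]
  have h2 : ∀ x, (u x * HDG.div r x - inner ℝ (q x) (r x)) * φ x =
      ∑ i, (u x * fderiv ℝ (fun y => r y i) x (EuclideanSpace.single i 1) -
        q x i * r x i) * φ x := by
    intro x
    rw [← Finset.sum_mul, Finset.sum_sub_distrib, hr.div_eq, PiLp.inner_apply, Finset.mul_sum]
    congr 2
    exact Finset.sum_congr rfl fun i _ => by simp [mul_comm]
  simp only [h1, h2]
  rw [integral_finsetSum, integral_finsetSum, ← Finset.sum_neg_distrib]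
  · exact Finset.sum_congr rfl fun i _ => key i
  · intro i _
    have hrd := ((hr i).fderiv_apply (EuclideanSpace.single i 1)).isPoly.continuous.continuousOn
      (s := body S)
    have hqi : ContinuousOn (fun x => q x i) (body S) :=
      (EuclideanSpace.proj (𝕜 := ℝ) i).continuous.comp_continuousOn hq
    exact integrableOn_body S (((hu.mul hrd).sub
      (hqi.mul (hr i).continuous.continuousOn)).mul hφ.continuous.continuousOn)
  · intro i _
    exact integrableOn_body S ((hu.mul (hr i).continuous.continuousOn).mul (hφg _).continuousOn)

/-- Integration by parts against a polynomial for a continuous vector field with integrable weak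
divergence. -/
theorem integral_by_parts_of_weakDiv {q : E d → E d} {g w : E d → ℝ}
    (hq : ContinuousOn q (body S)) (hg : IntegrableOn g (body S))
    (h : ∀ φ : E d → ℝ, ContDiff ℝ ∞ φ → HasCompactSupport φ → tsupport φ ⊆ interior (body S) →
      ∫ x in body S, inner ℝ (q x) (_root_.gradient φ x) = - ∫ x in body S, g x * φ x)
    (hw : IsPoly k w) :
    ∫ x in body S, (g x * w x + inner ℝ (q x) (_root_.gradient w x)) =
      ∑ i, faceInt S i (fun x => inner ℝ (q x) (normal S i) * w x) := by
  have hwc := hw.continuous.continuousOn (s := body S)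
  have hgw := hw.gradient.isPolyVec.continuous.continuousOn (s := body S)
  have hqg := integrableOn_body S (hq.inner (𝕜 := ℝ) hgw)
  have hgwi : IntegrableOn (fun x => g x * w x) (body S) :=
    hg.mul_continuousOn hwc (isCompact_body S)
  rw [integral_eq_sum_faceInt_of_weakDiv S (v := fun x => w x • q x) (hwc.smul hq)
    (g := fun x => g x * w x + inner ℝ (q x) (_root_.gradient w x)) (hgwi.add hqg)]
  · simp only [real_inner_smul_left, mul_comm]
  intro φ hφ hφc hφs
  -- The product w φ is itself an admissible test function. The Leibniz rule for its gradient yields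
  -- the weak divergence of w q.
  have hprod := h (fun x => w x * φ x) (hw.contDiff.mul hφ) (hφc.mul_left)
    ((tsupport_mul_subset_right).trans hφs)
  have hφd : Differentiable ℝ φ := hφ.differentiable (by simp)
  have hgr : ∀ x, _root_.gradient (fun x => w x * φ x) x =
      w x • _root_.gradient φ x + φ x • _root_.gradient w x := by
    intro x
    ext i
    rw [PiLp.add_apply, PiLp.smul_apply, PiLp.smul_apply, IsPoly.gradient_coord,
      IsPoly.gradient_coord, IsPoly.gradient_coord, fderiv_fun_mul (hw.differentiable x) (hφd x)]
    simp
  have hφg : Continuous (_root_.gradient φ) := by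
    have : _root_.gradient φ = fun x => (InnerProductSpace.toDual ℝ (E d)).symm (fderiv ℝ φ x) :=
      rfl
    rw [this]
    exact (LinearIsometryEquiv.continuous _).comp (hφ.continuous_fderiv (by simp))
  have hφo := hφ.continuous.continuousOn (s := body S)
  have e1 : ∫ x in body S, inner ℝ (q x) (_root_.gradient (fun x => w x * φ x) x) =
      (∫ x in body S, inner ℝ (w x • q x) (_root_.gradient φ x)) +
        ∫ x in body S, inner ℝ (q x) (_root_.gradient w x) * φ x := by
    rw [← integral_add]
    · refine integral_congr_ae (ae_of_all _ fun x => ?_)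
      simp only [hgr, inner_add_right, real_inner_smul_left, real_inner_smul_right]
      ring
    · exact integrableOn_body S ((hwc.smul hq).inner hφg.continuousOn)
    · exact integrableOn_body S ((hq.inner (𝕜 := ℝ) hgw).mul hφo)
  have e2 : ∫ x in body S, (g x * w x + inner ℝ (q x) (_root_.gradient w x)) * φ x =
      (∫ x in body S, g x * (w x * φ x)) +
        ∫ x in body S, inner ℝ (q x) (_root_.gradient w x) * φ x := by
    rw [← integral_add]
    · refine integral_congr_ae (ae_of_all _ fun x => ?_)
      simp only
      ring
    · exact hg.mul_continuousOn (hwc.mul hφo) (isCompact_body S)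
    · exact integrableOn_body S ((hq.inner (𝕜 := ℝ) hgw).mul hφo)
  rw [e2]
  rw [e1] at hprod
  linarith

end

section

/-! ### Unisolvence of the HDG projection -/

variable {d k : ℕ}

theorem sum_isPolyVec_coord {v : E d → E d} (hv : IsPolyVec k v) (n : E d) :
    IsPoly k (fun x => inner ℝ (v x) n) := by
  have : (fun x => inner ℝ (v x) n) = ∑ m, n m • fun x => v x m := by
    ext x
    simp [PiLp.inner_apply, Finset.sum_apply]
  rw [this]
  exact IsPoly.sum fun m _ => (hv m).smul _

variable [NeZero d] (S : Simplex d)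

/-- Translation along such a `v` changes no barycentric coordinate, so `v` has the same coordinates
as the origin. -/
theorem eq_zero_of_inner_normal {v : E d} (h : ∀ i, inner ℝ v (normal S i) = 0) : v = 0 := by
  refine (vertexBasis S).ext_elem fun i => ?_
  have := bary_add S i 0 v
  rw [h, zero_div, sub_zero, zero_add] at this
  exact this

/-- A polynomial vanishing on a face is divisible by the corresponding barycentric coordinate. -/
theorem IsPoly.exists_eq_bary_mul {w : E d → ℝ} (hw : IsPoly k w) {i : Fin (d + 1)}
    (h0 : ∀ x ∈ face S i, w x = 0) : ∃ g, IsPolyPred k g ∧ w = bary S i * g := by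
  have hh := S.height_pos i
  -- Vanishing on the face extends to its whole hyperplane: on the line from the face centre to `y`
  -- the polynomial vanishes near the centre.
  have hplane : ∀ y, bary S i y = 0 → w y = 0 := by
    intro y hy
    obtain ⟨c, hc0, hc⟩ := exists_faceCenter S i
    refine hw.eq_zero_of_line (x := c) ?_
    have hev : ∀ᶠ t : ℝ in nhds 0, ∀ j, j ≠ i → 0 < bary S j (c + t • (y - c)) := by
      refine Filter.eventually_all.2 fun j => ?_
      by_cases hj : j = i
      · exact Filter.Eventually.of_forall fun t h => absurd hj h
      · have hcont : Continuous fun t : ℝ => bary S j (c + t • (y - c)) :=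
          (continuous_bary S j).comp (by fun_prop)
        have := hcont.continuousAt.eventually_mem (s := Ioi 0) (x := 0)
          (Ioi_mem_nhds (by simpa using hc j hj))
        filter_upwards [this] with t ht _ using ht
    obtain ⟨ε, hε, hb⟩ := Metric.eventually_nhds_iff.1 hev
    refine ⟨ε, hε, fun t ht => h0 _ ((mem_face S i).2 ?_)⟩
    have hi : bary S i (c + t • (y - c)) = 0 := by rw [bary_lineMap, hc0, hy]; ring
    refine ⟨fun j => ?_, hi⟩
    by_cases hj : j = i
    · rw [hj, hi]
    · exact (hb (by simpa using ht) j hj).le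
  -- The direction -h n makes x - λ_i(x) a the orthogonal projection onto the hyperplane, where the
  -- polynomial is zero.
  obtain ⟨g, hg, hwg⟩ := hw.exists_sub_eq_mul (isPoly_bary S i) (-(S.height i • normal S i))
  refine ⟨g, hg, funext fun x => ?_⟩
  have hz : w (x - bary S i x • -(S.height i • normal S i)) = 0 := by
    refine hplane _ ?_
    rw [sub_eq_add_neg, bary_add, inner_neg_left, real_inner_smul_left, inner_neg_left,
      real_inner_smul_left, real_inner_self_eq_norm_sq, norm_normal]
    field_simp
    ring
  have := hwg x
  rw [hz, sub_zero] at this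
  exact this

/-- Write w = λ_i g with g of degree at most k - 1. Testing with g gives ∫ λ_i g² = 0, and λ_i is
positive inside the simplex. -/
theorem IsPoly.eq_zero_of_face_of_orthogonal {w : E d → ℝ} (hw : IsPoly k w) {i : Fin (d + 1)}
    (h0 : ∀ x ∈ face S i, w x = 0)
    (horth : ∀ g, IsPolyPred k g → ∫ x in body S, w x * g x = 0) : w = 0 := by
  obtain ⟨g, hg, rfl⟩ := hw.exists_eq_bary_mul S h0
  have h1 := eq_zero_of_setIntegral_body_eq_zero S
    (hw.continuous.mul hg.isPoly.continuous).continuousOn (fun x hx => by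
      have := (mem_body S).1 hx i
      simp only [Pi.mul_apply, mul_assoc]
      exact mul_nonneg this (mul_self_nonneg _)) (horth g hg)
  refine hw.eq_zero_of_open isOpen_interior (interior_body_nonempty S) fun x hx => ?_
  have := h1 x (interior_subset hx)
  simp only [Pi.mul_apply, mul_eq_zero] at this ⊢
  tauto

/-- Test the face conditions with pu and sum over the faces. Integration by parts and the two
orthogonality conditions remove the term pu pq·n, leaving ∑ τ_i ∫ pu² = 0. So pu vanishes on the
faces, and then everywhere by orthogonality. The face conditions now make each pq·n_i vanish on its
face, and the same argument applies to it. -/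
theorem isHDGProjection_zero {τ : Fin (d + 1) → ℝ} (hτ : ∀ i, 0 < τ i) {pq : E d → E d}
    {pu : E d → ℝ} (h : IsHDGProjection k S τ 0 0 pq pu) : pq = 0 ∧ pu = 0 := by
  have hqc := h.poly_q.continuous
  have huc := h.poly_u.continuous
  have hgc := h.poly_u.gradient.isPolyVec.continuous
  have hdc := h.poly_q.div.isPoly.continuous
  have oq : ∀ r, IsPolyVecPred k r → ∫ x in body S, inner ℝ (pq x) (r x) = 0 := fun r hr => by
    simpa using h.orth_q r hr
  have ou : ∀ w, IsPolyPred k w → ∫ x in body S, pu x * w x = 0 := fun w hw => by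
    simpa using h.orth_u w hw
  have of : ∀ i μ, IsPoly k μ →
      faceInt S i (fun x => (inner ℝ (pq x) (normal S i) + τ i * pu x) * μ x) = 0 :=
    fun i μ hμ => by simpa [faceInt_eq] using h.orth_face i μ hμ
  have hparts := integral_by_parts_of_gradient S (u := pu) (q := fun x => -(gradient pu x))
    huc.continuousOn hgc.neg.continuousOn
    (fun x _ => by rw [neg_neg]; exact h.poly_u.hasGradientAt x) h.poly_q
  have hlhs : ∫ x in body S, (pu x * div pq x - inner ℝ (-(gradient pu x)) (pq x)) = 0 := by
    rw [integral_sub, ou _ h.poly_q.div, zero_sub]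
    · simp only [inner_neg_left, integral_neg, neg_neg]
      simp only [real_inner_comm, oq _ h.poly_u.gradient]
    · exact integrableOn_body S (huc.mul hdc).continuousOn
    · exact integrableOn_body S (hgc.neg.inner hqc).continuousOn
  rw [hlhs] at hparts
  have hsplit : ∀ i, faceInt S i (fun x => pu x * inner ℝ (pq x) (normal S i)) +
      τ i * faceInt S i (fun x => pu x * pu x) = 0 := by
    intro i
    rw [← of i pu h.poly_u, faceInt_eq, faceInt_eq, faceInt_eq, ← integral_const_mul, ← integral_add]
    · exact integral_congr_ae (ae_of_all _ fun x => by ring)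
    · exact integrable_faceMeasure S i (huc.mul (hqc.inner continuous_const)).continuousOn
    · exact (integrable_faceMeasure S i (huc.mul huc).continuousOn).const_mul _
  have hnn : ∀ i, 0 ≤ faceInt S i (fun x => pu x * pu x) := fun i =>
    integral_nonneg fun x => mul_self_nonneg _
  have hsum : ∑ i, τ i * faceInt S i (fun x => pu x * pu x) = 0 := by
    have : ∑ i, (faceInt S i (fun x => pu x * inner ℝ (pq x) (normal S i)) +
      τ i * faceInt S i (fun x => pu x * pu x)) = 0 := Finset.sum_eq_zero fun i _ => hsplit i
    rwa [Finset.sum_add_distrib, ← hparts, zero_add] at this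
  have hpu : pu = 0 := by
    have h1 := (Finset.sum_eq_zero_iff_of_nonneg fun i _ => mul_nonneg (hτ i).le (hnn i)).1 hsum 0
      (Finset.mem_univ _)
    have h2 := (mul_eq_zero.1 h1).resolve_left (hτ 0).ne'
    have h3 := eq_zero_of_faceInt_eq_zero S 0 (huc.mul huc).continuousOn
      (fun x _ => mul_self_nonneg _) h2
    exact h.poly_u.eq_zero_of_face_of_orthogonal S (fun x hx => mul_self_eq_zero.1 (h3 x hx)) ou
  refine ⟨?_, hpu⟩
  have hn : ∀ i, (fun x => inner ℝ (pq x) (normal S i)) = (0 : E d → ℝ) := by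
    intro i
    have hp := sum_isPolyVec_coord h.poly_q (normal S i)
    have h2 := of i _ hp
    simp only [hpu, Pi.zero_apply, mul_zero, add_zero] at h2
    have h3 := eq_zero_of_faceInt_eq_zero S i (hp.continuous.mul hp.continuous).continuousOn
      (fun x _ => mul_self_nonneg _) h2
    refine hp.eq_zero_of_face_of_orthogonal S (fun x hx => mul_self_eq_zero.1 (h3 x hx)) ?_
    intro g hg
    -- Orthogonality to the fields g n_i is orthogonality of the scalar pq·n_i to all g of degree at
    -- most k - 1.
    have := oq (fun x => g x • normal S i) (fun m => by
      convert hg.smul (normal S i m) using 1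
      ext x
      simp [mul_comm])
    simpa only [real_inner_smul_right, mul_comm] using this
  ext1 x
  exact eq_zero_of_inner_normal S fun i => congrFun (hn i) x

end

section

/-! ### Existence and representation of the HDG projection -/

variable {d k : ℕ}

theorem inner_toLp {α : Type*} [MeasurableSpace α] {ν : Measure α} {f g : α → ℝ}
    (hf : MemLp f 2 ν) (hg : MemLp g 2 ν) :
    inner ℝ (hf.toLp f) (hg.toLp g) = ∫ x, f x * g x ∂ν := by
  rw [L2.inner_def]
  refine integral_congr_ae ?_
  filter_upwards [hf.coeFn_toLp, hg.coeFn_toLp] with x h1 h2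
  rw [h1, h2]
  simp [mul_comm]

theorem memLp_body (S : Simplex d) {V : Type*} [NormedAddCommGroup V] {f : E d → V}
    (hf : ContinuousOn f (body S)) : MemLp f 2 (volume.restrict (body S)) := by
  obtain ⟨C, hC⟩ := (isCompact_body S).exists_bound_of_continuousOn hf
  have : IsFiniteMeasure (volume.restrict (body S)) :=
    ⟨by simpa using (isCompact_body S).measure_lt_top⟩
  refine MemLp.of_bound (integrableOn_body S hf).aestronglyMeasurable C ?_
  filter_upwards [ae_restrict_mem (measurableSet_body S)] with x hx using hC x hx

variable [NeZero d]

theorem memLp_face (S : Simplex d) (i : Fin (d + 1)) {f : E d → ℝ}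
    (hf : ContinuousOn f (face S i)) : MemLp f 2 (faceMeasure S i) := by
  obtain ⟨C, hC⟩ := (isCompact_face S i).exists_bound_of_continuousOn hf
  refine MemLp.of_bound (integrable_faceMeasure S i hf).aestronglyMeasurable C ?_
  filter_upwards [faceMeasure_ae_mem S i] with x hx using hC x hx

/-- Polynomials of degree at most `k` as elements of `L²` of a simplex. -/
def bodyL2 (S : Simplex d) : polySpace d k →ₗ[ℝ] Lp ℝ 2 (volume.restrict (body S)) where
  toFun p := (memLp_body S (IsPoly.continuous p.2).continuousOn).toLp p
  map_add' _ _ := MemLp.toLp_add _ _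
  map_smul' _ _ := MemLp.toLp_const_smul _ _

/-- Polynomials of degree at most `k` as elements of `L²` of a face. -/
def faceL2 (S : Simplex d) (i : Fin (d + 1)) : polySpace d k →ₗ[ℝ] Lp ℝ 2 (faceMeasure S i) where
  toFun p := (memLp_face S i (IsPoly.continuous p.2).continuousOn).toLp p
  map_add' _ _ := MemLp.toLp_add _ _
  map_smul' _ _ := MemLp.toLp_const_smul _ _

theorem inner_bodyL2 (S : Simplex d) (p q : polySpace d k) :
    inner ℝ (bodyL2 S p) (bodyL2 S q) = ∫ x in body S, p.1 x * q.1 x :=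
  inner_toLp (memLp_body S (IsPoly.continuous p.2).continuousOn)
    (memLp_body S (IsPoly.continuous q.2).continuousOn)

theorem inner_faceL2 (S : Simplex d) (i : Fin (d + 1)) (p q : polySpace d k) :
    inner ℝ (faceL2 S i p) (faceL2 S i q) = faceInt S i fun x => p.1 x * q.1 x :=
  inner_toLp (memLp_face S i (IsPoly.continuous p.2).continuousOn)
    (memLp_face S i (IsPoly.continuous q.2).continuousOn)

/-- Polynomials of degree at most `k - 1` as polynomials of degree at most `k`. -/
def polyIncl (d k : ℕ) : polySpacePred d k →ₗ[ℝ] polySpace d k :=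
  Submodule.inclusion polySpacePred_le

theorem faceL2_eq_zero_iff (S : Simplex d) (i : Fin (d + 1)) (p : polySpace d k) :
    faceL2 S i p = 0 ↔ ∀ x ∈ face S i, p.1 x = 0 := by
  have hc := (IsPoly.continuous p.2).continuousOn (s := face S i)
  constructor
  · intro h x hx
    have h1 : inner ℝ (faceL2 S i p) (faceL2 S i p) = (0 : ℝ) := by rw [h, inner_zero_left]
    rw [inner_faceL2] at h1
    exact mul_self_eq_zero.1 (eq_zero_of_faceInt_eq_zero S i (hc.mul hc)
      (fun x _ => mul_self_nonneg _) h1 x hx)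
  · intro h
    rw [← inner_self_eq_zero (𝕜 := ℝ), inner_faceL2]
    refine integral_eq_zero_of_ae ?_
    filter_upwards [faceMeasure_ae_mem S i] with x hx
    simp [h x hx]

/-- Trial space of the local HDG projection problem. -/
abbrev TrialSpace (d k : ℕ) : Type := (Fin d → polySpace d k) × polySpace d k

/-- Test space of the local HDG projection problem. -/
abbrev TestSpace (k : ℕ) (S : Simplex d) : Type :=
  (Fin d → polySpacePred d k) × polySpacePred d k × (∀ i, LinearMap.range (faceL2 (k := k) S i))

/-- Rank-nullity for restriction to a face: its kernel consists of the multiples of λ_i, a copy of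
the polynomials of degree at most k - 1. -/
theorem finrank_range_faceL2 (S : Simplex d) (i : Fin (d + 1)) :
    Module.finrank ℝ (LinearMap.range (faceL2 (k := k) S i)) +
      Module.finrank ℝ (polySpacePred d k) = Module.finrank ℝ (polySpace d k) := by
  rw [← (faceL2 (k := k) S i).finrank_range_add_finrank_ker]
  congr 1
  let φ : polySpacePred d k →ₗ[ℝ] LinearMap.ker (faceL2 (k := k) S i) :=
    { toFun := fun g => ⟨⟨bary S i * g.1, by
        obtain ⟨g, rfl | ⟨m, rfl, hm⟩⟩ := g
        · simp
        · have := (isPoly_bary S i).mul hm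
          rwa [add_comm] at this⟩, by
        rw [LinearMap.mem_ker, faceL2_eq_zero_iff]
        intro x hx
        simp [((mem_face S i).1 hx).2]⟩
      map_add' := fun a b => by ext x; simp [mul_add]
      map_smul' := fun c a => by ext x; simp; ring }
  refine (LinearEquiv.ofBijective φ ⟨?_, ?_⟩).finrank_eq
  · rw [injective_iff_map_eq_zero]
    intro g hg
    have hg' : bary S i * g.1 = 0 := congrArg (fun z => z.1.1) hg
    ext1
    refine (IsPolyPred.isPoly g.2).eq_zero_of_open isOpen_interior (interior_body_nonempty S)
      fun x hx => ?_
    have h1 := congrFun hg' x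
    simpa [((mem_interior_body S).1 hx i).ne'] using h1
  · rintro ⟨p, hp⟩
    obtain ⟨g, hg, hpg⟩ := IsPoly.exists_eq_bary_mul S p.2 ((faceL2_eq_zero_iff S i p).1 hp)
    exact ⟨⟨g, hg⟩, by ext1; ext1; exact hpg.symm⟩

/-- With a = dim P_k and b = dim P_(k-1), the test space has dimension d b + b + (d + 1)(a - b) = (d
+ 1) a. -/
theorem finrank_trial_eq_test (S : Simplex d) :
    Module.finrank ℝ (TrialSpace d k) = Module.finrank ℝ (TestSpace k S) := by
  have h := fun i => finrank_range_faceL2 (k := k) S i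
  simp only [TrialSpace, TestSpace, Module.finrank_prod, Module.finrank_pi_fintype,
    Finset.sum_const, Finset.card_univ, Fintype.card_fin, smul_eq_mul]
  have h2 : ∑ i, Module.finrank ℝ (LinearMap.range (faceL2 (k := k) S i)) +
      (d + 1) * Module.finrank ℝ (polySpacePred d k) =
      (d + 1) * Module.finrank ℝ (polySpace d k) := by
    have := Finset.sum_congr (rfl : (Finset.univ : Finset (Fin (d + 1))) = _) fun i _ => h i
    simpa [Finset.sum_add_distrib] using this
  linarith

/-- The bilinear form of the local HDG projection problem. -/
def projForm (k : ℕ) (S : Simplex d) (τ : Fin (d + 1) → ℝ) :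
    TrialSpace d k →ₗ[ℝ] TestSpace k S →ₗ[ℝ] ℝ :=
  LinearMap.mk₂ ℝ (fun x y => ∑ m, inner ℝ (bodyL2 S (x.1 m)) (bodyL2 S (polyIncl d k (y.1 m))) +
      inner ℝ (bodyL2 S x.2) (bodyL2 S (polyIncl d k y.2.1)) +
      ∑ i, inner ℝ (∑ m, normal S i m • faceL2 S i (x.1 m) + τ i • faceL2 S i x.2)
        (y.2.2 i : Lp ℝ 2 (faceMeasure S i)))
    (fun x x' y => by
      simp only [Prod.fst_add, Prod.snd_add, Pi.add_apply, map_add, inner_add_left, smul_add,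
        Finset.sum_add_distrib]
      ring)
    (fun c x y => by
      simp only [Prod.smul_fst, Prod.smul_snd, Pi.smul_apply, map_smul, inner_smul_left,
        smul_comm _ c, ← Finset.smul_sum, ← smul_add, Finset.mul_sum, smul_eq_mul, mul_add]
      simp)
    (fun x y y' => by
      simp only [Prod.fst_add, Prod.snd_add, Pi.add_apply, map_add, inner_add_right,
        Finset.sum_add_distrib, Submodule.coe_add]
      ring)
    (fun c x y => by
      simp only [Prod.smul_fst, Prod.smul_snd, Pi.smul_apply, map_smul, inner_smul_right,
        Finset.mul_sum, smul_eq_mul, mul_add, Submodule.coe_smul])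

theorem integral_inner_eq_sum (S : Simplex d) {v r : E d → E d} (hv : ContinuousOn v (body S))
    (hr : ContinuousOn r (body S)) :
    ∫ x in body S, inner ℝ (v x) (r x) = ∑ m, ∫ x in body S, v x m * r x m := by
  rw [← integral_finsetSum]
  · exact integral_congr_ae (ae_of_all _ fun x => by simp [PiLp.inner_apply, mul_comm])
  · intro m _
    have hm := (EuclideanSpace.proj (𝕜 := ℝ) (ι := Fin d) m).continuous
    exact integrableOn_body S ((hm.comp_continuousOn hv).mul (hm.comp_continuousOn hr))

theorem projForm_apply (S : Simplex d) (τ : Fin (d + 1) → ℝ) {pq : E d → E d} {pu : E d → ℝ}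
    (hpq : IsPolyVec k pq) (hpu : IsPoly k pu) {r : E d → E d} {w : E d → ℝ}
    (hr : IsPolyVecPred k r) (hw : IsPolyPred k w) (μ : Fin (d + 1) → polySpace d k) :
    projForm k S τ (fun m => ⟨_, hpq m⟩, ⟨pu, hpu⟩)
      (fun m => ⟨_, hr m⟩, ⟨w, hw⟩, fun i => ⟨faceL2 S i (μ i), LinearMap.mem_range_self _ _⟩) =
    (∫ x in body S, inner ℝ (pq x) (r x)) + (∫ x in body S, pu x * w x) +
      ∑ i, faceInt S i (fun x => (inner ℝ (pq x) (normal S i) + τ i * pu x) * (μ i).1 x) := by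
  have hface : ∀ i, (∑ m, normal S i m • faceL2 S i ⟨_, hpq m⟩ + τ i • faceL2 S i ⟨pu, hpu⟩) =
      faceL2 S i ⟨_, (sum_isPolyVec_coord hpq (normal S i)).add (hpu.smul (τ i))⟩ := by
    intro i
    simp only [← map_smul, ← map_sum, ← map_add]
    congr 1
    ext x
    simp [PiLp.inner_apply, Finset.sum_apply]
  rw [integral_inner_eq_sum S hpq.continuous.continuousOn hr.isPolyVec.continuous.continuousOn]
  simp only [projForm, LinearMap.mk₂_apply, hface, inner_bodyL2, inner_faceL2]
  rfl

theorem projForm_injective (S : Simplex d) {τ : Fin (d + 1) → ℝ} (hτ : ∀ i, 0 < τ i) :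
    Function.Injective (projForm k S τ) := by
  rw [injective_iff_map_eq_zero]
  rintro ⟨pq, pu⟩ h
  set q : E d → E d := fun x => WithLp.toLp 2 fun m => (pq m).1 x with hq
  have hqp : IsPolyVec k q := fun m => (pq m).2
  have key := fun (r : E d → E d) (w : E d → ℝ) (hr : IsPolyVecPred k r) (hw : IsPolyPred k w)
    (μ : Fin (d + 1) → polySpace d k) =>
    (projForm_apply S τ hqp pu.2 hr hw μ).symm.trans (LinearMap.congr_fun h _)
  have h0r : IsPolyVecPred k (0 : E d → E d) := fun m => Or.inl rfl
  have h0w : IsPolyPred k (0 : E d → ℝ) := Or.inl rfl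
  have hp : IsHDGProjection k S τ 0 0 q pu.1 := by
    refine ⟨hqp, pu.2, fun r hr => ?_, fun w hw => ?_, fun i μ hμ => ?_⟩
    · have := key r 0 hr h0w 0
      simpa [faceInt_eq] using this
    · have := key 0 w h0r hw 0
      simpa [faceInt_eq] using this
    · classical
      have := key 0 0 h0r h0w (Pi.single i ⟨μ, hμ⟩)
      rw [Finset.sum_eq_single i] at this
      · simpa [faceInt_eq] using this
      · intro j _ hj
        simp [faceInt_eq, Pi.single_eq_of_ne hj]
      · simp
  obtain ⟨h1, h2⟩ := isHDGProjection_zero S hτ hp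
  refine Prod.ext (funext fun m => Subtype.ext (funext fun x => ?_)) (Subtype.ext h2)
  have := congrArg (fun v : E d => v m) (congrFun h1 x)
  simpa [hq] using this

/-- Every linear functional of the HDG projection is a fixed combination of moments. -/
theorem IsHDGProjection.exists_moments (S : Simplex d) {τ : Fin (d + 1) → ℝ} (hτ : ∀ i, 0 < τ i)
    (ev : TrialSpace d k →ₗ[ℝ] ℝ) :
    ∃ (r : E d → E d) (w : E d → ℝ) (μ : Fin (d + 1) → E d → ℝ), IsPolyVecPred k r ∧
      IsPolyPred k w ∧ (∀ i, IsPoly k (μ i)) ∧ ∀ q u pq pu (h : IsHDGProjection k S τ q u pq pu),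
      ev (fun m => ⟨_, h.poly_q m⟩, ⟨pu, h.poly_u⟩) =
        (∫ x in body S, inner ℝ (q x) (r x)) + (∫ x in body S, u x * w x) +
        ∑ i, faceInt S i (fun x => (inner ℝ (q x) (normal S i) + τ i * u x) * μ i x) := by
  -- Injectivity in the trial variable is, in finite dimensions, surjectivity of the test space onto
  -- the dual of the trial space. So every functional of the projection is represented by a test
  -- element.
  have hsurj : Function.Surjective (projForm k S τ).flip :=
    LinearMap.flip_surjective_iff₁.2 (projForm_injective S hτ)
  obtain ⟨⟨r, w, μ⟩, hy⟩ := hsurj ev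
  choose μ' hμ' using fun i => (μ i).2
  have hr : IsPolyVecPred k (fun x => WithLp.toLp 2 fun m => (r m).1 x) := fun m => (r m).2
  refine ⟨_, w.1, fun i => (μ' i).1, hr, w.2, fun i => (μ' i).2, fun q u pq pu h => ?_⟩
  have h1 := projForm_apply S τ h.poly_q h.poly_u hr w.2 μ'
  rw [← h.orth_q _ hr, ← h.orth_u _ w.2]
  simp only [← fun i => h.orth_face i _ (μ' i).2]
  rw [← h1, ← hy, LinearMap.flip_apply]
  congr 3
  funext i
  ext1
  exact (hμ' i).symm

/-- Trial and test spaces have equal dimension, so uniqueness gives existence: the moments of (q, u)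
form a functional on the test space, which the form represents by a trial element. -/
theorem exists_isHDGProjection (S : Simplex d) {τ : Fin (d + 1) → ℝ} (hτ : ∀ i, 0 < τ i)
    {q : E d → E d} {u : E d → ℝ} (hq : ContinuousOn q (body S)) (hu : ContinuousOn u (body S)) :
    ∃ p : (E d → E d) × (E d → ℝ), IsHDGProjection k S τ q u p.1 p.2 := by
  have hqm : ∀ m, ContinuousOn (fun x => q x m) (body S) := fun m =>
    (EuclideanSpace.proj (𝕜 := ℝ) (ι := Fin d) m).continuous.comp_continuousOn hq
  have hface : ∀ i, ContinuousOn (fun x => inner ℝ (q x) (normal S i) + τ i * u x) (face S i) :=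
    fun i => ((hq.inner continuousOn_const).add (continuousOn_const.mul hu)).mono
      (face_subset_body S i)
  let ℓ : TestSpace k S →ₗ[ℝ] ℝ :=
    { toFun := fun y =>
        ∑ m, inner ℝ ((memLp_body S (hqm m)).toLp _) (bodyL2 S (polyIncl d k (y.1 m))) +
        inner ℝ ((memLp_body S hu).toLp _) (bodyL2 S (polyIncl d k y.2.1)) +
        ∑ i, inner ℝ ((memLp_face S i (hface i)).toLp _) (y.2.2 i : Lp ℝ 2 (faceMeasure S i))
      map_add' := fun y y' => by
        simp only [Prod.fst_add, Prod.snd_add, Pi.add_apply, map_add, inner_add_right,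
          Finset.sum_add_distrib, Submodule.coe_add]
        ring
      map_smul' := fun c y => by
        simp only [Prod.smul_fst, Prod.smul_snd, Pi.smul_apply, map_smul, inner_smul_right,
          Finset.mul_sum, smul_eq_mul, mul_add, Submodule.coe_smul, RingHom.id_apply] }
  have hsurj : Function.Surjective (projForm k S τ) :=
    (LinearMap.injective_iff_surjective_of_finrank_eq_finrank (by
      rw [finrank_trial_eq_test S]; exact (Subspace.dual_finrank_eq).symm)).1
      (projForm_injective S hτ)
  obtain ⟨⟨pq, pu⟩, hx⟩ := hsurj ℓ
  have hpq : IsPolyVec k (fun x => WithLp.toLp 2 fun m => (pq m).1 x : E d → E d) :=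
    fun m => (pq m).2
  have key : ∀ (r : E d → E d) (w : E d → ℝ) (_ : IsPolyVecPred k r) (_ : IsPolyPred k w)
      (μ : Fin (d + 1) → polySpace d k),
      (∫ x in body S, inner ℝ (WithLp.toLp 2 fun m => (pq m).1 x : E d) (r x)) +
        (∫ x in body S, pu.1 x * w x) + ∑ i, faceInt S i (fun x =>
        (inner ℝ (WithLp.toLp 2 fun m => (pq m).1 x : E d) (normal S i) + τ i * pu.1 x) *
          (μ i).1 x) =
      (∫ x in body S, inner ℝ (q x) (r x)) + (∫ x in body S, u x * w x) +
        ∑ i, faceInt S i (fun x => (inner ℝ (q x) (normal S i) + τ i * u x) * (μ i).1 x) := by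
    intro r w hr hw μ
    rw [← projForm_apply S τ hpq pu.2 hr hw μ,
      integral_inner_eq_sum S hq hr.isPolyVec.continuous.continuousOn]
    refine (LinearMap.congr_fun hx _).trans ?_
    refine congr_arg₂ _ (congr_arg₂ _ (Finset.sum_congr rfl fun m _ => ?_) ?_)
      (Finset.sum_congr rfl fun i _ => ?_)
    · exact inner_toLp _ (memLp_body S (hr m).isPoly.continuous.continuousOn)
    · exact inner_toLp _ (memLp_body S hw.isPoly.continuous.continuousOn)
    · exact inner_toLp _ (memLp_face S i (IsPoly.continuous (μ i).2).continuousOn)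
  have h0r : IsPolyVecPred k (0 : E d → E d) := fun m => Or.inl rfl
  have h0w : IsPolyPred k (0 : E d → ℝ) := Or.inl rfl
  refine ⟨(_, pu.1), hpq, pu.2, fun r hr => ?_, fun w hw => ?_, fun i μ hμ => ?_⟩
  · have := key r 0 hr h0w 0
    simpa [faceInt_eq] using this
  · have := key 0 w h0r hw 0
    simpa [faceInt_eq] using this
  · classical
    have := key 0 0 h0r h0w (Pi.single i ⟨μ, hμ⟩)
    rw [Finset.sum_eq_single i, Finset.sum_eq_single i] at this
    · simpa [faceInt_eq] using this
    · intro j _ hj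
      simp [faceInt_eq, Pi.single_eq_of_ne hj]
    · simp
    · intro j _ hj
      simp [faceInt_eq, Pi.single_eq_of_ne hj]
    · simp

theorem hdgProj_spec (S : Simplex d) {τ : Fin (d + 1) → ℝ} (hτ : ∀ i, 0 < τ i)
    {q : E d → E d} {u : E d → ℝ} (hq : ContinuousOn q (body S)) (hu : ContinuousOn u (body S)) :
    IsHDGProjection k S τ q u (hdgProj k S τ q u).1 (hdgProj k S τ q u).2 :=
  Classical.epsilon_spec (exists_isHDGProjection S hτ hq hu)

end

section

/-! ### Nodal interpolation -/

variable {d k : ℕ} (S : Simplex d)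

/-- The inverse of `refMap S`, given by the barycentric coordinates. -/
def refInv (x : E d) : E d := WithLp.toLp 2 fun i : Fin d => bary S i.succ x

theorem bary_refMap_succ (x : E d) (i : Fin d) : bary S i.succ (refMap S x) = x i := by
  classical
  have hlin : ∀ v : E d, bary S i.succ (S.points 0 + v) =
      ((vertexBasis S).coord i.succ).linear v := by
    intro v
    have h := ((vertexBasis S).coord i.succ).map_vadd (S.points 0) v
    have h0 : (vertexBasis S).coord i.succ (S.points 0) = 0 :=
      bary_point_ne S (Fin.succ_ne_zero i)
    rw [h0, vadd_eq_add, vadd_eq_add, add_zero, add_comm v] at h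
    exact h
  have hd : ∀ j : Fin d, ((vertexBasis S).coord i.succ).linear (S.points j.succ - S.points 0) =
      if j = i then 1 else 0 := by
    intro j
    rw [← hlin, add_sub_cancel, bary_point]
    simp [Fin.succ_inj, eq_comm]
  rw [refMap, hlin, map_sum]
  simp only [map_smul, hd, smul_eq_mul]
  simp

theorem refInv_refMap (x : E d) : refInv S (refMap S x) = x := by
  ext i
  exact bary_refMap_succ S x i

theorem refMap_refInv (x : E d) : refMap S (refInv S x) = x := by
  have h := sum_bary_smul S x
  have h1 := sum_bary S x
  rw [Fin.sum_univ_succ] at h h1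
  conv_rhs => rw [← h, eq_sub_of_add_eq h1]
  simp only [refMap, refInv, smul_sub, Finset.sum_sub_distrib, ← Finset.sum_smul, sub_smul,
    one_smul]
  abel

theorem invFun_refMap : Function.invFun (refMap S) = refInv S := by
  have hinj : Function.Injective (refMap S) := Function.LeftInverse.injective (refInv_refMap S)
  funext x
  apply hinj
  rw [refMap_refInv]
  exact Function.invFun_eq ⟨refInv S x, refMap_refInv S x⟩

theorem refMap_mem_body_iff (x : E d) : refMap S x ∈ body S ↔ x ∈ refSimplex d := by
  have h1 := sum_bary S (refMap S x)
  rw [Fin.sum_univ_succ] at h1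
  simp only [bary_refMap_succ] at h1
  rw [mem_body, Fin.forall_fin_succ, refSimplex, mem_ofPred_eq]
  simp only [bary_refMap_succ]
  constructor
  · rintro ⟨h, h'⟩
    exact ⟨h', by linarith⟩
  · rintro ⟨h, h'⟩
    exact ⟨by linarith, h⟩

theorem image_refMap : refMap S '' refSimplex d = body S := by
  ext x
  constructor
  · rintro ⟨y, hy, rfl⟩
    exact (refMap_mem_body_iff S y).2 hy
  · intro hx
    refine ⟨refInv S x, ?_, refMap_refInv S x⟩
    rwa [← refMap_mem_body_iff S, refMap_refInv]

theorem isPoly_refInv (i : Fin d) : IsPoly 1 (fun x => refInv S x i) := isPoly_bary S i.succ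

theorem isPoly_refMap (i : Fin d) : IsPoly 1 (fun x => refMap S x i) := by
  have : (fun x => refMap S x i) = (fun _ => S.points 0 i) +
      ∑ m, (S.points m.succ i - S.points 0 i) • fun x : E d => x m := by
    ext x
    simp [refMap, Finset.sum_apply, mul_comm]
  rw [this]
  exact (isPoly_const _ _).add (IsPoly.sum fun m _ => (isPoly_coord m).smul _)

section Nodal

variable (R : NodalElement d k)

/-- The nodal basis functions on `S`. -/
def nodal (j : Fin R.card) : E d → ℝ := fun x => R.shape j (refInv S x)

/-- The Lagrange nodes on `S`. -/
def nodePt (j : Fin R.card) : E d := refMap S (R.node j)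

theorem interp_eq {V : Type} [AddCommGroup V] [Module ℝ V] (g : E d → V) (x : E d) :
    interp R S g x = ∑ j, nodal S R j x • g (nodePt S R j) := by
  rw [interp, invFun_refMap]; rfl

theorem isPoly_nodal (j : Fin R.card) : IsPoly k (nodal S R j) :=
  (R.shape_poly j).comp_affine (isPoly_refInv S)

theorem nodePt_mem (j : Fin R.card) : nodePt S R j ∈ body S :=
  (refMap_mem_body_iff S _).2 (R.node_mem j)

theorem nodal_nodePt (i j : Fin R.card) : nodal S R j (nodePt S R i) = if i = j then 1 else 0 := by
  rw [nodal, nodePt, refInv_refMap, R.shape_node]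

theorem IsPoly.eq_sum_shape {p : E d → ℝ} (hp : IsPoly k p) (x : E d) :
    p x = ∑ j, p (R.node j) * R.shape j x := by
  obtain ⟨c, hc⟩ := (Submodule.mem_span_range_iff_exists_fun ℝ).1 (R.shape_span p hp)
  have hx : ∀ x, p x = ∑ j, c j * R.shape j x := fun x => by
    rw [← hc]; simp [Finset.sum_apply]
  have hcj : ∀ i, p (R.node i) = c i := fun i => by
    rw [hx]; simp [R.shape_node]
  simp only [hcj]
  exact hx x

theorem IsPoly.eq_sum_nodal {p : E d → ℝ} (hp : IsPoly k p) (x : E d) :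
    p x = ∑ j, p (nodePt S R j) * nodal S R j x := by
  have h := (hp.comp_affine (isPoly_refMap S)).eq_sum_shape R (refInv S x)
  simp only [Function.comp_apply, refMap_refInv] at h
  exact h

theorem isPoly_interp (g : E d → ℝ) : IsPoly k (interp R S g) := by
  have : interp R S g = ∑ j, g (nodePt S R j) • nodal S R j := by
    ext x
    simp [HDG.interp_eq, Finset.sum_apply, mul_comm]
  rw [this]
  exact IsPoly.sum fun j _ => (isPoly_nodal S R j).smul _

theorem interp_coord (g : E d → E d) (x : E d) (m : Fin d) :
    interp R S g x m = interp R S (fun y => g y m) x := by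
  simp [HDG.interp_eq]

theorem isPolyVec_interp (g : E d → E d) : IsPolyVec k (interp R S g) := fun m => by
  simp only [interp_coord]
  exact isPoly_interp S R _

theorem interp_nodePt (g : E d → ℝ) (i : Fin R.card) :
    interp R S g (nodePt S R i) = g (nodePt S R i) := by
  simp [HDG.interp_eq, nodal_nodePt]

theorem interp_nodePt_vec (g : E d → E d) (i : Fin R.card) :
    interp R S g (nodePt S R i) = g (nodePt S R i) := by
  simp [HDG.interp_eq, nodal_nodePt]

end Nodal

/-! ### Scaling to the reference simplex -/

theorem isCompact_refSimplex : IsCompact (refSimplex d) := by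
  have h1 : IsCompact (WithLp.toLp 2 '' (Icc (0 : Fin d → ℝ) 1)) :=
    isCompact_Icc.image (PiLp.continuous_toLp 2 _)
  refine h1.of_isClosed_subset ?_ ?_
  · have : refSimplex d = (⋂ i, {x : E d | 0 ≤ x i}) ∩ {x | ∑ i, x i ≤ 1} := by
      ext x; simp [refSimplex]
    rw [this]
    exact (isClosed_iInter fun i => isClosed_le continuous_const (by fun_prop)).inter
      (isClosed_le (by fun_prop) continuous_const)
  · rintro x ⟨h0, h1⟩
    refine ⟨fun i => x i, ⟨fun i => h0 i, fun i => ?_⟩, rfl⟩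
    exact (Finset.single_le_sum (f := fun i => x i) (fun j _ => h0 j) (Finset.mem_univ i)).trans h1

/-- The map is affine, so its Jacobian is constant. Only the sign of J matters later, because the
same factor appears on both sides of every comparison. -/
theorem exists_refMap_scaling (S : Simplex d) : ∃ J : ℝ, 0 ≤ J ∧ ∀ f : E d → ℝ,
    ∫ x in body S, f x = J * ∫ x in refSimplex d, f (refMap S x) := by
  let A : E d →ₗ[ℝ] E d := ∑ i : Fin d, (EuclideanSpace.projₗ (𝕜 := ℝ) i).smulRight
    (S.points i.succ - S.points 0)
  have hA : ∀ x, refMap S x = S.points 0 + (LinearMap.toContinuousLinearMap A) x := by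
    intro x
    simp [refMap, A]
  have hder : ∀ x ∈ refSimplex d, HasFDerivWithinAt (refMap S) (LinearMap.toContinuousLinearMap A)
      (refSimplex d) x := by
    intro x _
    rw [show refMap S = fun x => S.points 0 + (LinearMap.toContinuousLinearMap A) x from funext hA]
    exact ((LinearMap.toContinuousLinearMap A).hasFDerivAt.const_add _).hasFDerivWithinAt
  refine ⟨|(LinearMap.toContinuousLinearMap A).det|, abs_nonneg _, fun f => ?_⟩
  rw [← image_refMap, integral_image_eq_integral_abs_det_fderiv_smul volume
    isCompact_refSimplex.measurableSet hder
    (Function.LeftInverse.injective (refInv_refMap S)).injOn]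
  simp only [smul_eq_mul]
  rw [integral_const_mul]

theorem eq_zero_of_setIntegral_refSimplex [NeZero d] {p : E d → ℝ} (hp : IsPoly k p)
    (h : ∫ x in refSimplex d, p x ^ 2 = 0) : p = 0 := by
  have hc := hp.continuous
  set U : Set (E d) := (⋂ i, {x : E d | 0 < x i}) ∩ {x | ∑ i, x i < 1} with hU
  have hUo : IsOpen U := (isOpen_iInter_of_finite fun i => isOpen_lt continuous_const
    (by fun_prop)).inter (isOpen_lt (by fun_prop) continuous_const)
  have hUne : U.Nonempty := by
    refine ⟨WithLp.toLp 2 fun _ => 1 / ((d : ℝ) + 1), ?_, ?_⟩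
    · simp only [mem_iInter, mem_ofPred_eq]
      intro i
      positivity
    · simp only [mem_ofPred_eq, Finset.sum_const, Finset.card_univ, Fintype.card_fin, nsmul_eq_mul]
      rw [mul_one_div, div_lt_one (by positivity)]
      linarith
  have hsub : U ⊆ refSimplex d := fun x hx =>
    ⟨fun i => le_of_lt (by simpa using mem_iInter.1 hx.1 i), le_of_lt hx.2⟩
  have hae : (fun x => p x ^ 2) =ᵐ[volume.restrict (refSimplex d)] 0 :=
    (setIntegral_eq_zero_iff_of_nonneg_ae (ae_of_all _ fun x => sq_nonneg _)
      ((hc.pow 2).continuousOn.integrableOn_compact isCompact_refSimplex)).1 h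
  have hEq := Measure.eqOn_open_of_ae_eq (ae_restrict_of_ae_restrict_of_subset hsub hae) hUo
    (hc.pow 2).continuousOn continuousOn_const
  exact hp.eq_zero_of_open hUo hUne fun x hx => by simpa using hEq hx

/-- The lower constant is a positive minimum on the unit sphere of coefficients: a combination with
zero L² norm vanishes identically, and then so do its nodal values. The upper bound is the
Cauchy-Schwarz inequality. -/
theorem exists_norm_equiv [NeZero d] (R : NodalElement d k) : ∃ m M : ℝ, 0 < m ∧ 0 < M ∧
    ∀ c : Fin R.card → ℝ,
      m * ∑ j, c j ^ 2 ≤ ∫ x in refSimplex d, (∑ j, c j * R.shape j x) ^ 2 ∧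
      ∫ x in refSimplex d, (∑ j, c j * R.shape j x) ^ 2 ≤ M * ∑ j, c j ^ 2 := by
  have hsc : ∀ j, Continuous (R.shape j) := fun j => (R.shape_poly j).continuous
  have hint : ∀ f : E d → ℝ, Continuous f → IntegrableOn f (refSimplex d) := fun f hf =>
    hf.continuousOn.integrableOn_compact isCompact_refSimplex
  have hexp : ∀ c : Fin R.card → ℝ, ∫ x in refSimplex d, (∑ j, c j * R.shape j x) ^ 2 =
      ∑ i, ∑ j, c i * c j * ∫ x in refSimplex d, R.shape i x * R.shape j x := by
    intro c
    simp only [sq, Finset.sum_mul_sum, ← integral_const_mul]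
    rw [integral_finsetSum _ fun i _ => hint _ (by fun_prop)]
    refine Finset.sum_congr rfl fun i _ => ?_
    rw [integral_finsetSum _ fun j _ => hint _ (by fun_prop)]
    exact Finset.sum_congr rfl fun j _ => integral_congr_ae (ae_of_all _ fun x => by ring)
  have hpos : ∀ c : EuclideanSpace ℝ (Fin R.card), c ∈ Metric.sphere 0 1 →
      0 < ∫ x in refSimplex d, (∑ j, c j * R.shape j x) ^ 2 := by
    intro c hc
    refine lt_of_le_of_ne (integral_nonneg fun x => sq_nonneg _) fun h0 => ?_
    have hp : IsPoly k (fun x => ∑ j, c j * R.shape j x) := by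
      have : (fun x => ∑ j, c j * R.shape j x) = ∑ j, c j • R.shape j := by
        ext x; simp [Finset.sum_apply]
      rw [this]
      exact IsPoly.sum fun j _ => (R.shape_poly j).smul _
    have hz := eq_zero_of_setIntegral_refSimplex hp h0.symm
    have : c = 0 := by
      ext i
      have := congrFun hz (R.node i)
      simpa [R.shape_node] using this
    simp [this] at hc
  obtain ⟨m, hm, hmin⟩ := (isCompact_sphere (0 : EuclideanSpace ℝ (Fin R.card)) 1).exists_forall_le'
    (f := fun c => ∫ x in refSimplex d, (∑ j, c j * R.shape j x) ^ 2) (a := 0)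
    (by simp only [hexp]; fun_prop) hpos
  refine ⟨m, 1 + ∫ x in refSimplex d, ∑ j, R.shape j x ^ 2, hm, ?_, fun c => ⟨?_, ?_⟩⟩
  · have : 0 ≤ ∫ x in refSimplex d, ∑ j, R.shape j x ^ 2 :=
      integral_nonneg fun x => Finset.sum_nonneg fun j _ => sq_nonneg _
    linarith
  · set v : EuclideanSpace ℝ (Fin R.card) := WithLp.toLp 2 c with hv
    have hn : ‖v‖ ^ 2 = ∑ j, c j ^ 2 := by simp [EuclideanSpace.norm_sq_eq, hv]
    by_cases h0 : v = 0
    · have : ∑ j, c j ^ 2 = 0 := by rw [← hn, h0]; simp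
      rw [this, mul_zero]
      exact integral_nonneg fun x => sq_nonneg _
    · have hnp : 0 < ‖v‖ := norm_pos_iff.2 h0
      have h1 := hmin (‖v‖⁻¹ • v) (by simp [norm_smul, hnp.ne'])
      have h2 : ∫ x in refSimplex d, (∑ j, (‖v‖⁻¹ • v) j * R.shape j x) ^ 2 =
          (‖v‖⁻¹) ^ 2 * ∫ x in refSimplex d, (∑ j, c j * R.shape j x) ^ 2 := by
        rw [← integral_const_mul]
        refine integral_congr_ae (ae_of_all _ fun x => ?_)
        simp only [PiLp.smul_apply, smul_eq_mul, mul_assoc, ← Finset.mul_sum, mul_pow, hv]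
      simp only [h2] at h1
      rw [← hn, ← le_div_iff₀ (by positivity)]
      calc m ≤ _ := h1
        _ = _ := by field_simp
  · have h1 : ∫ x in refSimplex d, (∑ j, c j * R.shape j x) ^ 2 ≤
        ∫ x in refSimplex d, (∑ j, c j ^ 2) * ∑ j, R.shape j x ^ 2 := by
      refine integral_mono (hint _ (by fun_prop)) (hint _ (by fun_prop)) fun x => ?_
      exact Finset.sum_mul_sq_le_sq_mul_sq _ _ _
    rw [integral_const_mul] at h1
    have h2 : 0 ≤ ∑ j, c j ^ 2 := Finset.sum_nonneg fun j _ => sq_nonneg _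
    linarith

/-- Stability of nodal interpolation, with a constant that depends only on the reference
element. -/
theorem exists_interp_bound [NeZero d] (R : NodalElement d k) : ∃ C : ℝ, 0 < C ∧
    ∀ (S : Simplex d) (L : ℝ) (g ps : E d → ℝ) (pv : E d → E d), IsPolyVec k pv → IsPoly k ps →
      (∀ j, |g (nodePt S R j)| ≤ L * (‖pv (nodePt S R j)‖ + |ps (nodePt S R j)|)) →
      ∫ x in body S, (interp R S g x) ^ 2 ≤
        C * L ^ 2 * ((∫ x in body S, ‖pv x‖ ^ 2) + ∫ x in body S, ps x ^ 2) := by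
  obtain ⟨m, M, hm, hM, h⟩ := exists_norm_equiv R
  -- M bounds the interpolant by its nodal values, 1/m bounds nodal values of polynomials by their
  -- L² norms, and the 2 comes from squaring the sum in the Lipschitz bound.
  refine ⟨2 * M / m, by positivity, fun S L g ps pv hpv hps hg => ?_⟩
  obtain ⟨J, hJ, hscale⟩ := exists_refMap_scaling S
  have hlow : ∀ p : E d → ℝ, IsPoly k p →
      J * (m * ∑ j, p (nodePt S R j) ^ 2) ≤ ∫ x in body S, p x ^ 2 := by
    intro p hp
    rw [hscale]
    refine mul_le_mul_of_nonneg_left ((h fun j => p (nodePt S R j)).1.trans_eq ?_) hJ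
    refine integral_congr_ae (ae_of_all _ fun x => ?_)
    have := (hp.comp_affine (isPoly_refMap S)).eq_sum_shape R x
    simp only [Function.comp_apply] at this
    simp only [this]
    rfl
  have hupp : ∫ x in body S, (interp R S g x) ^ 2 ≤
      J * (M * ∑ j, g (nodePt S R j) ^ 2) := by
    rw [hscale]
    refine mul_le_mul_of_nonneg_left (le_of_eq_of_le ?_ (h fun j => g (nodePt S R j)).2) hJ
    refine integral_congr_ae (ae_of_all _ fun x => ?_)
    simp only [HDG.interp_eq, nodal, refInv_refMap, smul_eq_mul, mul_comm]
  have hvec : J * (m * ∑ j, ‖pv (nodePt S R j)‖ ^ 2) ≤ ∫ x in body S, ‖pv x‖ ^ 2 := by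
    have h1 : ∫ x in body S, ‖pv x‖ ^ 2 = ∑ i, ∫ x in body S, pv x i ^ 2 := by
      rw [← integral_finsetSum]
      · exact integral_congr_ae (ae_of_all _ fun x => by simp [EuclideanSpace.norm_sq_eq])
      · exact fun i _ => integrableOn_body S ((hpv i).continuous.pow 2).continuousOn
    rw [h1]
    refine le_trans (le_of_eq ?_) (Finset.sum_le_sum fun i _ => hlow _ (hpv i))
    rw [← Finset.mul_sum, ← Finset.mul_sum, Finset.sum_comm]
    simp [EuclideanSpace.norm_sq_eq]
  have hpt : ∑ j, g (nodePt S R j) ^ 2 ≤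
      2 * L ^ 2 * ∑ j, ‖pv (nodePt S R j)‖ ^ 2 + 2 * L ^ 2 * ∑ j, ps (nodePt S R j) ^ 2 := by
    rw [Finset.mul_sum, Finset.mul_sum, ← Finset.sum_add_distrib]
    refine Finset.sum_le_sum fun j _ => ?_
    have h1 := hg j
    have h2 : g (nodePt S R j) ^ 2 ≤
        (L * (‖pv (nodePt S R j)‖ + |ps (nodePt S R j)|)) ^ 2 := sq_le_sq' (by
      linarith [neg_abs_le (g (nodePt S R j))]) ((le_abs_self _).trans h1)
    have h3 := sq_abs (ps (nodePt S R j))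
    nlinarith [sq_nonneg (L * (‖pv (nodePt S R j)‖ - |ps (nodePt S R j)|))]
  calc _ ≤ J * (M * ∑ j, g (nodePt S R j) ^ 2) := hupp
    _ ≤ J * (M * (2 * L ^ 2 * ∑ j, ‖pv (nodePt S R j)‖ ^ 2 +
        2 * L ^ 2 * ∑ j, ps (nodePt S R j) ^ 2)) := by gcongr
    _ = 2 * M / m * L ^ 2 * (J * (m * ∑ j, ‖pv (nodePt S R j)‖ ^ 2) +
        J * (m * ∑ j, ps (nodePt S R j) ^ 2)) := by field_simp
    _ ≤ _ := by
      gcongr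
      exact hlow ps hps

end

section

/-! ### Functions that are continuously differentiable in time -/

variable {d k : ℕ}

/-- `f` is continuous on `[0, T] × B` and continuously differentiable in time with time
derivative `f'`. -/
structure IsC1On (T : ℝ) (B : Set (E d)) {V : Type*} [NormedAddCommGroup V] [NormedSpace ℝ V]
    (f f' : ℝ → E d → V) : Prop where
  cont : ContinuousOn (fun p : ℝ × E d => f p.1 p.2) (Icc 0 T ×ˢ B)
  cont' : ContinuousOn (fun p : ℝ × E d => f' p.1 p.2) (Icc 0 T ×ˢ B)
  deriv : ∀ t ∈ Icc 0 T, ∀ x ∈ B, HasDerivWithinAt (fun s => f s x) (f' t x) (Icc 0 T) t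

namespace IsC1On

variable {T : ℝ} {B : Set (E d)} {V : Type*} [NormedAddCommGroup V]

theorem mono [NormedSpace ℝ V] {B' : Set (E d)} {f f' : ℝ → E d → V} (h : IsC1On T B f f')
    (hB : B' ⊆ B) : IsC1On T B' f f' :=
  ⟨h.cont.mono (prod_mono_right hB), h.cont'.mono (prod_mono_right hB),
    fun t ht x hx => h.deriv t ht x (hB hx)⟩

theorem const [NormedSpace ℝ V] {g : E d → V} (hg : ContinuousOn g B) :
    IsC1On T B (fun _ => g) (fun _ _ => 0) :=
  ⟨hg.comp continuousOn_snd fun _ hp => hp.2, continuousOn_const,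
    fun _ _ _ _ => hasDerivWithinAt_const _ _ _⟩

theorem sub [NormedSpace ℝ V] {f f' g g' : ℝ → E d → V} (hf : IsC1On T B f f')
    (hg : IsC1On T B g g') : IsC1On T B (fun t x => f t x - g t x) (fun t x => f' t x - g' t x) :=
  ⟨hf.cont.sub hg.cont, hf.cont'.sub hg.cont', fun t ht x hx =>
    (hf.deriv t ht x hx).sub (hg.deriv t ht x hx)⟩

theorem add [NormedSpace ℝ V] {f f' g g' : ℝ → E d → V} (hf : IsC1On T B f f')
    (hg : IsC1On T B g g') : IsC1On T B (fun t x => f t x + g t x) (fun t x => f' t x + g' t x) :=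
  ⟨hf.cont.add hg.cont, hf.cont'.add hg.cont', fun t ht x hx =>
    (hf.deriv t ht x hx).add (hg.deriv t ht x hx)⟩

theorem inner [InnerProductSpace ℝ V] {f f' g g' : ℝ → E d → V} (hf : IsC1On T B f f')
    (hg : IsC1On T B g g') : IsC1On T B (fun t x => inner ℝ (f t x) (g t x))
      (fun t x => inner ℝ (f t x) (g' t x) + inner ℝ (f' t x) (g t x)) :=
  ⟨hf.cont.inner hg.cont, (hf.cont.inner hg.cont').add (hf.cont'.inner hg.cont),
    fun t ht x hx => (hf.deriv t ht x hx).inner ℝ (hg.deriv t ht x hx)⟩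

theorem mul {f f' g g' : ℝ → E d → ℝ} (hf : IsC1On T B f f')
    (hg : IsC1On T B g g') : IsC1On T B (fun t x => f t x * g t x)
      (fun t x => f' t x * g t x + f t x * g' t x) :=
  ⟨hf.cont.mul hg.cont, (hf.cont'.mul hg.cont).add (hf.cont.mul hg.cont'),
    fun t ht x hx => (hf.deriv t ht x hx).mul (hg.deriv t ht x hx)⟩

theorem of_coeff [NormedSpace ℝ V] {ι : Type*} [Fintype ι] {c c' : ι → ℝ → V} {g : ι → E d → ℝ}
    (hc : ∀ j, ContinuousOn (c j) (Icc 0 T)) (hc' : ∀ j, ContinuousOn (c' j) (Icc 0 T))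
    (hd : ∀ j, ∀ t ∈ Icc 0 T, HasDerivWithinAt (c j) (c' j t) (Icc 0 T) t)
    (hg : ∀ j, ContinuousOn (g j) B) :
    IsC1On T B (fun t x => ∑ j, g j x • c j t) (fun t x => ∑ j, g j x • c' j t) := by
  refine ⟨?_, ?_, fun t ht x hx => ?_⟩
  · exact continuousOn_finsetSum _ fun j _ => ((hg j).comp continuousOn_snd fun p hp => hp.2).smul
      ((hc j).comp continuousOn_fst fun p hp => hp.1)
  · exact continuousOn_finsetSum _ fun j _ => ((hg j).comp continuousOn_snd fun p hp => hp.2).smul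
      ((hc' j).comp continuousOn_fst fun p hp => hp.1)
  · exact HasDerivWithinAt.fun_sum fun j _ => (hd j t ht).const_smul _

end IsC1On

/-! ### Integrals depending on time -/

section Parametric

variable {T : ℝ} {B : Set (E d)} {ν : Measure (E d)} [IsFiniteMeasure ν]

theorem slice_aestronglyMeasurable (hB : IsCompact B) (hν : ∀ᵐ x ∂ν, x ∈ B) {f : ℝ → E d → ℝ}
    (hf : ContinuousOn (fun p : ℝ × E d => f p.1 p.2) (Icc 0 T ×ˢ B)) {t : ℝ}
    (ht : t ∈ Icc 0 T) : AEStronglyMeasurable (f t) ν := by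
  rw [← Measure.restrict_eq_self_of_ae_mem hν]
  exact (hf.comp (f := fun x => (t, x)) (by fun_prop) fun x hx => ⟨ht, hx⟩).aestronglyMeasurable
    hB.measurableSet

theorem continuousOn_integral_param (hB : IsCompact B) (hν : ∀ᵐ x ∂ν, x ∈ B) {f : ℝ → E d → ℝ}
    (hf : ContinuousOn (fun p : ℝ × E d => f p.1 p.2) (Icc 0 T ×ˢ B)) :
    ContinuousOn (fun t => ∫ x, f t x ∂ν) (Icc 0 T) := by
  obtain ⟨M, hM⟩ := (isCompact_Icc.prod hB).exists_bound_of_continuousOn hf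
  refine continuousOn_of_dominated (bound := fun _ => M)
    (fun t ht => slice_aestronglyMeasurable hB hν hf ht) (fun t ht => ?_) (integrable_const M) ?_
  · filter_upwards [hν] with x hx using hM (t, x) ⟨ht, hx⟩
  · filter_upwards [hν] with x hx
    exact hf.comp (f := fun t => (t, x)) (by fun_prop) fun t ht => ⟨ht, hx⟩

/-- Difference quotients are bounded by the supremum of the time derivative, by the mean value
inequality, so dominated convergence applies, also at the end points of the interval. -/
theorem hasDerivWithinAt_integral_param (hB : IsCompact B) (hν : ∀ᵐ x ∂ν, x ∈ B)
    {f f' : ℝ → E d → ℝ} (hf : IsC1On T B f f') {t : ℝ} (ht : t ∈ Icc 0 T) :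
    HasDerivWithinAt (fun t => ∫ x, f t x ∂ν) (∫ x, f' t x ∂ν) (Icc 0 T) t := by
  obtain ⟨M, hM⟩ := (isCompact_Icc.prod hB).exists_bound_of_continuousOn hf.cont
  have hcont := continuousOn_integral_param hB hν hf.cont
  have hcont' := continuousOn_integral_param hB hν hf.cont'
  have hint : ∀ s ∈ Icc 0 T, Integrable (f s) ν := fun s hs =>
    Integrable.of_bound (slice_aestronglyMeasurable hB hν hf.cont hs) M (by
      filter_upwards [hν] with x hx using hM (s, x) ⟨hs, hx⟩)
  obtain ⟨M', hM'⟩ := (isCompact_Icc.prod hB).exists_bound_of_continuousOn hf.cont'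
  rw [hasDerivWithinAt_iff_tendsto_slope]
  have hslope : ∀ s ∈ Icc 0 T, ∀ x ∈ B, ‖slope (fun r => f r x) t s‖ ≤ M' := by
    intro s hs x hx
    have h := (convex_Icc (0 : ℝ) T).norm_image_sub_le_of_norm_hasDerivWithin_le
      (fun r hr => hf.deriv r hr x hx) (fun r hr => hM' (r, x) ⟨hr, hx⟩) ht hs
    rw [slope_def_module, norm_smul, norm_inv]
    by_cases hst : s = t
    · subst hst
      simpa using (norm_nonneg _).trans (hM' (s, x) ⟨hs, hx⟩)
    · rwa [inv_mul_le_iff₀ (norm_pos_iff.2 (sub_ne_zero.2 hst)), mul_comm]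
  have hlim : Filter.Tendsto (fun s => ∫ x, slope (fun r => f r x) t s ∂ν)
      (nhdsWithin t (Icc 0 T \ {t})) (nhds (∫ x, f' t x ∂ν)) := by
    refine tendsto_integral_filter_of_dominated_convergence (fun _ => M') ?_ ?_
      (integrable_const M') ?_
    · filter_upwards [self_mem_nhdsWithin] with s hs
      simp only [slope_def_module]
      exact (((hint s hs.1).sub (hint t ht)).smul (s - t)⁻¹).aestronglyMeasurable
    · filter_upwards [self_mem_nhdsWithin] with s hs
      filter_upwards [hν] with x hx using hslope s hs.1 x hx
    · filter_upwards [hν] with x hx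
      exact hasDerivWithinAt_iff_tendsto_slope.1 (hf.deriv t ht x hx)
  refine hlim.congr' ?_
  filter_upwards [self_mem_nhdsWithin] with s hs
  simp only [slope_def_module]
  rw [integral_smul, integral_sub (hint s hs.1) (hint t ht)]

end Parametric

/-! ### The HDG projection in time -/

variable [NeZero d] (S : Simplex d) {T : ℝ}

instance isFiniteMeasure_body : IsFiniteMeasure (volume.restrict (body S)) :=
  ⟨by simpa using (isCompact_body S).measure_lt_top⟩

theorem ae_mem_body : ∀ᵐ x ∂volume.restrict (body S), x ∈ body S :=
  ae_restrict_mem (measurableSet_body S)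

theorem hasDerivWithinAt_moments {τ : Fin (d + 1) → ℝ} {u ut : ℝ → E d → ℝ}
    {q qt : ℝ → E d → E d} (hu : IsC1On T (body S) u ut) (hq : IsC1On T (body S) q qt)
    {r : E d → E d} {w : E d → ℝ} {μ : Fin (d + 1) → E d → ℝ} (hr : Continuous r)
    (hw : Continuous w) (hμ : ∀ i, Continuous (μ i)) {t : ℝ} (ht : t ∈ Icc 0 T) :
    HasDerivWithinAt (fun t => (∫ x in body S, inner ℝ (q t x) (r x)) +
        (∫ x in body S, u t x * w x) +
        ∑ i, faceInt S i (fun x => (inner ℝ (q t x) (normal S i) + τ i * u t x) * μ i x))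
      ((∫ x in body S, inner ℝ (qt t x) (r x)) + (∫ x in body S, ut t x * w x) +
        ∑ i, faceInt S i (fun x => (inner ℝ (qt t x) (normal S i) + τ i * ut t x) * μ i x))
      (Icc 0 T) t := by
  refine (HasDerivWithinAt.add ?_ ?_).add (HasDerivWithinAt.fun_sum fun i _ => ?_)
  · have h := hasDerivWithinAt_integral_param (isCompact_body S) (ae_mem_body S)
      (hq.inner (IsC1On.const hr.continuousOn)) ht
    simpa using h
  · have h := hasDerivWithinAt_integral_param (isCompact_body S) (ae_mem_body S)
      (hu.mul (IsC1On.const hw.continuousOn)) ht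
    simpa using h
  · have h := hasDerivWithinAt_integral_param (isCompact_face S i) (faceMeasure_ae_mem S i)
      ((((hq.inner (IsC1On.const (g := fun _ => normal S i) continuousOn_const)).add
        ((IsC1On.const (g := fun _ => τ i) continuousOn_const).mul hu)).mul
          (IsC1On.const (hμ i).continuousOn)).mono (face_subset_body S i)) ht
    simpa [faceInt_eq] using h

theorem continuousOn_moments {τ : Fin (d + 1) → ℝ} {u : ℝ → E d → ℝ} {q : ℝ → E d → E d}
    (hu : ContinuousOn (fun p : ℝ × E d => u p.1 p.2) (Icc 0 T ×ˢ body S))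
    (hq : ContinuousOn (fun p : ℝ × E d => q p.1 p.2) (Icc 0 T ×ˢ body S))
    {r : E d → E d} {w : E d → ℝ} {μ : Fin (d + 1) → E d → ℝ} (hr : Continuous r)
    (hw : Continuous w) (hμ : ∀ i, Continuous (μ i)) :
    ContinuousOn (fun t => (∫ x in body S, inner ℝ (q t x) (r x)) +
        (∫ x in body S, u t x * w x) +
        ∑ i, faceInt S i (fun x => (inner ℝ (q t x) (normal S i) + τ i * u t x) * μ i x))
      (Icc 0 T) := by
  refine (ContinuousOn.add ?_ ?_).add (continuousOn_finsetSum _ fun i _ => ?_)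
  · exact continuousOn_integral_param (isCompact_body S) (ae_mem_body S)
      (hq.inner (hr.comp continuous_snd).continuousOn)
  · exact continuousOn_integral_param (isCompact_body S) (ae_mem_body S)
      (hu.mul (hw.comp continuous_snd).continuousOn)
  · exact continuousOn_integral_param (isCompact_face S i) (faceMeasure_ae_mem S i)
      ((((hq.inner continuousOn_const).add (continuousOn_const.mul hu)).mono
        (prod_mono_right (face_subset_body S i))).mul
          ((hμ i).comp continuous_snd).continuousOn)

theorem slice_continuousOn {V : Type*} [TopologicalSpace V] {B : Set (E d)} {f : ℝ → E d → V}
    (hf : ContinuousOn (fun p : ℝ × E d => f p.1 p.2) (Icc 0 T ×ˢ B)) {t : ℝ}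
    (ht : t ∈ Icc 0 T) : ContinuousOn (f t) B :=
  hf.comp (f := fun x => (t, x)) (by fun_prop) fun _ hx => ⟨ht, hx⟩

/-- Linear functionals of the HDG projection are differentiable in time. -/
theorem hasDerivWithinAt_hdgProj_functional {τ : Fin (d + 1) → ℝ}
    (hτ : ∀ i, 0 < τ i) {u ut : ℝ → E d → ℝ} {q qt : ℝ → E d → E d}
    (hu : IsC1On T (body S) u ut) (hq : IsC1On T (body S) q qt)
    {ev : (E d → E d) × (E d → ℝ) → ℝ}
    (hev : ∃ ev' : TrialSpace d k →ₗ[ℝ] ℝ, ∀ (pq : E d → E d) (pu : E d → ℝ)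
      (hpq : IsPolyVec k pq) (hpu : IsPoly k pu),
      ev (pq, pu) = ev' (fun m => ⟨_, hpq m⟩, ⟨pu, hpu⟩)) :
    ContinuousOn (fun t => ev (hdgProj k S τ (q t) (u t))) (Icc 0 T) ∧
    ContinuousOn (fun t => ev (hdgProj k S τ (qt t) (ut t))) (Icc 0 T) ∧
    ∀ t ∈ Icc 0 T, HasDerivWithinAt (fun t => ev (hdgProj k S τ (q t) (u t)))
      (ev (hdgProj k S τ (qt t) (ut t))) (Icc 0 T) t := by
  obtain ⟨ev', hev⟩ := hev
  obtain ⟨r, w, μ, hr, hw, hμ, hmom⟩ := IsHDGProjection.exists_moments S hτ ev'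
  have h1 : ∀ t ∈ Icc 0 T, ev (hdgProj k S τ (q t) (u t)) = _ := fun t ht =>
    (hev _ _ _ _).trans (hmom _ _ _ _ (hdgProj_spec S hτ (slice_continuousOn hq.cont ht)
      (slice_continuousOn hu.cont ht)))
  have h2 : ∀ t ∈ Icc 0 T, ev (hdgProj k S τ (qt t) (ut t)) = _ := fun t ht =>
    (hev _ _ _ _).trans (hmom _ _ _ _ (hdgProj_spec S hτ (slice_continuousOn hq.cont' ht)
      (slice_continuousOn hu.cont' ht)))
  have hrc := hr.isPolyVec.continuous
  have hwc := hw.isPoly.continuous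
  have hμc := fun i => (hμ i).continuous
  refine ⟨(continuousOn_moments S hu.cont hq.cont hrc hwc hμc).congr h1,
    (continuousOn_moments S hu.cont' hq.cont' hrc hwc hμc).congr h2, fun t ht => ?_⟩
  rw [h2 t ht]
  exact (hasDerivWithinAt_moments S hu hq hrc hwc hμc ht).congr h1 (h1 t ht)

/-- Nodal values of the projection are linear functionals, hence fixed moments of the data, hence C¹
in time. The nodal expansion turns this into joint continuity in time and space. -/
theorem isC1On_hdgProj_snd (R : NodalElement d k) {τ : Fin (d + 1) → ℝ} (hτ : ∀ i, 0 < τ i)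
    {u ut : ℝ → E d → ℝ} {q qt : ℝ → E d → E d}
    (hu : IsC1On T (body S) u ut) (hq : IsC1On T (body S) q qt) :
    IsC1On T univ (fun t => (hdgProj k S τ (q t) (u t)).2)
      (fun t => (hdgProj k S τ (qt t) (ut t)).2) := by
  have h := fun x => hasDerivWithinAt_hdgProj_functional (k := k) S hτ hu hq
    (ev := fun p => p.2 x)
    ⟨LinearMap.proj x ∘ₗ (polySpace d k).subtype ∘ₗ LinearMap.snd ℝ _ _, fun _ _ _ _ => rfl⟩
  have hc := IsC1On.of_coeff (B := (univ : Set (E d))) (T := T) (g := nodal S R)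
    (fun j => (h (nodePt S R j)).1) (fun j => (h (nodePt S R j)).2.1)
    (fun j => (h (nodePt S R j)).2.2) (fun j => (isPoly_nodal S R j).continuous.continuousOn)
  have e1 : ∀ t ∈ Icc 0 T, ∀ x, (hdgProj k S τ (q t) (u t)).2 x =
      ∑ j, nodal S R j x • (hdgProj k S τ (q t) (u t)).2 (nodePt S R j) := fun t ht x => by
    rw [(hdgProj_spec S hτ (slice_continuousOn hq.cont ht)
      (slice_continuousOn hu.cont ht)).poly_u.eq_sum_nodal S R]
    simp only [smul_eq_mul, mul_comm]
  have e2 : ∀ t ∈ Icc 0 T, ∀ x, (hdgProj k S τ (qt t) (ut t)).2 x =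
      ∑ j, nodal S R j x • (hdgProj k S τ (qt t) (ut t)).2 (nodePt S R j) := fun t ht x => by
    rw [(hdgProj_spec S hτ (slice_continuousOn hq.cont' ht)
      (slice_continuousOn hu.cont' ht)).poly_u.eq_sum_nodal S R]
    simp only [smul_eq_mul, mul_comm]
  exact ⟨hc.cont.congr fun p hp => e1 p.1 hp.1 p.2, hc.cont'.congr fun p hp => e2 p.1 hp.1 p.2,
    fun t ht x _ => (h x).2.2 t ht⟩

theorem isC1On_hdgProj_fst (R : NodalElement d k) {τ : Fin (d + 1) → ℝ} (hτ : ∀ i, 0 < τ i)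
    {u ut : ℝ → E d → ℝ} {q qt : ℝ → E d → E d}
    (hu : IsC1On T (body S) u ut) (hq : IsC1On T (body S) q qt) :
    IsC1On T univ (fun t => (hdgProj k S τ (q t) (u t)).1)
      (fun t => (hdgProj k S τ (qt t) (ut t)).1) := by
  have h := fun x m => hasDerivWithinAt_hdgProj_functional (k := k) S hτ hu hq
    (ev := fun p => p.1 x m)
    ⟨LinearMap.proj x ∘ₗ (polySpace d k).subtype ∘ₗ LinearMap.proj m ∘ₗ LinearMap.fst ℝ _ _,
      fun _ _ _ _ => rfl⟩
  have hc := IsC1On.of_coeff (B := (univ : Set (E d))) (T := T)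
    (c := fun (a : Fin R.card × Fin d) t => (hdgProj k S τ (q t) (u t)).1 (nodePt S R a.1) a.2 •
      (EuclideanSpace.single a.2 1 : E d))
    (c' := fun a t => (hdgProj k S τ (qt t) (ut t)).1 (nodePt S R a.1) a.2 •
      (EuclideanSpace.single a.2 1 : E d))
    (g := fun a => nodal S R a.1)
    (fun a => (h (nodePt S R a.1) a.2).1.smul continuousOn_const)
    (fun a => (h (nodePt S R a.1) a.2).2.1.smul continuousOn_const)
    (fun a t ht => ((h (nodePt S R a.1) a.2).2.2 t ht).smul_const _)
    (fun a => (isPoly_nodal S R a.1).continuous.continuousOn)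
  have key : ∀ v : E d → E d, IsPolyVec k v → ∀ x, v x =
      ∑ a : Fin R.card × Fin d, nodal S R a.1 x •
        (v (nodePt S R a.1) a.2 • (EuclideanSpace.single a.2 1 : E d)) := fun v hv x => by
    ext m
    rw [Fintype.sum_prod_type, (hv m).eq_sum_nodal S R]
    simp [mul_comm, Pi.single_apply]
  have e1 := fun t (ht : t ∈ Icc 0 T) => key _ (hdgProj_spec (k := k) S hτ
    (slice_continuousOn hq.cont ht) (slice_continuousOn hu.cont ht)).poly_q
  have e2 := fun t (ht : t ∈ Icc 0 T) => key _ (hdgProj_spec (k := k) S hτ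
    (slice_continuousOn hq.cont' ht) (slice_continuousOn hu.cont' ht)).poly_q
  refine ⟨hc.cont.congr fun p hp => e1 p.1 hp.1 p.2, hc.cont'.congr fun p hp => e2 p.1 hp.1 p.2,
    fun t ht x hx => ?_⟩
  rw [e2 t ht x]
  exact (hc.deriv t ht x hx).congr (fun s hs => e1 s hs x) (e1 t ht x)

end

section

/-! ### Faces of a conforming mesh -/

variable {d N : ℕ} {𝒯 : Mesh d N} {Ω : Set (E d)}

theorem interior_body_ae_eq (S : Simplex d) : interior (body S) =ᵐ[volume] body S :=
  interior_ae_eq_of_null_frontier ((convex_body S).addHaar_frontier volume)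

namespace Mesh.Partitions

theorem isOpen (h : 𝒯.Partitions Ω) : IsOpen Ω := by
  rw [show Ω = _ from h]; exact isOpen_interior

theorem interior_body_subset (h : 𝒯.Partitions Ω) (K : Fin N) :
    interior (body (𝒯.elem K)) ⊆ Ω := by
  rw [show Ω = _ from h]
  exact interior_mono (subset_iUnion (fun K => body (𝒯.elem K)) K)

theorem body_subset_closure (h : 𝒯.Partitions Ω) (K : Fin N) :
    body (𝒯.elem K) ⊆ closure Ω := by
  rw [← closure_interior_body]
  exact closure_mono (h.interior_body_subset K)

theorem subset_iUnion_body (h : 𝒯.Partitions Ω) : Ω ⊆ ⋃ K, body (𝒯.elem K) := by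
  rw [show Ω = _ from h]; exact interior_subset

/-- A face that is not a boundary face has a point in `Ω` that lies in its relative interior. -/
theorem exists_mem_face [NeZero d] (h : 𝒯.Partitions Ω) {K : Fin N} {i : Fin (d + 1)}
    (hF : ¬ IsBoundaryFace Ω (face (𝒯.elem K) i)) :
    ∃ y ∈ face (𝒯.elem K) i, y ∈ Ω ∧ ∀ j, j ≠ i → 0 < bary (𝒯.elem K) j y := by
  obtain ⟨x, hx, hxF⟩ := not_subset.1 hF
  have hxΩ : x ∈ Ω := by
    by_contra hc
    refine hxF ⟨h.body_subset_closure K (face_subset_body _ _ hx), ?_⟩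
    rwa [h.isOpen.interior_eq]
  -- Moving slightly from `x` towards the face centre stays in the open set and makes the remaining
  -- coordinates positive.
  obtain ⟨z, hz0, hz⟩ := exists_faceCenter (𝒯.elem K) i
  have hcont : Filter.Tendsto (fun s : ℝ => x + s • (z - x)) (nhdsWithin 0 (Ioi 0)) (nhds x) := by
    have : Continuous (fun s : ℝ => x + s • (z - x)) := by fun_prop
    simpa using (this.tendsto 0).mono_left nhdsWithin_le_nhds
  obtain ⟨s, hsΩ, hs⟩ := ((hcont.eventually (h.isOpen.mem_nhds hxΩ)).and
    (Ioo_mem_nhdsGT (zero_lt_one' ℝ))).exists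
  have hb := (mem_face (𝒯.elem K) i).1 hx
  have hpos : ∀ j, j ≠ i → 0 < bary (𝒯.elem K) j (x + s • (z - x)) := fun j hj => by
    rw [bary_lineMap]
    nlinarith [hb.1 j, hz j hj, hs.1, hs.2, mul_nonneg (sub_nonneg.2 hs.2.le) (hb.1 j),
      mul_pos hs.1 (hz j hj)]
  have h0 : bary (𝒯.elem K) i (x + s • (z - x)) = 0 := by
    rw [bary_lineMap, hb.2, hz0]; ring
  refine ⟨_, (mem_face _ _).2 ⟨fun j => ?_, h0⟩, hsΩ, hpos⟩
  by_cases hj : j = i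
  · rw [hj, h0]
  · exact (hpos j hj).le

end Mesh.Partitions

theorem bary_eq_zero_of_mem_convexHull (S : Simplex d) {j : Fin (d + 1)} {A : Set (E d)}
    (hA : A ⊆ range S.points) (hj : S.points j ∉ A) {y : E d} (hy : y ∈ convexHull ℝ A) :
    bary S j y = 0 := by
  have hconv : Convex ℝ {x | bary S j x = 0} := by
    intro x hx z hz a b _ _ hab
    have hx' : bary S j x = 0 := hx
    have hz' : bary S j z = 0 := hz
    have : a • x + b • z = x + b • (z - x) := by
      rw [← eq_sub_iff_add_eq] at hab
      rw [hab, sub_smul, one_smul, smul_sub]; abel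
    change bary S j _ = 0
    rw [this, bary_lineMap, hx', hz']; ring
  refine convexHull_min ?_ hconv hy
  intro x hx
  obtain ⟨l, rfl⟩ := hA hx
  exact bary_point_ne S fun h => hj (h ▸ hx)

/-- A point in the relative interior of a face belongs to no other face of the mesh. -/
theorem Mesh.face_eq_of_mem (𝒯 : Mesh d N) {K K' : Fin N} {i i' : Fin (d + 1)} {y : E d}
    (hy : y ∈ face (𝒯.elem K) i) (hpos : ∀ j, j ≠ i → 0 < bary (𝒯.elem K) j y)
    (hy' : y ∈ face (𝒯.elem K') i') : face (𝒯.elem K') i' = face (𝒯.elem K) i := by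
  set S := 𝒯.elem K
  set S' := 𝒯.elem K'
  have hmem : y ∈ convexHull ℝ (range S.points ∩ range S'.points) := by
    rw [← 𝒯.conforming K K']
    exact ⟨face_subset_body _ _ hy, face_subset_body _ _ hy'⟩
  -- By conformity `y` is a convex combination of common vertices. A vertex with positive coordinate
  -- at `y` must be among them.
  have hvert : ∀ j, j ≠ i → S.points j ∈ range S'.points := fun j hj => by
    by_contra hc
    exact (hpos j hj).ne' (bary_eq_zero_of_mem_convexHull S inter_subset_left
      (fun h => hc h.2) hmem)
  have hsub : S.points '' {i}ᶜ ⊆ S'.points '' {i'}ᶜ := by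
    rintro _ ⟨j, hj, rfl⟩
    obtain ⟨l, hl⟩ := hvert j hj
    refine ⟨l, ?_, hl⟩
    rintro rfl
    have h1 : y ∈ convexHull ℝ (S.points '' {i}ᶜ) := hy
    -- If vertex `j` of the first face were the vertex omitted by the second, this comparison, which
    -- holds at every vertex of the first face, would hold at `y`. There the left side is positive
    -- and the right side is zero.
    have h2 : bary S j y ≤ bary S' l y := by
      have hconv : Convex ℝ {x | 0 ≤ bary S' l x - bary S j x} := by
        intro x hx z hz a b ha hb hab
        have hx' : 0 ≤ bary S' l x - bary S j x := hx
        have hz' : 0 ≤ bary S' l z - bary S j z := hz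
        have e : a • x + b • z = x + b • (z - x) := by
          rw [← eq_sub_iff_add_eq] at hab
          rw [hab, sub_smul, one_smul, smul_sub]; abel
        change 0 ≤ bary S' l _ - bary S j _
        rw [e, bary_lineMap, bary_lineMap]
        have : a = 1 - b := by linarith
        subst this
        nlinarith [mul_nonneg ha hx', mul_nonneg hb hz']
      have := convexHull_min (s := S.points '' {i}ᶜ) (t := {x | 0 ≤ bary S' l x - bary S j x})
        (by
          rintro _ ⟨m, hm, rfl⟩
          change 0 ≤ bary S' l _ - bary S j _
          by_cases hmj : m = j
          · rw [hmj, bary_point_self, ← hl, bary_point_self]; simp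
          · rw [bary_point_ne S fun h => hmj h.symm]
            obtain ⟨p, hp⟩ := hvert m hm
            rw [← hp, sub_zero]
            by_cases hpl : l = p
            · rw [hpl, bary_point_self]; exact zero_le_one
            · rw [bary_point_ne S' hpl]) hconv h1
      exact sub_nonneg.1 this
    rw [((mem_face S' l).1 hy').2] at h2
    exact absurd (hpos j hj) (not_lt.2 h2)
  have hcard : ∀ (P : Simplex d) (m : Fin (d + 1)), (P.points '' {m}ᶜ).ncard = d := fun P m => by
    rw [ncard_image_of_injective _ P.independent.injective, ncard_eq_toFinset_card']
    simp [Finset.card_compl]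
  have heq := eq_of_subset_of_ncard_le hsub (by rw [hcard, hcard])
    ((finite_range S'.points).subset (image_subset_range _ _))
  change convexHull ℝ _ = convexHull ℝ _
  rw [heq]

theorem integral_gradient_eq_zero {φ : E d → ℝ} (hφ : ContDiff ℝ 1 φ) (hc : HasCompactSupport φ)
    (e : E d) : ∫ x, inner ℝ (gradient φ x) e = 0 := by
  have hfd : ∀ x, inner ℝ (gradient φ x) e = fderiv ℝ φ x e := fun x => by
    simp [gradient]
  simp only [hfd]
  have h := integral_mul_fderiv_eq_neg_fderiv_mul_of_integrable (𝕜 := ℝ) (μ := volume)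
    (f := fun _ : E d => (1 : ℝ)) (g := φ) (v := e) (by simp) ?_ ?_ (by fun_prop)
    (fun x _ => hφ.differentiable one_ne_zero x)
  · simpa using h
  · simp only [one_mul]
    exact ((hφ.continuous_fderiv one_ne_zero).clm_apply continuous_const).integrable_of_hasCompactSupport
      (hc.fderiv_apply ℝ e)
  · simpa using hφ.continuous.integrable_of_hasCompactSupport hc

variable [NeZero d]

theorem Mesh.Partitions.sum_setIntegral_eq_zero (h : 𝒯.Partitions Ω) {φ : E d → ℝ}
    (hφ : ContDiff ℝ 1 φ) (hc : HasCompactSupport φ) (hs : tsupport φ ⊆ Ω) (e : E d) :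
    ∑ K, ∫ x in body (𝒯.elem K), inner ℝ (gradient φ x) e = 0 := by
  have hcont : Continuous fun x => inner ℝ (gradient φ x) e := by
    have hfd : ∀ x, inner ℝ (gradient φ x) e = fderiv ℝ φ x e := fun x => by simp [gradient]
    simp only [hfd]
    exact (hφ.continuous_fderiv one_ne_zero).clm_apply continuous_const
  have hsupp : ∀ x, x ∉ Ω → inner ℝ (gradient φ x) e = 0 := fun x hx => by
    have : fderiv ℝ φ x = 0 := by
      by_contra hne
      exact hx (hs (support_fderiv_subset ℝ hne))
    simp [gradient, this]
  have hK : ∀ K, ∫ x in body (𝒯.elem K), inner ℝ (gradient φ x) e =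
      ∫ x in interior (body (𝒯.elem K)), inner ℝ (gradient φ x) e := fun K =>
    (setIntegral_congr_set (interior_body_ae_eq _)).symm
  simp only [hK]
  rw [← integral_iUnion_fintype (fun K => isOpen_interior.measurableSet)
    (fun K K' hne => 𝒯.disjoint K K' hne)
    (fun K => (integrableOn_body _ hcont.continuousOn).mono_set interior_subset)]
  have hae : (⋃ K, interior (body (𝒯.elem K))) =ᵐ[volume] (⋃ K, body (𝒯.elem K)) :=
    Filter.EventuallyEq.countable_iUnion fun K => interior_body_ae_eq _
  rw [setIntegral_congr_set hae, setIntegral_eq_integral_of_forall_compl_eq_zero fun x hx =>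
    hsupp x fun hxΩ => hx (h.subset_iUnion_body hxΩ)]
  exact integral_gradient_eq_zero hφ hc e

open Classical in
/-- The outward normals on the two sides of an interior face cancel. -/
theorem Mesh.Partitions.sum_normal_eq_zero (h : 𝒯.Partitions Ω) {F : Set (E d)}
    (hF : ∃ K i, F = face (𝒯.elem K) i) (hFb : ¬ IsBoundaryFace Ω F) :
    ∑ K, ∑ i, (if face (𝒯.elem K) i = F then normal (𝒯.elem K) i else 0) = 0 := by
  obtain ⟨K₀, i₀, rfl⟩ := hF
  obtain ⟨y, hyF, hyΩ, hpos⟩ := h.exists_mem_face hFb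
  set F := face (𝒯.elem K₀) i₀
  -- A relatively interior point has a neighbourhood that meets no other face. A bump function
  -- supported there isolates `F`, and the number of elements sharing `F` need not be known.
  have hev : ∀ᶠ x in nhds y, x ∈ Ω ∧ ∀ K i, face (𝒯.elem K) i ≠ F → x ∉ face (𝒯.elem K) i := by
    refine Filter.Eventually.and (h.isOpen.mem_nhds hyΩ) ?_
    simp only [Filter.eventually_all]
    intro K i hne
    exact (isCompact_face (𝒯.elem K) i).isClosed.isOpen_compl.mem_nhds fun hy =>
      hne (𝒯.face_eq_of_mem hyF hpos hy)
  obtain ⟨ε, hε, hball⟩ := Metric.eventually_nhds_iff_ball.1 hev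
  let φ : ContDiffBump y := ⟨ε / 4, ε / 2, by positivity, by linarith⟩
  have hφ : ContDiff ℝ 1 (φ : E d → ℝ) := φ.contDiff
  have hsub : tsupport φ ⊆ Metric.ball y ε := by
    rw [φ.tsupport_eq]
    exact Metric.closedBall_subset_ball (by simp only [φ]; linarith)
  set c := faceInt (𝒯.elem K₀) i₀ φ with hcdef
  have hc : c ≠ 0 := fun hc => by
    have := eq_zero_of_faceInt_eq_zero (𝒯.elem K₀) i₀ φ.continuous.continuousOn
      (fun x _ => φ.nonneg) hc y hyF
    exact (φ.pos_of_mem_ball (Metric.mem_ball_self φ.rOut_pos)).ne' this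
  have hfi : ∀ K i, faceInt (𝒯.elem K) i φ = if face (𝒯.elem K) i = F then c else 0 :=
    fun K i => by
    split_ifs with hKi
    · change ∫ x in face _ _, _ ∂_ = ∫ x in face _ _, _ ∂_
      rw [hKi]
    · rw [faceInt_eq]
      refine integral_eq_zero_of_ae ?_
      filter_upwards [faceMeasure_ae_mem (𝒯.elem K) i] with x hx
      refine image_eq_zero_of_notMem_tsupport fun hx' => ?_
      exact (hball x (hsub hx')).2 K i hKi hx
  refine ext_inner_right ℝ fun e => ?_
  have hpart : ∀ K, ∫ x in body (𝒯.elem K), inner ℝ (gradient φ x) e =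
      ∑ i, (if face (𝒯.elem K) i = F then c * inner ℝ (normal (𝒯.elem K) i) e else 0) :=
    fun K => by
    have hgc : Continuous (gradient (φ : E d → ℝ)) := by
      exact (LinearIsometryEquiv.continuous _).comp (hφ.continuous_fderiv one_ne_zero)
    have hpoly : IsPolyVec 0 (fun _ : E d => e) := fun i => isPoly_const 0 (e i)
    have hib := integral_by_parts_of_gradient (𝒯.elem K) (u := φ)
      (q := fun x => -gradient (φ : E d → ℝ) x) (r := fun _ => e)
      φ.continuous.continuousOn hgc.neg.continuousOn
      (fun x _ => by
        rw [neg_neg]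
        exact (hφ.differentiable one_ne_zero x).hasGradientAt) hpoly
    have hdiv : ∀ x, HDG.div (fun _ : E d => e) x = 0 := fun x => by simp [HDG.div]
    simp only [hdiv, mul_zero, inner_neg_left, zero_sub, neg_neg] at hib
    rw [hib]
    refine Finset.sum_congr rfl fun i _ => ?_
    have : faceInt (𝒯.elem K) i (fun x => φ x * inner ℝ e (normal (𝒯.elem K) i)) =
        faceInt (𝒯.elem K) i φ * inner ℝ (normal (𝒯.elem K) i) e := by
      rw [faceInt_eq, faceInt_eq, integral_mul_const, real_inner_comm]
    rw [this, hfi]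
    split_ifs <;> simp
  have hsum := h.sum_setIntegral_eq_zero hφ φ.hasCompactSupport
    (fun x hx => (hball x (hsub hx)).1) e
  simp only [hpart] at hsum
  rw [inner_zero_left, sum_inner]
  -- Summing the element integrals of the directional derivative of the bump gives zero. By parts it
  -- is c times the sum of the normals, where c > 0 is the integral of the bump over `F`.
  refine mul_left_cancel₀ hc ?_
  rw [mul_zero, ← hsum, Finset.mul_sum]
  refine Finset.sum_congr rfl fun K _ => ?_
  rw [sum_inner, Finset.mul_sum]
  refine Finset.sum_congr rfl fun i _ => ?_
  split_ifs <;> simp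

/-- The normal components of a vector field that is single valued on the faces cancel in the sum
over the interior faces. -/
theorem Mesh.Partitions.interiorBdryInt_eq_zero (h : 𝒯.Partitions Ω)
    {v : Set (E d) → E d → E d}
    (hv : ∀ K i, ContinuousOn (v (face (𝒯.elem K) i)) (face (𝒯.elem K) i)) :
    𝒯.interiorBdryInt Ω (fun K i x =>
      inner ℝ (v (face (𝒯.elem K) i) x) (normal (𝒯.elem K) i)) = 0 := by
  classical
  let ν : Set (E d) → Measure (E d) := fun F =>
    (Measure.euclideanHausdorffMeasure (d - 1) : Measure (E d)).restrict F
  let G : Set (E d) → E d := fun F => if IsBoundaryFace Ω F then 0 else ∫ x, v F x ∂ν F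
  have key : ∀ K i, (if IsBoundaryFace Ω (face (𝒯.elem K) i) then 0 else
      faceInt (𝒯.elem K) i (fun x => inner ℝ (v (face (𝒯.elem K) i) x) (normal (𝒯.elem K) i))) =
      inner ℝ (G (face (𝒯.elem K) i)) (normal (𝒯.elem K) i) := fun K i => by
    simp only [G]
    split_ifs
    · simp
    · rw [faceInt_eq, real_inner_comm]
      refine Eq.trans ?_ (integral_inner (integrable_faceMeasure _ _ (hv K i)) _)
      simp only [real_inner_comm]
  unfold Mesh.interiorBdryInt
  have hconv : ∀ K i, (if IsBoundaryFace Ω (face (𝒯.elem K) i) then 0 else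
      faceInt (𝒯.elem K) i (fun x => inner ℝ (v (face (𝒯.elem K) i) x) (normal (𝒯.elem K) i))) =
      inner ℝ (G (face (𝒯.elem K) i)) (normal (𝒯.elem K) i) := fun K i => by
    rw [← key K i]
  simp only [hconv]
  rw [← Fintype.sum_prod_type']
  -- The sum is regrouped by faces as sets. On each of them the vector `G` is common to all sides,
  -- so only the sum of the normals remains.
  have hfib := Finset.sum_fiberwise_of_maps_to (s := Finset.univ)
    (t := Finset.univ.image fun p : Fin N × Fin (d + 1) => face (𝒯.elem p.1) p.2)
    (g := fun p : Fin N × Fin (d + 1) => face (𝒯.elem p.1) p.2)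
    (fun p hp => Finset.mem_image_of_mem _ hp)
    (fun p : Fin N × Fin (d + 1) => inner ℝ (G (face (𝒯.elem p.1) p.2)) (normal (𝒯.elem p.1) p.2))
  rw [← hfib]
  refine Finset.sum_eq_zero fun F hF => ?_
  obtain ⟨⟨K₀, i₀⟩, _, rfl⟩ := Finset.mem_image.1 hF
  by_cases hb : IsBoundaryFace Ω (face (𝒯.elem K₀) i₀)
  · refine Finset.sum_eq_zero fun p hp => ?_
    rw [(Finset.mem_filter.1 hp).2]
    simp [G, hb]
  · have hn := h.sum_normal_eq_zero ⟨K₀, i₀, rfl⟩ hb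
    rw [← Fintype.sum_prod_type', ← Finset.sum_filter] at hn
    rw [Finset.sum_congr rfl fun p hp => by rw [(Finset.mem_filter.1 hp).2], ← inner_sum, hn,
      inner_zero_right]

end

section

variable {d k N : ℕ}

/-! ### Linearity of the broken integrals -/

namespace Mesh

variable (𝒯 : Mesh d N)

theorem volInt_add {f g : Fin N → E d → ℝ}
    (hf : ∀ K, IntegrableOn (f K) (body (𝒯.elem K)))
    (hg : ∀ K, IntegrableOn (g K) (body (𝒯.elem K))) :
    𝒯.volInt (fun K x => f K x + g K x) = 𝒯.volInt f + 𝒯.volInt g := by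
  simp only [volInt, ← Finset.sum_add_distrib]
  exact Finset.sum_congr rfl fun K _ => integral_add (hf K) (hg K)

theorem volInt_sub {f g : Fin N → E d → ℝ}
    (hf : ∀ K, IntegrableOn (f K) (body (𝒯.elem K)))
    (hg : ∀ K, IntegrableOn (g K) (body (𝒯.elem K))) :
    𝒯.volInt (fun K x => f K x - g K x) = 𝒯.volInt f - 𝒯.volInt g := by
  simp only [volInt, ← Finset.sum_sub_distrib]
  exact Finset.sum_congr rfl fun K _ => integral_sub (hf K) (hg K)

theorem volInt_const_mul (c : ℝ) (f : Fin N → E d → ℝ) :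
    𝒯.volInt (fun K x => c * f K x) = c * 𝒯.volInt f := by
  simp only [volInt, integral_const_mul, Finset.mul_sum]

theorem volInt_congr {f g : Fin N → E d → ℝ} (h : ∀ K, ∀ x ∈ body (𝒯.elem K), f K x = g K x) :
    𝒯.volInt f = 𝒯.volInt g :=
  Finset.sum_congr rfl fun K _ => setIntegral_congr_fun (measurableSet_body _) (h K)

theorem volInt_mono {f g : Fin N → E d → ℝ}
    (hf : ∀ K, IntegrableOn (f K) (body (𝒯.elem K)))
    (hg : ∀ K, IntegrableOn (g K) (body (𝒯.elem K)))
    (h : ∀ K, ∀ x ∈ body (𝒯.elem K), f K x ≤ g K x) : 𝒯.volInt f ≤ 𝒯.volInt g :=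
  Finset.sum_le_sum fun K _ => setIntegral_mono_on (hf K) (hg K) (measurableSet_body _) (h K)

theorem volInt_nonneg {f : Fin N → E d → ℝ} (h : ∀ K, ∀ x ∈ body (𝒯.elem K), 0 ≤ f K x) :
    0 ≤ 𝒯.volInt f :=
  Finset.sum_nonneg fun K _ => setIntegral_nonneg (measurableSet_body _) (h K)

theorem normSq_nonneg {V : Type} [NormedAddCommGroup V] (g : Fin N → E d → V) :
    0 ≤ 𝒯.normSq g :=
  𝒯.volInt_nonneg fun _ _ _ => sq_nonneg _

variable [NeZero d]

theorem bdryInt_congr {f g : Fin N → Fin (d + 1) → E d → ℝ}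
    (h : ∀ K i, ∀ x ∈ face (𝒯.elem K) i, f K i x = g K i x) : 𝒯.bdryInt f = 𝒯.bdryInt g := by
  refine Finset.sum_congr rfl fun K _ => Finset.sum_congr rfl fun i _ => ?_
  rw [faceInt_eq, faceInt_eq]
  refine integral_congr_ae ?_
  filter_upwards [faceMeasure_ae_mem (𝒯.elem K) i] with x hx using h K i x hx

theorem bdryInt_add {f g : Fin N → Fin (d + 1) → E d → ℝ}
    (hf : ∀ K i, ContinuousOn (f K i) (face (𝒯.elem K) i))
    (hg : ∀ K i, ContinuousOn (g K i) (face (𝒯.elem K) i)) :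
    𝒯.bdryInt (fun K i x => f K i x + g K i x) = 𝒯.bdryInt f + 𝒯.bdryInt g := by
  simp only [bdryInt, ← Finset.sum_add_distrib]
  refine Finset.sum_congr rfl fun K _ => Finset.sum_congr rfl fun i _ => ?_
  exact integral_add (integrable_faceMeasure _ i (hf K i)) (integrable_faceMeasure _ i (hg K i))

theorem bdryInt_sub {f g : Fin N → Fin (d + 1) → E d → ℝ}
    (hf : ∀ K i, ContinuousOn (f K i) (face (𝒯.elem K) i))
    (hg : ∀ K i, ContinuousOn (g K i) (face (𝒯.elem K) i)) :
    𝒯.bdryInt (fun K i x => f K i x - g K i x) = 𝒯.bdryInt f - 𝒯.bdryInt g := by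
  simp only [bdryInt, ← Finset.sum_sub_distrib]
  refine Finset.sum_congr rfl fun K _ => Finset.sum_congr rfl fun i _ => ?_
  exact integral_sub (integrable_faceMeasure _ i (hf K i)) (integrable_faceMeasure _ i (hg K i))

theorem bdryInt_const_mul (c : ℝ) (f : Fin N → Fin (d + 1) → E d → ℝ) :
    𝒯.bdryInt (fun K i x => c * f K i x) = c * 𝒯.bdryInt f := by
  simp only [bdryInt, faceInt_eq, integral_const_mul, Finset.mul_sum]

theorem bdryInt_nonneg {f : Fin N → Fin (d + 1) → E d → ℝ}
    (h : ∀ K i, ∀ x ∈ face (𝒯.elem K) i, 0 ≤ f K i x) : 0 ≤ 𝒯.bdryInt f := by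
  refine Finset.sum_nonneg fun K _ => Finset.sum_nonneg fun i _ => ?_
  rw [faceInt_eq]
  refine integral_nonneg_of_ae ?_
  filter_upwards [faceMeasure_ae_mem (𝒯.elem K) i] with x hx using h K i x hx

theorem interiorBdryInt_eq_bdryInt {Ω : Set (E d)} {g : Fin N → Fin (d + 1) → E d → ℝ}
    (h : ∀ K i, IsBoundaryFace Ω (face (𝒯.elem K) i) → ∀ x ∈ face (𝒯.elem K) i, g K i x = 0) :
    𝒯.interiorBdryInt Ω g = 𝒯.bdryInt g := by
  unfold interiorBdryInt bdryInt
  refine Finset.sum_congr rfl fun K _ => Finset.sum_congr rfl fun i _ => ?_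
  split_ifs with hb
  · rw [faceInt_eq]
    refine (integral_eq_zero_of_ae ?_).symm
    filter_upwards [faceMeasure_ae_mem (𝒯.elem K) i] with x hx using h K i hb x hx
  · rfl

end Mesh

/-! ### The discrete spaces -/

theorem IsPolyVec.sub {v w : E d → E d} (hv : IsPolyVec k v) (hw : IsPolyVec k w) :
    IsPolyVec k (fun x => v x - w x) := fun i => (hv i).sub (hw i)

theorem IsPolyVec.add {v w : E d → E d} (hv : IsPolyVec k v) (hw : IsPolyVec k w) :
    IsPolyVec k (fun x => v x + w x) := fun i => (hv i).add (hw i)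

theorem IsPolyVec.const_smul {v : E d → E d} (c : ℝ) (hv : IsPolyVec k v) :
    IsPolyVec k (fun x => c • v x) := fun i => (hv i).smul c

variable {𝒯 : Mesh d N} {Ω : Set (E d)}

theorem MemM.continuousOn {μ : Set (E d) → E d → ℝ} (h : MemM k 𝒯 Ω μ) (K : Fin N)
    (i : Fin (d + 1)) : ContinuousOn (μ (face (𝒯.elem K) i)) (face (𝒯.elem K) i) := by
  obtain ⟨⟨p, hp, he⟩, -⟩ := h K i
  exact hp.continuous.continuousOn.congr he

theorem MemM.add {μ ν : Set (E d) → E d → ℝ} (h : MemM k 𝒯 Ω μ) (h' : MemM k 𝒯 Ω ν) :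
    MemM k 𝒯 Ω (fun F x => μ F x + ν F x) := fun K i => by
  obtain ⟨⟨p, hp, he⟩, hb⟩ := h K i
  obtain ⟨⟨p', hp', he'⟩, hb'⟩ := h' K i
  refine ⟨⟨p + p', hp.add hp', fun x hx => ?_⟩, fun hF x hx => ?_⟩
  · simp [he hx, he' hx]
  · simp [hb hF x hx, hb' hF x hx]

theorem MemM.const_mul {μ : Set (E d) → E d → ℝ} (c : ℝ) (h : MemM k 𝒯 Ω μ) :
    MemM k 𝒯 Ω (fun F x => c * μ F x) := fun K i => by
  obtain ⟨⟨p, hp, he⟩, hb⟩ := h K i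
  refine ⟨⟨c • p, hp.smul c, fun x hx => ?_⟩, fun hF x hx => ?_⟩
  · simp [he hx]
  · simp [hb hF x hx]

variable [NeZero d]

/-! ### The facewise `L²` projection -/

theorem exists_faceProj (S : Simplex d) (i : Fin (d + 1)) {u : E d → ℝ}
    (hu : ContinuousOn u (face S i)) : ∃ p, IsPoly k p ∧ ∀ ν, IsPoly k ν →
      faceInt S i (fun x => p x * ν x) = faceInt S i (fun x => u x * ν x) := by
  let U := LinearMap.range (faceL2 (k := k) S i)
  let v := (memLp_face S i hu).toLp u
  obtain ⟨p, hp⟩ := (U.orthogonalProjectionOnto v).2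
  refine ⟨p.1, p.2, fun ν hν => ?_⟩
  rw [← inner_faceL2 S i p ⟨ν, hν⟩, hp]
  refine Eq.trans ?_ (inner_toLp (memLp_face S i hu)
    (memLp_face S i hν.continuous.continuousOn))
  have h := U.starProjection_inner_eq_zero v (faceL2 S i ⟨ν, hν⟩) ⟨_, rfl⟩
  rw [inner_sub_left, sub_eq_zero] at h
  exact h.symm

open Classical in
/-- The facewise `L²` projection of `u` onto polynomials of degree at most `k`, set to zero on
boundary faces. -/
def traceProj (k : ℕ) (Ω : Set (E d)) (u : E d → ℝ) (F : Set (E d)) : E d → ℝ :=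
  if IsBoundaryFace Ω F then 0 else Classical.epsilon fun p => IsPoly k p ∧ ∀ ν, IsPoly k ν →
    ∫ x in F, p x * ν x ∂(Measure.euclideanHausdorffMeasure (d - 1) : Measure (E d)) =
      ∫ x in F, u x * ν x ∂(Measure.euclideanHausdorffMeasure (d - 1) : Measure (E d))

/-- Setting the projection to zero on boundary faces loses no moments, because u itself vanishes
there. -/
theorem traceProj_spec (S : Simplex d) (i : Fin (d + 1)) {u : E d → ℝ}
    (hu : ContinuousOn u (face S i)) (hb : ∀ x ∈ frontier Ω, u x = 0) :
    IsPoly k (traceProj k Ω u (face S i)) ∧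
      (IsBoundaryFace Ω (face S i) → traceProj k Ω u (face S i) = 0) ∧
      ∀ ν, IsPoly k ν → faceInt S i (fun x => traceProj k Ω u (face S i) x * ν x) =
        faceInt S i (fun x => u x * ν x) := by
  unfold traceProj
  split_ifs with hF
  · refine ⟨isPoly_zero k, fun _ => rfl, fun ν _ => ?_⟩
    rw [faceInt_eq, faceInt_eq]
    refine integral_congr_ae ?_
    filter_upwards [faceMeasure_ae_mem S i] with x hx
    simp [hb x (hF hx)]
  · have h := Classical.epsilon_spec (exists_faceProj (k := k) S i hu)
    exact ⟨h.1, fun h => absurd h hF, h.2⟩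

theorem memM_traceProj {u : E d → ℝ} (hu : ContinuousOn u (closure Ω)) (h𝒯 : 𝒯.Partitions Ω)
    (hb : ∀ x ∈ frontier Ω, u x = 0) : MemM k 𝒯 Ω (traceProj k Ω u) := fun K i => by
  have h := traceProj_spec (k := k) (𝒯.elem K) i
    (hu.mono ((face_subset_body _ i).trans (h𝒯.body_subset_closure K))) hb
  exact ⟨⟨_, h.1, fun _ _ => rfl⟩, fun hF x _ => by rw [h.2.1 hF]; rfl⟩

end

section

/-! ### Symmetric linear systems with differentiable data -/

/-- `O` factors through the quotient by the kernel of `D`, which is the range of `D`, and a linear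
map on a subspace extends. -/
theorem exists_comp_eq_of_ker_le {X Y Z : Type*} [AddCommGroup X] [Module ℝ X] [AddCommGroup Y]
    [Module ℝ Y] [AddCommGroup Z] [Module ℝ Z] (D : X →ₗ[ℝ] Y) (O : X →ₗ[ℝ] Z)
    (h : ∀ σ, D σ = 0 → O σ = 0) : ∃ Λ : Y →ₗ[ℝ] Z, ∀ σ, O σ = Λ (D σ) := by
  obtain ⟨g, hg⟩ := ((LinearMap.ker D).liftQ O (fun σ hσ => h σ hσ) ∘ₗ
    D.quotKerEquivRange.symm.toLinearMap).exists_extend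
  refine ⟨g, fun σ => ?_⟩
  have h1 := LinearMap.congr_fun hg ⟨D σ, σ, rfl⟩
  have h2 : D.quotKerEquivRange.symm ⟨D σ, σ, rfl⟩ = (LinearMap.ker D).mkQ σ := by
    rw [LinearEquiv.symm_apply_eq]; rfl
  simp only [LinearMap.comp_apply, LinearEquiv.coe_coe, h2, Submodule.subtype_apply] at h1
  exact h1.symm

/-- If the output of a symmetric linear system is determined by its data, and the data are
differentiable in time, then the output is continuous, and the derivative of the energy (the
pairing of data and output) is twice the pairing of the output with the derivative of the data. -/
theorem exists_output_of_symmetric {X ι : Type*} [AddCommGroup X] [Module ℝ X] [Fintype ι]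
    (D O : X →ₗ[ℝ] ι → ℝ) (hsymm : ∀ σ σ', ∑ i, D σ i * O σ' i = ∑ i, D σ' i * O σ i)
    (hker : ∀ σ, D σ = 0 → O σ = 0) {T : ℝ} {σ : ℝ → X} {c c' : ι → ℝ → ℝ}
    (h : ∀ t ∈ Ioc 0 T, ∀ i, D (σ t) i = c i t) (hc : ∀ i, ContinuousOn (c i) (Icc 0 T))
    (hd : ∀ t ∈ Ioc 0 T, ∀ i, HasDerivWithinAt (c i) (c' i t) (Icc 0 T) t) :
    ∃ o : ι → ℝ → ℝ, (∀ i, ContinuousOn (o i) (Icc 0 T)) ∧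
      (∀ t ∈ Ioc 0 T, ∀ i, O (σ t) i = o i t) ∧
      ∀ t ∈ Ioc 0 T, HasDerivWithinAt (fun t => ∑ i, c i t * o i t)
        (2 * ∑ i, c' i t * o i t) (Icc 0 T) t := by
  classical
  obtain ⟨Λ, hΛ⟩ := exists_comp_eq_of_ker_le D O hker
  have hDc : ∀ t ∈ Ioc 0 T, D (σ t) = fun i => c i t := fun t ht => funext (h t ht)
  have hexp : ∀ (v : ι → ℝ) i, Λ v i = ∑ j, Λ (Pi.single j 1) i * v j := fun v i => by
    conv_lhs => rw [pi_eq_sum_univ' v]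
    rw [map_sum, Finset.sum_apply]
    refine Finset.sum_congr rfl fun j _ => ?_
    rw [map_smul, Pi.smul_apply, smul_eq_mul, mul_comm]
  set a : ι → ι → ℝ := fun i j => Λ (Pi.single j 1) i
  have hod : ∀ t ∈ Ioc 0 T, ∀ i, HasDerivWithinAt (fun t => ∑ j, a i j * c j t)
      (∑ j, a i j * c' j t) (Icc 0 T) t := fun t ht i =>
    HasDerivWithinAt.fun_sum fun j _ => (hd t ht j).const_mul _
  have ho : ∀ t ∈ Ioc 0 T, ∀ i, O (σ t) i = ∑ j, a i j * c j t := fun t ht i => by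
    rw [hΛ, hexp, hDc t ht]
  refine ⟨fun i t => ∑ j, a i j * c j t, fun i => ?_, fun t ht i => ?_, fun t ht => ?_⟩
  · exact continuousOn_finsetSum _ fun j _ => continuousOn_const.mul (hc j)
  · exact ho t ht i
  · have hA := HasDerivWithinAt.fun_sum (u := Finset.univ) fun i _ => (hd t ht i).mul (hod t ht i)
    -- The matrix `a` need not be symmetric, since the extension off the range of `D` is arbitrary.
    -- Symmetry holds for the data at two times t and s, and differentiating that identity in s at s
    -- = t gives what is needed.
    have hsy : ∑ i, c i t * ∑ j, a i j * c' j t = ∑ i, c' i t * ∑ j, a i j * c j t := by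
      have h1 := HasDerivWithinAt.fun_sum (u := Finset.univ)
        fun i _ => (hod t ht i).const_mul (c i t)
      have h2 := HasDerivWithinAt.fun_sum (u := Finset.univ)
        fun i _ => (hd t ht i).mul_const (∑ j, a i j * c j t)
      have htI : t ∈ Icc 0 T := ⟨ht.1.le, ht.2⟩
      refine ((uniqueDiffOn_Icc (ht.1.trans_le ht.2)) t htI).eq_deriv _ h1 (h2.congr_of_eventuallyEq
        ?_ rfl)
      have : Ioc 0 T ∈ nhdsWithin t (Icc 0 T) := by
        exact Filter.mem_of_superset (inter_mem_nhdsWithin _ (Ioi_mem_nhds ht.1))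
          fun s hs => ⟨hs.2, hs.1.2⟩
      filter_upwards [this] with s hs
      have h3 := hsymm (σ t) (σ s)
      simp only [h t ht, h s hs, ho t ht, ho s hs] at h3
      exact h3
    refine hA.congr_deriv ?_
    rw [Finset.sum_add_distrib, hsy]
    ring

/-! ### States of the HDG error system -/

variable {d k N : ℕ} [NeZero d]

/-- The linear relations satisfied by the error `(p, w, μ)` of the HDG method: the flux equation
with residual `δ` and the continuity of the normal flux. -/
structure IsErrorState (k : ℕ) (𝒯 : Mesh d N) (Ω : Set (E d)) (τ : Fin N → Fin (d + 1) → ℝ)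
    (p : Fin N → E d → E d) (w : Fin N → E d → ℝ) (μ : Set (E d) → E d → ℝ)
    (δ : Fin N → E d → E d) : Prop where
  mem_V : MemV k p
  mem_W : MemW k w
  mem_M : MemM k 𝒯 Ω μ
  cont : ∀ K, ContinuousOn (δ K) (body (𝒯.elem K))
  flux : ∀ r, MemV k r →
    𝒯.volInt (fun K x => inner ℝ (p K x) (r K x) - w K x * div (r K) x - inner ℝ (δ K x) (r K x))
      + 𝒯.bdryInt (fun K i x =>
          μ (face (𝒯.elem K) i) x * inner ℝ (r K x) (normal (𝒯.elem K) i)) = 0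
  trace : ∀ ν, MemM k 𝒯 Ω ν →
    𝒯.bdryInt (fun K i x => numFlux 𝒯 τ p w μ K i x * ν (face (𝒯.elem K) i) x) = 0

/-- The weak divergence of the numerical flux on `K`, tested with `v`. -/
def fluxRes (𝒯 : Mesh d N) (τ : Fin N → Fin (d + 1) → ℝ) (p : Fin N → E d → E d)
    (w : Fin N → E d → ℝ) (μ : Set (E d) → E d → ℝ) (K : Fin N) (v : E d → ℝ) : ℝ :=
  ∑ i, faceInt (𝒯.elem K) i (fun x => numFlux 𝒯 τ p w μ K i x * v x) -
    ∫ x in body (𝒯.elem K), inner ℝ (p K x) (gradient v x)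

variable {𝒯 : Mesh d N} {Ω : Set (E d)} {τ : Fin N → Fin (d + 1) → ℝ}

theorem numFlux_continuousOn {p : Fin N → E d → E d} {w : Fin N → E d → ℝ}
    {μ : Set (E d) → E d → ℝ} (hp : MemV k p) (hw : MemW k w) (hμ : MemM k 𝒯 Ω μ)
    (K : Fin N) (i : Fin (d + 1)) :
    ContinuousOn (numFlux 𝒯 τ p w μ K i) (face (𝒯.elem K) i) :=
  ((hp K).continuous.continuousOn.inner (𝕜 := ℝ) continuousOn_const).add
    (continuousOn_const.mul ((hw K).continuous.continuousOn.sub (hμ.continuousOn K i)))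

theorem IsPoly.continuous_gradient {v : E d → ℝ} (hv : IsPoly k v) : Continuous (_root_.gradient v) :=
  hv.gradient.isPolyVec.continuous

theorem fluxRes_sum {p : Fin N → E d → E d} {w : Fin N → E d → ℝ} {μ : Set (E d) → E d → ℝ}
    (hp : MemV k p) (hw : MemW k w) (hμ : MemM k 𝒯 Ω μ) (K : Fin N) {ι : Type*} [Fintype ι]
    (c : ι → ℝ) {g : ι → E d → ℝ} (hg : ∀ j, IsPoly k (g j)) :
    fluxRes 𝒯 τ p w μ K (fun x => ∑ j, c j * g j x) = ∑ j, c j * fluxRes 𝒯 τ p w μ K (g j) := by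
  have hgrad : ∀ x, gradient (fun x => ∑ j, c j * g j x) x = ∑ j, c j • gradient (g j) x :=
    fun x => by
    simp only [gradient, ← map_smul, ← map_sum]
    congr 1
    rw [fderiv_fun_sum fun j _ => ((hg j).differentiable x).const_mul _]
    exact Finset.sum_congr rfl fun j _ => fderiv_const_mul ((hg j).differentiable x) _
  unfold fluxRes
  simp only [hgrad, inner_sum, Finset.mul_sum, inner_smul_right, faceInt_eq]
  rw [integral_finsetSum _ fun j _ => (integrableOn_body _ (((hp K).continuous.inner
    (hg j).continuous_gradient).const_mul (c j)).continuousOn)]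
  have : ∀ i, ∫ x, ∑ j, numFlux 𝒯 τ p w μ K i x * (c j * g j x) ∂faceMeasure (𝒯.elem K) i =
      ∑ j, c j * ∫ x, numFlux 𝒯 τ p w μ K i x * g j x ∂faceMeasure (𝒯.elem K) i := fun i => by
    rw [integral_finsetSum (f := fun j x => numFlux 𝒯 τ p w μ K i x * (c j * g j x)) _
      fun j _ => integrable_faceMeasure _ _ ((numFlux_continuousOn hp hw hμ K i).mul
        (continuousOn_const.mul (hg j).continuous.continuousOn))]
    refine Finset.sum_congr rfl fun j _ => ?_
    rw [← integral_const_mul]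
    exact integral_congr_ae (ae_of_all _ fun x => by ring)
  simp only [this, integral_const_mul, mul_sub, Finset.sum_sub_distrib, Finset.mul_sum]
  rw [Finset.sum_comm]

theorem integral_inner_gradient {S : Simplex d} {v : E d → ℝ} {r : E d → E d} (hv : IsPoly k v)
    (hr : IsPolyVec k r) : ∫ x in body S, inner ℝ (r x) (gradient v x) =
      ∑ i, faceInt S i (fun x => inner ℝ (r x) (normal S i) * v x) -
        ∫ x in body S, v x * div r x := by
  have h := integral_by_parts_of_gradient S (u := v) (q := fun x => -gradient v x)
    hv.continuous.continuousOn hv.continuous_gradient.neg.continuousOn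
    (fun x _ => by rw [neg_neg]; exact hv.hasGradientAt x) hr
  simp only [inner_neg_left, sub_neg_eq_add] at h
  rw [integral_add (f := fun x => v x * div r x) (g := fun x => inner ℝ (gradient v x) (r x))
    (integrableOn_body _ (hv.continuous.mul hr.div.isPoly.continuous).continuousOn)
    (integrableOn_body _ (hv.continuous_gradient.inner hr.continuous).continuousOn)] at h
  simp only [fun x => real_inner_comm (gradient v x) (r x),
    fun i x => mul_comm (inner ℝ (r x) (normal S i)) (v x)] at h ⊢
  linarith

/-! ### Energy identity and linear structure of error states -/

section Energy

variable {p p' δ δ' : Fin N → E d → E d} {w w' : Fin N → E d → ℝ} {μ μ' : Set (E d) → E d → ℝ}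

/-- The energy identity of the HDG error system. -/
theorem IsErrorState.energy (h : IsErrorState k 𝒯 Ω τ p w μ δ)
    (h' : IsErrorState k 𝒯 Ω τ p' w' μ' δ') :
    𝒯.volInt (fun K x => inner ℝ (δ K x) (p' K x)) + ∑ K, fluxRes 𝒯 τ p' w' μ' K (w K) =
      𝒯.volInt (fun K x => inner ℝ (p K x) (p' K x)) + 𝒯.bdryInt (fun K i x => τ K i *
        (w K x - μ (face (𝒯.elem K) i) x) * (w' K x - μ' (face (𝒯.elem K) i) x)) := by
  have hpc := fun K => (h.mem_V K).continuous
  have hpc' := fun K => (h'.mem_V K).continuous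
  have hwc := fun K => (h.mem_W K).continuous
  have hwc' := fun K => (h'.mem_W K).continuous
  have hμ := h.mem_M.continuousOn
  have hμ' := h'.mem_M.continuousOn
  have hnf := numFlux_continuousOn (τ := τ) h'.mem_V h'.mem_W h'.mem_M
  -- The flux equation of the first state is tested with p', the trace equation of the second with
  -- μ. The resulting right side is symmetric in the two states.
  have h1 := h.flux p' h'.mem_V
  have i1 : ∀ K, IntegrableOn (fun x => inner ℝ (p K x) (p' K x)) (body (𝒯.elem K)) := fun K =>
    integrableOn_body _ ((hpc K).inner (hpc' K)).continuousOn
  have i2 : ∀ K, IntegrableOn (fun x => w K x * div (p' K) x) (body (𝒯.elem K)) := fun K =>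
    integrableOn_body _ ((hwc K).mul (h'.mem_V K).div.isPoly.continuous).continuousOn
  have i3 : ∀ K, IntegrableOn (fun x => inner ℝ (δ K x) (p' K x)) (body (𝒯.elem K)) := fun K =>
    integrableOn_body _ ((h.cont K).inner (𝕜 := ℝ) (hpc' K).continuousOn)
  rw [𝒯.volInt_sub (f := fun K x => inner ℝ (p K x) (p' K x) - w K x * div (p' K) x)
    (fun K => (i1 K).sub (i2 K)) i3, 𝒯.volInt_sub i1 i2] at h1
  have h2 := h'.trace μ h.mem_M
  have h3 : ∑ K, fluxRes 𝒯 τ p' w' μ' K (w K) = 𝒯.bdryInt (fun K i x =>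
      numFlux 𝒯 τ p' w' μ' K i x * w K x) - (𝒯.bdryInt (fun K i x =>
        inner ℝ (p' K x) (normal (𝒯.elem K) i) * w K x) -
          𝒯.volInt fun K x => w K x * div (p' K) x) := by
    simp only [fluxRes, Mesh.bdryInt, Mesh.volInt, ← Finset.sum_sub_distrib]
    refine Finset.sum_congr rfl fun K _ => ?_
    rw [integral_inner_gradient (h.mem_W K) (h'.mem_V K)]
  have h4 : 𝒯.bdryInt (fun K i x => τ K i * (w K x - μ (face (𝒯.elem K) i) x) *
      (w' K x - μ' (face (𝒯.elem K) i) x)) =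
      𝒯.bdryInt (fun K i x => numFlux 𝒯 τ p' w' μ' K i x * w K x) -
      𝒯.bdryInt (fun K i x => numFlux 𝒯 τ p' w' μ' K i x * μ (face (𝒯.elem K) i) x) -
      𝒯.bdryInt (fun K i x => inner ℝ (p' K x) (normal (𝒯.elem K) i) * w K x) +
      𝒯.bdryInt (fun K i x => μ (face (𝒯.elem K) i) x *
        inner ℝ (p' K x) (normal (𝒯.elem K) i)) := by
    have c1 : ∀ K i, ContinuousOn (fun x => numFlux 𝒯 τ p' w' μ' K i x * w K x)
      (face (𝒯.elem K) i) := fun K i => (hnf K i).mul (hwc K).continuousOn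
    have c2 : ∀ K i, ContinuousOn (fun x => numFlux 𝒯 τ p' w' μ' K i x *
      μ (face (𝒯.elem K) i) x) (face (𝒯.elem K) i) := fun K i => (hnf K i).mul (hμ K i)
    have c3 : ∀ K i, ContinuousOn (fun x => inner ℝ (p' K x) (normal (𝒯.elem K) i) * w K x)
      (face (𝒯.elem K) i) := fun K i =>
        (((hpc' K).inner continuous_const).mul (hwc K)).continuousOn
    have c4 : ∀ K i, ContinuousOn (fun x => μ (face (𝒯.elem K) i) x *
      inner ℝ (p' K x) (normal (𝒯.elem K) i)) (face (𝒯.elem K) i) := fun K i =>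
        (hμ K i).mul ((hpc' K).inner continuous_const).continuousOn
    have c12 : ∀ K i, ContinuousOn (fun x => numFlux 𝒯 τ p' w' μ' K i x * w K x -
      numFlux 𝒯 τ p' w' μ' K i x * μ (face (𝒯.elem K) i) x) (face (𝒯.elem K) i) :=
      fun K i => (c1 K i).sub (c2 K i)
    have c123 : ∀ K i, ContinuousOn (fun x => numFlux 𝒯 τ p' w' μ' K i x * w K x -
      numFlux 𝒯 τ p' w' μ' K i x * μ (face (𝒯.elem K) i) x -
      inner ℝ (p' K x) (normal (𝒯.elem K) i) * w K x) (face (𝒯.elem K) i) :=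
      fun K i => (c12 K i).sub (c3 K i)
    rw [← 𝒯.bdryInt_sub c1 c2, ← 𝒯.bdryInt_sub c12 c3, ← 𝒯.bdryInt_add c123 c4]
    refine 𝒯.bdryInt_congr fun K i x _ => ?_
    simp only [numFlux]
    ring
  rw [h4, h2, h3]
  linarith

theorem IsErrorState.add (h : IsErrorState k 𝒯 Ω τ p w μ δ)
    (h' : IsErrorState k 𝒯 Ω τ p' w' μ' δ') :
    IsErrorState k 𝒯 Ω τ (p + p') (w + w') (μ + μ') (δ + δ') where
  mem_V K := (h.mem_V K).add (h'.mem_V K)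
  mem_W K := (h.mem_W K).add (h'.mem_W K)
  mem_M := h.mem_M.add h'.mem_M
  cont K := (h.cont K).add (h'.cont K)
  flux r hr := by
    have e1 := h.flux r hr
    have e2 := h'.flux r hr
    have hrc := fun K => (hr K).continuous
    have hi : ∀ {p δ : Fin N → E d → E d} {w : Fin N → E d → ℝ} {μ : Set (E d) → E d → ℝ},
        IsErrorState k 𝒯 Ω τ p w μ δ → ∀ K, IntegrableOn (fun x => inner ℝ (p K x) (r K x) -
          w K x * div (r K) x - inner ℝ (δ K x) (r K x)) (body (𝒯.elem K)) := fun h K =>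
      integrableOn_body _ ((((h.mem_V K).continuous.inner (hrc K)).sub
        ((h.mem_W K).continuous.mul (hr K).div.isPoly.continuous)).continuousOn.sub
          ((h.cont K).inner (𝕜 := ℝ) (hrc K).continuousOn))
    have hc : ∀ {p δ : Fin N → E d → E d} {w : Fin N → E d → ℝ} {μ : Set (E d) → E d → ℝ},
        IsErrorState k 𝒯 Ω τ p w μ δ → ∀ K i, ContinuousOn (fun x =>
          μ (face (𝒯.elem K) i) x * inner ℝ (r K x) (normal (𝒯.elem K) i))
            (face (𝒯.elem K) i) := fun h K i =>
      (h.mem_M.continuousOn K i).mul ((hrc K).inner continuous_const).continuousOn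
    have v := 𝒯.volInt_add (hi h) (hi h')
    have b := 𝒯.bdryInt_add (hc h) (hc h')
    have v' : 𝒯.volInt (fun K x => inner ℝ ((p + p') K x) (r K x) - (w + w') K x * div (r K) x -
        inner ℝ ((δ + δ') K x) (r K x)) = _ :=
      (𝒯.volInt_congr fun K x _ => by simp only [Pi.add_apply, inner_add_left]; ring).trans v
    have b' : 𝒯.bdryInt (fun K i x => (μ + μ') (face (𝒯.elem K) i) x *
        inner ℝ (r K x) (normal (𝒯.elem K) i)) = _ :=
      (𝒯.bdryInt_congr fun K i x _ => by simp only [Pi.add_apply]; ring).trans b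
    rw [v', b']
    linarith
  trace ν hν := by
    have hc : ∀ {p δ : Fin N → E d → E d} {w : Fin N → E d → ℝ} {μ : Set (E d) → E d → ℝ},
        IsErrorState k 𝒯 Ω τ p w μ δ → ∀ K i, ContinuousOn (fun x => numFlux 𝒯 τ p w μ K i x *
          ν (face (𝒯.elem K) i) x) (face (𝒯.elem K) i) := fun h K i =>
      (numFlux_continuousOn h.mem_V h.mem_W h.mem_M K i).mul (hν.continuousOn K i)
    have b := 𝒯.bdryInt_add (hc h) (hc h')
    rw [h.trace ν hν, h'.trace ν hν, add_zero] at b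
    rw [← b]
    refine 𝒯.bdryInt_congr fun K i x _ => ?_
    simp only [numFlux, Pi.add_apply, inner_add_left]
    ring

theorem IsErrorState.smul (h : IsErrorState k 𝒯 Ω τ p w μ δ) (a : ℝ) :
    IsErrorState k 𝒯 Ω τ (a • p) (a • w) (a • μ) (a • δ) where
  mem_V K := (h.mem_V K).const_smul a
  mem_W K := (h.mem_W K).smul a
  mem_M := h.mem_M.const_mul a
  cont K := (h.cont K).const_smul a
  flux r hr := by
    have e := congrArg (a * ·) (h.flux r hr)
    simp only [mul_add, mul_zero, ← Mesh.volInt_const_mul, ← Mesh.bdryInt_const_mul] at e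
    rw [← e]
    congr 1
    · exact 𝒯.volInt_congr fun K x _ => by
        simp only [Pi.smul_apply, real_inner_smul_left, smul_eq_mul]; ring
    · exact 𝒯.bdryInt_congr fun K i x _ => by simp only [Pi.smul_apply, smul_eq_mul]; ring
  trace ν hν := by
    have e := congrArg (a * ·) (h.trace ν hν)
    simp only [mul_zero, ← Mesh.bdryInt_const_mul] at e
    rw [← e]
    exact 𝒯.bdryInt_congr fun K i x _ => by
      simp only [numFlux, Pi.smul_apply, real_inner_smul_left, smul_eq_mul]; ring

theorem fluxRes_add (h : IsErrorState k 𝒯 Ω τ p w μ δ) (h' : IsErrorState k 𝒯 Ω τ p' w' μ' δ')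
    (K : Fin N) {v : E d → ℝ} (hv : IsPoly k v) :
    fluxRes 𝒯 τ (p + p') (w + w') (μ + μ') K v =
      fluxRes 𝒯 τ p w μ K v + fluxRes 𝒯 τ p' w' μ' K v := by
  have hc : ∀ {p δ : Fin N → E d → E d} {w : Fin N → E d → ℝ} {μ : Set (E d) → E d → ℝ},
      IsErrorState k 𝒯 Ω τ p w μ δ → ∀ i, Integrable (fun x => numFlux 𝒯 τ p w μ K i x * v x)
        (faceMeasure (𝒯.elem K) i) := fun h i => integrable_faceMeasure _ _
    ((numFlux_continuousOn h.mem_V h.mem_W h.mem_M K i).mul hv.continuous.continuousOn)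
  have hi : ∀ {p : Fin N → E d → E d}, MemV k p → IntegrableOn
      (fun x => inner ℝ (p K x) (gradient v x)) (body (𝒯.elem K)) := fun hp =>
    integrableOn_body _ ((hp K).continuous.inner hv.continuous_gradient).continuousOn
  have h1 : ∀ i x, numFlux 𝒯 τ (p + p') (w + w') (μ + μ') K i x * v x =
      numFlux 𝒯 τ p w μ K i x * v x + numFlux 𝒯 τ p' w' μ' K i x * v x := fun i x => by
    simp only [numFlux, Pi.add_apply, inner_add_left]; ring
  unfold fluxRes
  simp only [h1, faceInt_eq, Pi.add_apply, inner_add_left]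
  rw [integral_add (hi h.mem_V) (hi h'.mem_V)]
  simp only [integral_add (hc h _) (hc h' _), Finset.sum_add_distrib]
  ring

theorem fluxRes_smul (a : ℝ) (K : Fin N) (v : E d → ℝ) :
    fluxRes 𝒯 τ (a • p) (a • w) (a • μ) K v = a * fluxRes 𝒯 τ p w μ K v := by
  have h1 : ∀ i x, numFlux 𝒯 τ (a • p) (a • w) (a • μ) K i x * v x =
      a * (numFlux 𝒯 τ p w μ K i x * v x) := fun i x => by
    simp only [numFlux, Pi.smul_apply, real_inner_smul_left, smul_eq_mul]; ring
  unfold fluxRes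
  simp only [h1, faceInt_eq, Pi.smul_apply, real_inner_smul_left, integral_const_mul, mul_sub,
    Finset.mul_sum]

end Energy

/-- The space of states of the HDG error system. -/
def errorStates (k : ℕ) (𝒯 : Mesh d N) (Ω : Set (E d)) (τ : Fin N → Fin (d + 1) → ℝ) :
    Submodule ℝ ((Fin N → E d → E d) × (Fin N → E d → ℝ) × (Set (E d) → E d → ℝ) ×
      (Fin N → E d → E d)) where
  carrier := {σ | IsErrorState k 𝒯 Ω τ σ.1 σ.2.1 σ.2.2.1 σ.2.2.2}
  add_mem' h h' := IsErrorState.add h h'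
  zero_mem' := by
    change IsErrorState k 𝒯 Ω τ 0 0 0 0
    refine ⟨fun K i => isPoly_zero k, fun K => isPoly_zero k, fun K i =>
      ⟨⟨0, isPoly_zero k, fun _ _ => rfl⟩, fun _ _ _ => rfl⟩, fun K => continuousOn_const, ?_, ?_⟩
    · intro r _
      simp [Mesh.volInt, Mesh.bdryInt, faceInt_eq]
    · intro ν _
      simp [Mesh.bdryInt, faceInt_eq, numFlux]
  smul_mem' a _ h := IsErrorState.smul h a

/-! ### Error states in nodal coordinates: data and output -/

variable (R : NodalElement d k)

/-- Index type of the nodal coordinates of `V_h × W_h`. -/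
abbrev Coord (N : ℕ) (R : NodalElement d k) : Type :=
  (Fin N × Fin R.card × Fin d) ⊕ (Fin N × Fin R.card)

/-- The data of an error state: moments of the flux residual and nodal values of `w`. -/
def stateData : errorStates k 𝒯 Ω τ →ₗ[ℝ] Coord N R → ℝ where
  toFun σ := Sum.elim
    (fun a => ∫ x in body (𝒯.elem a.1), nodal (𝒯.elem a.1) R a.2.1 x * σ.1.2.2.2 a.1 x a.2.2)
    (fun a => σ.1.2.1 a.1 (nodePt (𝒯.elem a.1) R a.2))
  map_add' σ σ' := by
    have hi : ∀ (σ : errorStates k 𝒯 Ω τ) K j (m : Fin d), IntegrableOn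
        (fun x => nodal (𝒯.elem K) R j x * σ.1.2.2.2 K x m) (body (𝒯.elem K)) := fun σ K j m =>
      integrableOn_body _ ((isPoly_nodal _ R j).continuous.continuousOn.mul
        ((by fun_prop : Continuous fun y : E d => y m).comp_continuousOn
          (IsErrorState.cont σ.2 K)))
    ext (⟨K, j, m⟩ | ⟨K, j⟩)
    · simp only [Sum.elim_inl, Pi.add_apply]
      rw [← integral_add (hi σ K j m) (hi σ' K j m)]
      simp [mul_add]
    · rfl
  map_smul' a σ := by
    ext (⟨K, j, m⟩ | ⟨K, j⟩)
    · simp [← integral_const_mul, mul_left_comm]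
    · rfl

/-- The output of an error state: nodal values of `p` and moments of the numerical flux. -/
def stateOutput : errorStates k 𝒯 Ω τ →ₗ[ℝ] Coord N R → ℝ where
  toFun σ := Sum.elim
    (fun a => σ.1.1 a.1 (nodePt (𝒯.elem a.1) R a.2.1) a.2.2)
    (fun a => fluxRes 𝒯 τ σ.1.1 σ.1.2.1 σ.1.2.2.1 a.1 (nodal (𝒯.elem a.1) R a.2))
  map_add' σ σ' := by
    ext (⟨K, j, m⟩ | ⟨K, j⟩)
    · rfl
    · exact fluxRes_add σ.2 σ'.2 K (isPoly_nodal _ R j)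
  map_smul' a σ := by
    ext (⟨K, j, m⟩ | ⟨K, j⟩)
    · rfl
    · exact fluxRes_smul a K _

theorem volInt_inner_eq_sum {δ p : Fin N → E d → E d}
    (hδ : ∀ K, ContinuousOn (δ K) (body (𝒯.elem K))) (hp : MemV k p) :
    𝒯.volInt (fun K x => inner ℝ (δ K x) (p K x)) = ∑ a : Fin N × Fin R.card × Fin d,
      (∫ x in body (𝒯.elem a.1), nodal (𝒯.elem a.1) R a.2.1 x * δ a.1 x a.2.2) *
        p a.1 (nodePt (𝒯.elem a.1) R a.2.1) a.2.2 := by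
  rw [Fintype.sum_prod_type]
  refine Finset.sum_congr rfl fun K _ => ?_
  have hexp : ∀ x, inner ℝ (δ K x) (p K x) = ∑ a : Fin R.card × Fin d,
      nodal (𝒯.elem K) R a.1 x * δ K x a.2 * p K (nodePt (𝒯.elem K) R a.1) a.2 := fun x => by
    rw [Fintype.sum_prod_type_right, PiLp.inner_apply]
    refine Finset.sum_congr rfl fun m _ => ?_
    rw [(hp K m).eq_sum_nodal (𝒯.elem K) R]
    simp only [RCLike.inner_apply, conj_trivial, Finset.sum_mul]
    exact Finset.sum_congr rfl fun j _ => by ring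
  simp only [hexp]
  rw [integral_finsetSum _ fun a _ => integrableOn_body _
    (((isPoly_nodal _ R a.1).continuous.continuousOn.mul
      ((by fun_prop : Continuous fun y : E d => y a.2).comp_continuousOn (hδ K))).mul
        continuousOn_const)]
  exact Finset.sum_congr rfl fun a _ => integral_mul_const _ _

theorem sum_fluxRes_eq_sum {p : Fin N → E d → E d} {w v : Fin N → E d → ℝ}
    {μ : Set (E d) → E d → ℝ} (hp : MemV k p) (hw : MemW k w) (hμ : MemM k 𝒯 Ω μ)
    (hv : MemW k v) : ∑ K, fluxRes 𝒯 τ p w μ K (v K) = ∑ a : Fin N × Fin R.card,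
      v a.1 (nodePt (𝒯.elem a.1) R a.2) *
        fluxRes 𝒯 τ p w μ a.1 (nodal (𝒯.elem a.1) R a.2) := by
  rw [Fintype.sum_prod_type]
  refine Finset.sum_congr rfl fun K _ => ?_
  conv_lhs => rw [show v K = fun x => ∑ j, v K (nodePt (𝒯.elem K) R j) * nodal (𝒯.elem K) R j x
    from funext fun x => (hv K).eq_sum_nodal (𝒯.elem K) R x]
  exact fluxRes_sum hp hw hμ K _ fun j => isPoly_nodal _ R j

/-- Residual moments are paired with nodal values of p, and nodal values of w with flux moments.
These choices make the pairing exactly the left side of the energy identity. -/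
theorem stateData_mul_stateOutput (σ σ' : errorStates k 𝒯 Ω τ) :
    ∑ a, stateData R σ a * stateOutput R σ' a =
      𝒯.volInt (fun K x => inner ℝ (σ.1.2.2.2 K x) (σ'.1.1 K x)) +
        ∑ K, fluxRes 𝒯 τ σ'.1.1 σ'.1.2.1 σ'.1.2.2.1 K (σ.1.2.1 K) := by
  rw [Fintype.sum_sum_type, volInt_inner_eq_sum R (IsErrorState.cont σ.2)
    (IsErrorState.mem_V σ'.2), sum_fluxRes_eq_sum R (IsErrorState.mem_V σ'.2)
    (IsErrorState.mem_W σ'.2) (IsErrorState.mem_M σ'.2) (IsErrorState.mem_W σ.2)]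
  rfl

theorem stateData_symm (σ σ' : errorStates k 𝒯 Ω τ) :
    ∑ a, stateData R σ a * stateOutput R σ' a = ∑ a, stateData R σ' a * stateOutput R σ a := by
  rw [stateData_mul_stateOutput, stateData_mul_stateOutput, IsErrorState.energy σ.2 σ'.2,
    IsErrorState.energy σ'.2 σ.2]
  congr 1
  · exact 𝒯.volInt_congr fun K x _ => real_inner_comm _ _
  · exact 𝒯.bdryInt_congr fun K i x _ => by ring

/-- Zero data mean zero energy. As τ > 0, p vanishes on the elements and w = μ on the faces, so the
numerical flux vanishes. -/
theorem stateOutput_eq_zero (hτ : ∀ K i, 0 < τ K i) (σ : errorStates k 𝒯 Ω τ)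
    (h : stateData R σ = 0) : stateOutput R σ = 0 := by
  obtain ⟨⟨p, w, μ, δ⟩, hσ⟩ := σ
  have hσ' : IsErrorState k 𝒯 Ω τ p w μ δ := hσ
  have h0 := stateData_mul_stateOutput R ⟨(p, w, μ, δ), hσ⟩ ⟨(p, w, μ, δ), hσ⟩
  rw [h, IsErrorState.energy hσ' hσ'] at h0
  simp only [Pi.zero_apply, zero_mul, Finset.sum_const_zero] at h0
  have hv : 0 ≤ 𝒯.volInt fun K x => inner ℝ (p K x) (p K x) :=
    𝒯.volInt_nonneg fun K x _ => real_inner_self_nonneg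
  have hbnn : ∀ K i x, 0 ≤ τ K i * (w K x - μ (face (𝒯.elem K) i) x) *
      (w K x - μ (face (𝒯.elem K) i) x) := fun K i x => by
    rw [mul_assoc]; exact mul_nonneg (hτ K i).le (mul_self_nonneg _)
  have hb : 0 ≤ 𝒯.bdryInt fun K i x => τ K i * (w K x - μ (face (𝒯.elem K) i) x) *
      (w K x - μ (face (𝒯.elem K) i) x) := 𝒯.bdryInt_nonneg fun K i x _ => hbnn K i x
  have hv0 : 𝒯.volInt (fun K x => inner ℝ (p K x) (p K x)) = 0 := by linarith
  have hb0 : 𝒯.bdryInt (fun K i x => τ K i * (w K x - μ (face (𝒯.elem K) i) x) *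
      (w K x - μ (face (𝒯.elem K) i) x)) = 0 := by linarith
  have hp0 : ∀ K, ∀ x ∈ body (𝒯.elem K), p K x = 0 := fun K x hx => by
    have h1 := (Finset.sum_eq_zero_iff_of_nonneg fun K _ =>
      setIntegral_nonneg (measurableSet_body (𝒯.elem K)) fun x _ =>
        real_inner_self_nonneg (x := p K x)).1 hv0 K (Finset.mem_univ K)
    have hc := (hσ'.mem_V K).continuous
    exact inner_self_eq_zero.1 (eq_zero_of_setIntegral_body_eq_zero _ (hc.inner hc).continuousOn
      (fun x _ => real_inner_self_nonneg) h1 x hx)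
  have hfnn : ∀ K i, 0 ≤ faceInt (𝒯.elem K) i fun x => τ K i *
      (w K x - μ (face (𝒯.elem K) i) x) * (w K x - μ (face (𝒯.elem K) i) x) := fun K i => by
    rw [faceInt_eq]; exact integral_nonneg fun x => hbnn K i x
  have hw0 : ∀ K i, ∀ x ∈ face (𝒯.elem K) i, w K x - μ (face (𝒯.elem K) i) x = 0 :=
    fun K i x hx => by
    have h1 := (Finset.sum_eq_zero_iff_of_nonneg fun i _ => hfnn K i).1
      ((Finset.sum_eq_zero_iff_of_nonneg fun K _ => Finset.sum_nonneg fun i _ =>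
        hfnn K i).1 hb0 K (Finset.mem_univ K)) i (Finset.mem_univ i)
    have hc := (hσ'.mem_W K).continuous.continuousOn.sub (hσ'.mem_M.continuousOn K i)
    have h2 := eq_zero_of_faceInt_eq_zero _ _ ((continuousOn_const.mul hc).mul hc)
      (fun x _ => hbnn K i x) h1 x hx
    rw [mul_assoc] at h2
    exact mul_self_eq_zero.1 ((mul_eq_zero.1 h2).resolve_left (hτ K i).ne')
  ext (⟨K, j, m⟩ | ⟨K, j⟩)
  · change p K (nodePt (𝒯.elem K) R j) m = 0
    rw [hp0 K _ (nodePt_mem _ R j)]; rfl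
  · change fluxRes 𝒯 τ p w μ K (nodal (𝒯.elem K) R j) = 0
    unfold fluxRes
    rw [setIntegral_congr_fun (measurableSet_body _) (g := fun _ => (0 : ℝ)) fun x hx => by
      simp only [hp0 K x hx, inner_zero_left]]
    rw [integral_zero, sub_zero]
    refine Finset.sum_eq_zero fun i _ => ?_
    rw [faceInt_eq]
    refine integral_eq_zero_of_ae ?_
    filter_upwards [faceMeasure_ae_mem (𝒯.elem K) i] with x hx
    simp [numFlux, hw0 K i x hx, hp0 K x (face_subset_body _ _ hx)]

end

section

variable {d k N : ℕ} [NeZero d]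

/-! ### The error equations -/

/-- The flux component of the HDG projection on the mesh. -/
abbrev projV (k : ℕ) (𝒯 : Mesh d N) (τ : Fin N → Fin (d + 1) → ℝ) (q : E d → E d) (u : E d → ℝ)
    (K : Fin N) : E d → E d := (hdgProj k (𝒯.elem K) (τ K) q u).1

/-- The scalar component of the HDG projection on the mesh. -/
abbrev projW (k : ℕ) (𝒯 : Mesh d N) (τ : Fin N → Fin (d + 1) → ℝ) (q : E d → E d) (u : E d → ℝ)
    (K : Fin N) : E d → ℝ := (hdgProj k (𝒯.elem K) (τ K) q u).2

section Steady

variable {𝒯 : Mesh d N} {Ω : Set (E d)} {τ : Fin N → Fin (d + 1) → ℝ} (h𝒯 : 𝒯.Partitions Ω)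
  (hτ : ∀ K i, 0 < τ K i) {q : E d → E d} {u : E d → ℝ} (hq : ContinuousOn q (closure Ω))
  (hu : ContinuousOn u (closure Ω))

include h𝒯 hq hu

theorem volInt_flux (hgrad : ∀ x ∈ Ω, HasGradientAt u (-(q x)) x) {r : Fin N → E d → E d}
    (hr : MemV k r) : 𝒯.volInt (fun K x => u x * div (r K) x - inner ℝ (q x) (r K x)) =
      𝒯.bdryInt (fun K i x => u x * inner ℝ (r K x) (normal (𝒯.elem K) i)) :=
  Finset.sum_congr rfl fun K _ => integral_by_parts_of_gradient _
    (hu.mono (h𝒯.body_subset_closure K)) (hq.mono (h𝒯.body_subset_closure K))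
    (fun x hx => hgrad x (h𝒯.interior_body_subset K hx)) (hr K)

include hτ

theorem projection_spec (K : Fin N) : IsHDGProjection k (𝒯.elem K) (τ K) q u
    (projV k 𝒯 τ q u K) (projW k 𝒯 τ q u K) :=
  hdgProj_spec _ (hτ K) (hq.mono (h𝒯.body_subset_closure K)) (hu.mono (h𝒯.body_subset_closure K))

/-- The numerical flux of the projections has the same moments as the exact flux. -/
theorem faceInt_numFlux_proj (hb : ∀ x ∈ frontier Ω, u x = 0) (K : Fin N) (i : Fin (d + 1))
    {ν : E d → ℝ} (hν : IsPoly k ν) :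
    faceInt (𝒯.elem K) i (fun x => numFlux 𝒯 τ (projV k 𝒯 τ q u) (projW k 𝒯 τ q u)
      (traceProj k Ω u) K i x * ν x) =
    faceInt (𝒯.elem K) i (fun x => inner ℝ (q x) (normal (𝒯.elem K) i) * ν x) := by
  have hp := projection_spec (k := k) h𝒯 hτ hq hu K
  have hF := (face_subset_body (𝒯.elem K) i).trans (h𝒯.body_subset_closure K)
  have htr := traceProj_spec (k := k) (𝒯.elem K) i (hu.mono hF) hb
  have h1 := hp.orth_face i ν hν
  have h2 := htr.2.2 ν hν
  have hνc := hν.continuous.continuousOn (s := face (𝒯.elem K) i)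
  have c1 : ContinuousOn (fun x => (inner ℝ (projV k 𝒯 τ q u K x) (normal (𝒯.elem K) i) +
      τ K i * projW k 𝒯 τ q u K x) * ν x) (face (𝒯.elem K) i) :=
    (((hp.poly_q.continuous.inner continuous_const).add
      (continuous_const.mul hp.poly_u.continuous)).mul hν.continuous).continuousOn
  have c2 : ContinuousOn (fun x => traceProj k Ω u (face (𝒯.elem K) i) x * ν x)
      (face (𝒯.elem K) i) := (htr.1.continuous.mul hν.continuous).continuousOn
  have c3 : ContinuousOn (fun x => (inner ℝ (q x) (normal (𝒯.elem K) i) +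
      τ K i * u x) * ν x) (face (𝒯.elem K) i) :=
    (((hq.mono hF).inner (𝕜 := ℝ) continuousOn_const).add
      (continuousOn_const.mul (hu.mono hF))).mul hνc
  have c4 : ContinuousOn (fun x => u x * ν x) (face (𝒯.elem K) i) := (hu.mono hF).mul hνc
  have e1 : faceInt (𝒯.elem K) i (fun x => numFlux 𝒯 τ (projV k 𝒯 τ q u) (projW k 𝒯 τ q u)
      (traceProj k Ω u) K i x * ν x) = faceInt (𝒯.elem K) i (fun x =>
        (inner ℝ (projV k 𝒯 τ q u K x) (normal (𝒯.elem K) i) +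
          τ K i * projW k 𝒯 τ q u K x) * ν x) -
      τ K i * faceInt (𝒯.elem K) i (fun x => traceProj k Ω u (face (𝒯.elem K) i) x * ν x) := by
    simp only [faceInt_eq]
    rw [← integral_const_mul, ← integral_sub (integrable_faceMeasure _ _ c1)
      ((integrable_faceMeasure _ _ c2).const_mul _)]
    refine integral_congr_ae (ae_of_all _ fun x => ?_)
    simp only [numFlux]
    ring
  have e2 : faceInt (𝒯.elem K) i (fun x => inner ℝ (q x) (normal (𝒯.elem K) i) * ν x) =
      faceInt (𝒯.elem K) i (fun x => (inner ℝ (q x) (normal (𝒯.elem K) i) +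
      τ K i * u x) * ν x) - τ K i * faceInt (𝒯.elem K) i (fun x => u x * ν x) := by
    simp only [faceInt_eq]
    rw [← integral_const_mul, ← integral_sub (integrable_faceMeasure _ _ c3)
      ((integrable_faceMeasure _ _ c4).const_mul _)]
    refine integral_congr_ae (ae_of_all _ fun x => ?_)
    ring
  rw [e1, e2, h1, h2]

/-- The projected exact solution is a state of the error system up to the projection error. -/
theorem isErrorState_proj (hgrad : ∀ x ∈ Ω, HasGradientAt u (-(q x)) x)
    (hb : ∀ x ∈ frontier Ω, u x = 0) :
    IsErrorState k 𝒯 Ω τ (projV k 𝒯 τ q u) (projW k 𝒯 τ q u) (traceProj k Ω u)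
      (fun K x => projV k 𝒯 τ q u K x - q x) where
  mem_V K := (projection_spec h𝒯 hτ hq hu K).poly_q
  mem_W K := (projection_spec h𝒯 hτ hq hu K).poly_u
  mem_M := memM_traceProj hu h𝒯 hb
  cont K := (projection_spec h𝒯 hτ hq hu K).poly_q.continuous.continuousOn.sub
    (hq.mono (h𝒯.body_subset_closure K))
  flux r hr := by
    have h1 := volInt_flux h𝒯 hq hu hgrad hr
    have h2 : 𝒯.bdryInt (fun K i x => traceProj k Ω u (face (𝒯.elem K) i) x *
        inner ℝ (r K x) (normal (𝒯.elem K) i)) =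
        𝒯.bdryInt (fun K i x => u x * inner ℝ (r K x) (normal (𝒯.elem K) i)) :=
      Finset.sum_congr rfl fun K _ => Finset.sum_congr rfl fun i _ =>
        (traceProj_spec (𝒯.elem K) i (hu.mono ((face_subset_body _ i).trans
          (h𝒯.body_subset_closure K))) hb).2.2 _ (sum_isPolyVec_coord (hr K) _)
    rw [h2, ← h1]
    have c1 : ∀ K, IntegrableOn (fun x => inner ℝ (q x) (r K x)) (body (𝒯.elem K)) := fun K =>
      integrableOn_body _ ((hq.mono (h𝒯.body_subset_closure K)).inner (𝕜 := ℝ)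
        (hr K).continuous.continuousOn)
    have c2 : ∀ K, IntegrableOn (fun x => u x * div (r K) x) (body (𝒯.elem K)) := fun K =>
      integrableOn_body _ ((hu.mono (h𝒯.body_subset_closure K)).mul
        (hr K).div.isPoly.continuous.continuousOn)
    have c3 : ∀ K, IntegrableOn (fun x => projW k 𝒯 τ q u K x * div (r K) x)
        (body (𝒯.elem K)) := fun K =>
      integrableOn_body _ ((projection_spec h𝒯 hτ hq hu K).poly_u.continuous.mul
        (hr K).div.isPoly.continuous).continuousOn
    have e1 : 𝒯.volInt (fun K x => inner ℝ (projV k 𝒯 τ q u K x) (r K x) -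
        projW k 𝒯 τ q u K x * div (r K) x - inner ℝ (projV k 𝒯 τ q u K x - q x) (r K x)) =
        𝒯.volInt (fun K x => inner ℝ (q x) (r K x)) -
          𝒯.volInt (fun K x => projW k 𝒯 τ q u K x * div (r K) x) := by
      rw [← 𝒯.volInt_sub c1 c3]
      exact 𝒯.volInt_congr fun K x _ => by rw [inner_sub_left]; ring
    -- The divergence of r has degree at most k - 1, so the projection of u may be replaced by u.
    have e2 : 𝒯.volInt (fun K x => projW k 𝒯 τ q u K x * div (r K) x) =
        𝒯.volInt (fun K x => u x * div (r K) x) :=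
      Finset.sum_congr rfl fun K _ => (projection_spec h𝒯 hτ hq hu K).orth_u _ (hr K).div
    rw [e1, e2, 𝒯.volInt_sub c2 c1]
    ring
  trace ν hν := by
    -- The exact flux q is continuous across faces, so ν q·n cancels between the two sides. The
    -- projected numerical flux has the same moments.
    have h1 := h𝒯.interiorBdryInt_eq_zero (v := fun F x => ν F x • q x) fun K i =>
      (hν.continuousOn K i).smul
        (hq.mono ((face_subset_body _ i).trans (h𝒯.body_subset_closure K)))
    rw [𝒯.interiorBdryInt_eq_bdryInt fun K i hF x hx => by
      simp [(hν K i).2 hF x hx]] at h1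
    rw [← h1]
    refine Finset.sum_congr rfl fun K _ => Finset.sum_congr rfl fun i _ => ?_
    obtain ⟨p, hp, he⟩ := (hν K i).1
    have h2 := faceInt_numFlux_proj h𝒯 hτ hq hu hb K i hp
    refine Eq.trans ?_ (h2.trans ?_) <;> rw [faceInt_eq, faceInt_eq] <;>
      refine integral_congr_ae ?_ <;>
      filter_upwards [faceMeasure_ae_mem (𝒯.elem K) i] with x hx
    · rw [he hx]
    · rw [real_inner_smul_left, he hx, mul_comm]

/-- Weak divergence of the exact flux, in terms of the projections. -/
theorem volInt_add_fluxRes_proj {g : E d → ℝ} (hg : HasWeakDiv Ω q g)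
    (hgi : ∀ K, IntegrableOn g (body (𝒯.elem K))) (hb : ∀ x ∈ frontier Ω, u x = 0)
    {w : Fin N → E d → ℝ} (hw : MemW k w) :
    𝒯.volInt (fun K x => g x * w K x) = ∑ K, fluxRes 𝒯 τ (projV k 𝒯 τ q u) (projW k 𝒯 τ q u)
      (traceProj k Ω u) K (w K) := by
  refine Finset.sum_congr rfl fun K _ => ?_
  have hqK := hq.mono (h𝒯.body_subset_closure K)
  have h1 := integral_by_parts_of_weakDiv (𝒯.elem K) hqK (hgi K) (fun φ hφ hφc hφs => by
    have hext : ∀ (A : Set (E d)), tsupport φ ⊆ A → ∀ f : E d → ℝ, (∀ x, x ∉ tsupport φ → f x = 0) →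
        ∫ x in A, f x = ∫ x, f x := fun A hA f hf =>
      setIntegral_eq_integral_of_forall_compl_eq_zero fun x hx => hf x fun h => hx (hA h)
    have hz1 : ∀ x, x ∉ tsupport φ → inner ℝ (q x) (gradient φ x) = 0 := fun x hx => by
      have : fderiv ℝ φ x = 0 := by
        by_contra hne
        exact hx (support_fderiv_subset ℝ hne)
      simp [gradient, this]
    have hz2 : ∀ x, x ∉ tsupport φ → g x * φ x = 0 := fun x hx => by
      rw [image_eq_zero_of_notMem_tsupport hx, mul_zero]
    have hΩ := hφs.trans (h𝒯.interior_body_subset K)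
    have := hg φ hφ hφc hΩ
    rwa [hext Ω hΩ _ hz1, hext Ω hΩ _ hz2, ← hext _ (hφs.trans interior_subset) _ hz1,
      ← hext _ (hφs.trans interior_subset) _ hz2] at this) (hw K)
  have hi : IntegrableOn (fun x => g x * w K x) (body (𝒯.elem K)) :=
    (hgi K).mul_continuousOn (hw K).continuous.continuousOn (isCompact_body _)
  rw [integral_add hi (integrableOn_body _ (hqK.inner (𝕜 := ℝ)
    (hw K).continuous_gradient.continuousOn))] at h1
  -- The gradient of a polynomial of degree k has degree at most k - 1, so the volume term does not
  -- see the projection error.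
  have h2 : ∫ x in body (𝒯.elem K), inner ℝ (projV k 𝒯 τ q u K x) (gradient (w K) x) =
      ∫ x in body (𝒯.elem K), inner ℝ (q x) (gradient (w K) x) :=
    (projection_spec h𝒯 hτ hq hu K).orth_q _ (hw K).gradient
  unfold fluxRes
  rw [h2, Finset.sum_congr rfl fun i _ => faceInt_numFlux_proj h𝒯 hτ hq hu hb K i (hw K), ← h1]
  ring

end Steady

/-- The discrete solution is a state of the error system with vanishing residual. -/
theorem isErrorState_discrete {𝒯 : Mesh d N} {Ω : Set (E d)} {τ : Fin N → Fin (d + 1) → ℝ}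
    {qh : Fin N → E d → E d} {uh : Fin N → E d → ℝ} {uhat : Set (E d) → E d → ℝ}
    (hq : MemV k qh) (hu : MemW k uh) (hμ : MemM k 𝒯 Ω uhat)
    (hflux : ∀ r, MemV k r →
      𝒯.volInt (fun K x => inner ℝ (qh K x) (r K x))
        - 𝒯.volInt (fun K x => uh K x * div (r K) x)
        + 𝒯.bdryInt (fun K i x =>
          uhat (face (𝒯.elem K) i) x * inner ℝ (r K x) (normal (𝒯.elem K) i)) = 0)
    (htrace : ∀ ν, MemM k 𝒯 Ω ν → 𝒯.interiorBdryInt Ω (fun K i x =>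
      numFlux 𝒯 τ qh uh uhat K i x * ν (face (𝒯.elem K) i) x) = 0) :
    IsErrorState k 𝒯 Ω τ qh uh uhat 0 where
  mem_V := hq
  mem_W := hu
  mem_M := hμ
  cont K := continuousOn_const
  flux r hr := by
    rw [← hflux r hr]
    congr 1
    rw [← 𝒯.volInt_sub (f := fun K x => inner ℝ (qh K x) (r K x))
      (g := fun K x => uh K x * div (r K) x)
      (fun K => integrableOn_body _ ((hq K).continuous.inner (hr K).continuous).continuousOn)
      (fun K => integrableOn_body _ ((hu K).continuous.mul
        (hr K).div.isPoly.continuous).continuousOn)]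
    exact 𝒯.volInt_congr fun K x _ => by simp
  trace ν hν := by
    rw [← htrace ν hν]
    exact (𝒯.interiorBdryInt_eq_bdryInt fun K i hF x hx => by rw [(hν K i).2 hF x hx, mul_zero]).symm

end

section

/-! ### Gronwall's inequality and broken norms in time -/

/-- Only the upper bound `g` has to be integrable. The derivative `Z'` itself need not be, and the
derivative at time zero is not used. -/
theorem le_add_integral_of_deriv_le {T : ℝ} {Z Z' g : ℝ → ℝ} (hZ : ContinuousOn Z (Icc 0 T))
    (hd : ∀ t ∈ Ioc 0 T, HasDerivWithinAt Z (Z' t) (Icc 0 T) t)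
    (hg : ContinuousOn g (Icc 0 T)) (hle : ∀ t ∈ Ioc 0 T, Z' t ≤ g t) {s t : ℝ} (hs : 0 ≤ s)
    (hst : s ≤ t) (ht : t ≤ T) : Z t ≤ Z s + ∫ r in s..t, g r := by
  have hsub : Icc s t ⊆ Icc 0 T := Icc_subset_Icc hs ht
  have h := intervalIntegral.sub_le_integral_of_hasDeriv_right_of_le hst (hZ.mono hsub)
    (g' := Z') (φ := g) (fun x hx => ?_) ((hg.mono hsub).integrableOn_compact isCompact_Icc)
    (fun x hx => hle x ⟨hs.trans_lt hx.1, hx.2.le.trans ht⟩)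
  · linarith
  · have hx0 : 0 < x := hs.trans_lt hx.1
    have hxT : x < T := hx.2.trans_le ht
    exact ((hd x ⟨hx0, hxT.le⟩).hasDerivAt (Icc_mem_nhds hx0 hxT)).hasDerivWithinAt

/-- Integrating factor exp(-Ct): the derivative of the product is at most C g, because the factor is
at most one and `g` is nonnegative. -/
theorem gronwall_of_deriv_le {T C : ℝ} (hC : 0 ≤ C) {Z Z' g : ℝ → ℝ}
    (hZ : ContinuousOn Z (Icc 0 T))
    (hd : ∀ t ∈ Ioc 0 T, HasDerivWithinAt Z (Z' t) (Icc 0 T) t)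
    (hg : ContinuousOn g (Icc 0 T)) (hg0 : ∀ t ∈ Icc 0 T, 0 ≤ g t)
    (hle : ∀ t ∈ Ioc 0 T, Z' t ≤ C * (g t + Z t)) {t : ℝ} (ht : t ∈ Icc 0 T) :
    Z t ≤ Real.exp (C * t) * (Z 0 + C * ∫ r in (0 : ℝ)..t, g r) := by
  have hexp : ∀ x, HasDerivAt (fun x => Real.exp (-(C * x))) (Real.exp (-(C * x)) * -(C * 1)) x :=
    fun x => (((hasDerivAt_id x).const_mul C).neg).exp
  have h := le_add_integral_of_deriv_le (Z := fun x => Real.exp (-(C * x)) * Z x)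
    (Z' := fun x => Real.exp (-(C * x)) * -(C * 1) * Z x + Real.exp (-(C * x)) * Z' x)
    (g := fun x => C * g x) ((by fun_prop : Continuous fun x => Real.exp (-(C * x))).continuousOn.mul
      hZ) (fun x hx => (hexp x).hasDerivWithinAt.mul (hd x hx)) (continuousOn_const.mul hg)
    (fun x hx => ?_) le_rfl ht.1 ht.2
  · simp only [mul_zero, neg_zero, Real.exp_zero, one_mul, intervalIntegral.integral_const_mul] at h
    calc Z t = Real.exp (C * t) * (Real.exp (-(C * t)) * Z t) := by
          rw [← mul_assoc, ← Real.exp_add, add_neg_cancel, Real.exp_zero, one_mul]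
      _ ≤ _ := mul_le_mul_of_nonneg_left h (Real.exp_pos _).le
  · have h1 : Real.exp (-(C * x)) ≤ 1 := Real.exp_le_one_iff.2 (by
      have := mul_nonneg hC hx.1.le; linarith)
    have h2 := mul_le_mul_of_nonneg_left (hle x hx) (Real.exp_pos (-(C * x))).le
    have h3 : 0 ≤ C * g x := mul_nonneg hC (hg0 x ⟨hx.1.le, hx.2⟩)
    nlinarith [mul_le_mul_of_nonneg_right h1 h3]

variable {d k N : ℕ} [NeZero d] {T : ℝ} (𝒯 : Mesh d N)

theorem Mesh.continuousOn_volInt {f : ℝ → Fin N → E d → ℝ}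
    (hf : ∀ K, ContinuousOn (fun p : ℝ × E d => f p.1 K p.2) (Icc 0 T ×ˢ body (𝒯.elem K))) :
    ContinuousOn (fun t => 𝒯.volInt (f t)) (Icc 0 T) :=
  continuousOn_finsetSum _ fun K _ => continuousOn_integral_param (f := fun t => f t K)
    (isCompact_body _) (ae_mem_body _) (hf K)

theorem Mesh.continuousOn_normSq {V : Type} [NormedAddCommGroup V] {f : ℝ → Fin N → E d → V}
    (hf : ∀ K, ContinuousOn (fun p : ℝ × E d => f p.1 K p.2) (Icc 0 T ×ˢ body (𝒯.elem K))) :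
    ContinuousOn (fun t => 𝒯.normSq (f t)) (Icc 0 T) :=
  𝒯.continuousOn_volInt fun K => (hf K).norm.pow 2

section Inner

variable {V : Type} [NormedAddCommGroup V] [InnerProductSpace ℝ V]

theorem Mesh.normSq_eq (f : Fin N → E d → V) :
    𝒯.normSq f = 𝒯.volInt fun K x => inner ℝ (f K x) (f K x) := by
  simp only [Mesh.normSq, real_inner_self_eq_norm_sq]

/-- Young's inequality for the broken inner product. -/
theorem Mesh.volInt_inner_le {f g : Fin N → E d → V} {ε : ℝ} (hε : 0 < ε)
    (hf : ∀ K, ContinuousOn (f K) (body (𝒯.elem K)))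
    (hg : ∀ K, ContinuousOn (g K) (body (𝒯.elem K))) :
    2 * 𝒯.volInt (fun K x => inner ℝ (f K x) (g K x)) ≤ ε * 𝒯.normSq f + ε⁻¹ * 𝒯.normSq g := by
  have i1 : ∀ K, IntegrableOn (fun x => ‖f K x‖ ^ 2) (body (𝒯.elem K)) := fun K =>
    integrableOn_body _ ((hf K).norm.pow 2)
  have i2 : ∀ K, IntegrableOn (fun x => ‖g K x‖ ^ 2) (body (𝒯.elem K)) := fun K =>
    integrableOn_body _ ((hg K).norm.pow 2)
  unfold Mesh.normSq
  rw [← 𝒯.volInt_const_mul, ← 𝒯.volInt_const_mul, ← 𝒯.volInt_const_mul,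
    ← 𝒯.volInt_add (f := fun K x => ε * ‖f K x‖ ^ 2) (g := fun K x => ε⁻¹ * ‖g K x‖ ^ 2)
      (fun K => (i1 K).const_mul ε) (fun K => (i2 K).const_mul ε⁻¹)]
  refine 𝒯.volInt_mono (fun K => (integrableOn_body _ ((hf K).inner (𝕜 := ℝ) (hg K))).const_mul 2)
    (fun K => ((i1 K).const_mul ε).add ((i2 K).const_mul ε⁻¹)) fun K x _ => ?_
  have h1 := real_inner_le_norm (f K x) (g K x)
  have h2 : 0 ≤ ε⁻¹ * (ε * ‖f K x‖ - ‖g K x‖) ^ 2 := by positivity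
  have h3 : ε⁻¹ * (ε * ‖f K x‖ - ‖g K x‖) ^ 2 =
      ε * ‖f K x‖ ^ 2 - 2 * (‖f K x‖ * ‖g K x‖) + ε⁻¹ * ‖g K x‖ ^ 2 := by
    field_simp; ring
  linarith

theorem Mesh.normSq_add_le {f g : Fin N → E d → V}
    (hf : ∀ K, ContinuousOn (f K) (body (𝒯.elem K)))
    (hg : ∀ K, ContinuousOn (g K) (body (𝒯.elem K))) :
    𝒯.normSq (fun K x => f K x + g K x) ≤ 2 * 𝒯.normSq f + 2 * 𝒯.normSq g := by
  have i1 : ∀ K, IntegrableOn (fun x => ‖f K x‖ ^ 2) (body (𝒯.elem K)) := fun K =>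
    integrableOn_body _ ((hf K).norm.pow 2)
  have i2 : ∀ K, IntegrableOn (fun x => ‖g K x‖ ^ 2) (body (𝒯.elem K)) := fun K =>
    integrableOn_body _ ((hg K).norm.pow 2)
  unfold Mesh.normSq
  rw [← 𝒯.volInt_const_mul, ← 𝒯.volInt_const_mul,
    ← 𝒯.volInt_add (f := fun K x => 2 * ‖f K x‖ ^ 2) (g := fun K x => 2 * ‖g K x‖ ^ 2)
      (fun K => (i1 K).const_mul 2) (fun K => (i2 K).const_mul 2)]
  refine 𝒯.volInt_mono (fun K => integrableOn_body _ (((hf K).add (hg K)).norm.pow 2))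
    (fun K => ((i1 K).const_mul 2).add ((i2 K).const_mul 2)) fun K x _ => ?_
  have := parallelogram_law_with_norm ℝ (f K x) (g K x)
  nlinarith [sq_nonneg ‖f K x - g K x‖]

theorem Mesh.normSq_congr {f g : Fin N → E d → V}
    (h : ∀ K, ∀ x ∈ body (𝒯.elem K), f K x = g K x) : 𝒯.normSq f = 𝒯.normSq g :=
  𝒯.volInt_congr fun K x hx => by rw [h K x hx]

theorem Mesh.normSq_neg (f : Fin N → E d → V) : 𝒯.normSq (fun K x => -f K x) = 𝒯.normSq f := by
  simp only [Mesh.normSq, norm_neg]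

theorem Mesh.normSq_sub_le {f g : Fin N → E d → V}
    (hf : ∀ K, ContinuousOn (f K) (body (𝒯.elem K)))
    (hg : ∀ K, ContinuousOn (g K) (body (𝒯.elem K))) :
    𝒯.normSq (fun K x => f K x - g K x) ≤ 2 * 𝒯.normSq f + 2 * 𝒯.normSq g := by
  have h := 𝒯.normSq_add_le hf (fun K => (hg K).neg)
  simp only [Pi.neg_apply, ← sub_eq_add_neg] at h
  rwa [show 𝒯.normSq (fun K => -g K) = 𝒯.normSq g from 𝒯.normSq_neg g] at h

/-- Growth of the broken norm of a function that is continuously differentiable in time. -/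
theorem Mesh.normSq_le_add_integral {f f' : ℝ → Fin N → E d → V}
    (hf : ∀ K, IsC1On T (body (𝒯.elem K)) (fun t => f t K) (fun t => f' t K)) {s t : ℝ}
    (hs : 0 ≤ s) (hst : s ≤ t) (ht : t ≤ T) :
    𝒯.normSq (f t) ≤ 𝒯.normSq (f s) + ∫ r in s..t, (𝒯.normSq (f r) + 𝒯.normSq (f' r)) := by
  have hc := 𝒯.continuousOn_normSq (fun K => (hf K).cont)
  have hc' := 𝒯.continuousOn_normSq (fun K => (hf K).cont')
  refine le_add_integral_of_deriv_le (T := T) (Z := fun t => 𝒯.normSq (f t)) hc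
    (Z' := fun t => ∑ K, ∫ x in body (𝒯.elem K),
      (inner ℝ (f t K x) (f' t K x) + inner ℝ (f' t K x) (f t K x)))
    (fun r hr => ?_) (hc.add hc') (fun r hr => ?_) hs hst ht
  · simp only [Mesh.normSq_eq]
    exact HasDerivWithinAt.fun_sum fun K _ => hasDerivWithinAt_integral_param (isCompact_body _)
      (ae_mem_body _) ((hf K).inner (hf K)) ⟨hr.1.le, hr.2⟩
  · have hr' : r ∈ Icc 0 T := ⟨hr.1.le, hr.2⟩
    have h := 𝒯.volInt_inner_le one_pos (fun K => slice_continuousOn (f := fun t => f t K) (hf K).cont hr')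
      (fun K => slice_continuousOn (f := fun t => f' t K) (hf K).cont' hr')
    rw [one_mul, inv_one, one_mul, ← 𝒯.volInt_const_mul] at h
    refine le_trans (le_of_eq ?_) h
    refine Finset.sum_congr rfl fun K _ => ?_
    congr 1
    ext x
    rw [real_inner_comm (f r K x)]
    ring

end Inner

end

section

variable {d k N : ℕ} [NeZero d]

/-! ### The nonlinear term -/

theorem interp_sub (R : NodalElement d k) (S : Simplex d) {V : Type} [AddCommGroup V] [Module ℝ V]
    (g h : E d → V) (x : E d) :
    interp R S (fun y => g y - h y) x = interp R S g x - interp R S h x := by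
  simp only [interp, smul_sub, Finset.sum_sub_distrib]

theorem continuous_of_lipschitz {F : E d → ℝ → ℝ} {L : ℝ}
    (hF : ∀ p r v w, |F p v - F r w| ≤ L * (‖p - r‖ + |v - w|)) :
    Continuous fun z : E d × ℝ => F z.1 z.2 := by
  have hL : 0 ≤ L := by
    have h := (abs_nonneg _).trans (hF 0 0 1 0)
    simpa using h
  refine (LipschitzWith.of_dist_le_mul (K := ⟨2 * L, by positivity⟩) fun z y => ?_).continuous
  rw [Real.dist_eq]
  refine (hF _ _ _ _).trans ?_
  have h1 : ‖z.1 - y.1‖ ≤ dist z y := by rw [← dist_eq_norm]; exact le_max_left _ _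
  have h2 : |z.2 - y.2| ≤ dist z y := by rw [← Real.dist_eq]; exact le_max_right _ _
  change L * _ ≤ 2 * L * dist z y
  nlinarith [mul_le_mul_of_nonneg_left (add_le_add h1 h2) hL]

/-- Estimate of the interpolated nonlinear term by the interpolation and projection errors and
the discrete errors. -/
theorem exists_nonlinear_bound (R : NodalElement d k) (L : ℝ) : ∃ C : ℝ, 0 < C ∧
    ∀ (N : ℕ) (𝒯 : Mesh d N) (F : E d → ℝ → ℝ) (q : E d → E d) (u : E d → ℝ)
      (pq qh : Fin N → E d → E d) (pu uh : Fin N → E d → ℝ),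
      (∀ p r v w, |F p v - F r w| ≤ L * (‖p - r‖ + |v - w|)) →
      (∀ K, ContinuousOn q (body (𝒯.elem K))) → (∀ K, ContinuousOn u (body (𝒯.elem K))) →
      MemV k pq → MemV k qh → MemW k pu → MemW k uh →
      𝒯.normSq (fun K x => F (-(q x)) (u x) -
          interp R (𝒯.elem K) (fun y => F (-(qh K y)) (uh K y)) x) ≤
        C * (errInterp R 𝒯 (fun x => F (-(q x)) (u x)) + 𝒯.normSq (fun K x => pq K x - q x) +
          𝒯.normSq (fun K x => pu K x - u x) + errInterp R 𝒯 q + errInterp R 𝒯 u +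
          𝒯.normSq (fun K x => pq K x - qh K x) + 𝒯.normSq (fun K x => pu K x - uh K x)) := by
  obtain ⟨C, hC, hb⟩ := exists_interp_bound R
  refine ⟨2 + 8 * (C * L ^ 2), by positivity, fun N 𝒯 F q u pq qh pu uh hF hq hu hpq hqh hpu huh => ?_⟩
  have hFc := continuous_of_lipschitz hF
  have hqi : ∀ K, Continuous (interp R (𝒯.elem K) q) := fun K =>
    (isPolyVec_interp (𝒯.elem K) R q).continuous
  have hui : ∀ K, Continuous (interp R (𝒯.elem K) u) := fun K =>
    (isPoly_interp (𝒯.elem K) R u).continuous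
  have hFq : ∀ K, ContinuousOn (fun x => F (-(q x)) (u x)) (body (𝒯.elem K)) := fun K =>
    hFc.comp_continuousOn ((hq K).neg.prodMk (hu K))
  have h1 : 𝒯.normSq (fun K x => F (-(q x)) (u x) -
      interp R (𝒯.elem K) (fun y => F (-(qh K y)) (uh K y)) x) ≤
      2 * errInterp R 𝒯 (fun x => F (-(q x)) (u x)) +
      2 * 𝒯.normSq (fun K => interp R (𝒯.elem K)
        (fun y => F (-(q y)) (u y) - F (-(qh K y)) (uh K y))) := by
    have hs := 𝒯.normSq_sub_le
      (f := fun K => interp R (𝒯.elem K) (fun y => F (-(q y)) (u y) - F (-(qh K y)) (uh K y)))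
      (g := fun K x => interp R (𝒯.elem K) (fun y => F (-(q y)) (u y)) x - F (-(q x)) (u x))
      (fun K => (isPoly_interp (𝒯.elem K) R _).continuous.continuousOn)
      (fun K => (isPoly_interp (𝒯.elem K) R _).continuous.continuousOn.sub (hFq K))
    rw [𝒯.normSq_congr (g := fun K x => F (-(q x)) (u x) -
      interp R (𝒯.elem K) (fun y => F (-(qh K y)) (uh K y)) x) fun K x _ => by
        rw [interp_sub]; ring] at hs
    change _ ≤ 2 * _ + 2 * errInterp R 𝒯 (fun x => F (-(q x)) (u x)) at hs
    linarith
  -- At the nodes q and u coincide with their interpolants, so the nodal difference of F is bounded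
  -- by the polynomials I_h q - q_h and I_h u - u_h, to which interpolation stability applies.
  have h2 : 𝒯.normSq (fun K => interp R (𝒯.elem K)
        (fun y => F (-(q y)) (u y) - F (-(qh K y)) (uh K y))) ≤
      C * L ^ 2 * (𝒯.normSq (fun K x => interp R (𝒯.elem K) q x - qh K x) +
        𝒯.normSq (fun K x => interp R (𝒯.elem K) u x - uh K x)) := by
    simp only [Mesh.normSq, Mesh.volInt, ← Finset.sum_add_distrib, Finset.mul_sum,
      Real.norm_eq_abs, sq_abs]
    refine Finset.sum_le_sum fun K _ => hb _ _ _ _ _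
      ((isPolyVec_interp (𝒯.elem K) R q).sub (hqh K))
      ((isPoly_interp (𝒯.elem K) R u).sub (huh K)) fun j => ?_
    simp only [interp_nodePt, interp_nodePt_vec]
    refine (hF _ _ _ _).trans (le_of_eq ?_)
    rw [← norm_neg]
    congr 3
    abel
  -- Uses I_h q - q_h = (I_h q - q) + (Π_V q - q_h) - (Π_V q - q). The scalar part below is split in
  -- the same way.
  have h3 : 𝒯.normSq (fun K x => interp R (𝒯.elem K) q x - qh K x) ≤
      2 * errInterp R 𝒯 q + 2 * (2 * 𝒯.normSq (fun K x => pq K x - qh K x) +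
        2 * 𝒯.normSq (fun K x => pq K x - q x)) := by
    have c1 : ∀ K, ContinuousOn (fun x => pq K x - qh K x) (body (𝒯.elem K)) := fun K =>
      ((hpq K).continuous.sub (hqh K).continuous).continuousOn
    have c2 : ∀ K, ContinuousOn (fun x => pq K x - q x) (body (𝒯.elem K)) := fun K =>
      (hpq K).continuous.continuousOn.sub (hq K)
    have s1 := 𝒯.normSq_sub_le c1 c2
    have s2 := 𝒯.normSq_add_le (f := fun K x => interp R (𝒯.elem K) q x - q x)
      (g := fun K x => pq K x - qh K x - (pq K x - q x))
      (fun K => (hqi K).continuousOn.sub (hq K)) (fun K => (c1 K).sub (c2 K))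
    rw [𝒯.normSq_congr (g := fun K x => interp R (𝒯.elem K) q x - qh K x) fun K x _ => by
      abel] at s2
    change _ ≤ 2 * errInterp R 𝒯 q + _ at s2
    linarith
  have h4 : 𝒯.normSq (fun K x => interp R (𝒯.elem K) u x - uh K x) ≤
      2 * errInterp R 𝒯 u + 2 * (2 * 𝒯.normSq (fun K x => pu K x - uh K x) +
        2 * 𝒯.normSq (fun K x => pu K x - u x)) := by
    have c1 : ∀ K, ContinuousOn (fun x => pu K x - uh K x) (body (𝒯.elem K)) := fun K =>
      ((hpu K).continuous.sub (huh K).continuous).continuousOn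
    have c2 : ∀ K, ContinuousOn (fun x => pu K x - u x) (body (𝒯.elem K)) := fun K =>
      (hpu K).continuous.continuousOn.sub (hu K)
    have s1 := 𝒯.normSq_sub_le c1 c2
    have s2 := 𝒯.normSq_add_le (f := fun K x => interp R (𝒯.elem K) u x - u x)
      (g := fun K x => pu K x - uh K x - (pu K x - u x))
      (fun K => (hui K).continuousOn.sub (hu K)) (fun K => (c1 K).sub (c2 K))
    rw [𝒯.normSq_congr (g := fun K x => interp R (𝒯.elem K) u x - uh K x) fun K x _ => by
      abel] at s2
    change _ ≤ 2 * errInterp R 𝒯 u + _ at s2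
    linarith
  have n1 : 0 ≤ errInterp R 𝒯 (fun x => F (-(q x)) (u x)) := 𝒯.normSq_nonneg _
  have n2 : 0 ≤ errInterp R 𝒯 q := 𝒯.normSq_nonneg _
  have n3 : 0 ≤ errInterp R 𝒯 u := 𝒯.normSq_nonneg _
  have n4 := 𝒯.normSq_nonneg (fun K x => pq K x - q x)
  have n5 := 𝒯.normSq_nonneg (fun K x => pu K x - u x)
  have n6 := 𝒯.normSq_nonneg (fun K x => pq K x - qh K x)
  have n7 := 𝒯.normSq_nonneg (fun K x => pu K x - uh K x)
  have hD : 0 ≤ C * L ^ 2 := by positivity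
  have h5 := mul_le_mul_of_nonneg_left (add_le_add h3 h4) hD
  nlinarith [mul_nonneg hD n1, mul_nonneg hD n2, mul_nonneg hD n3]

/-! ### The energy of the error in time -/

variable {𝒯 : Mesh d N} {Ω : Set (E d)} {τ : Fin N → Fin (d + 1) → ℝ} {T : ℝ}

/-- The energy of a family of error states whose flux residual and scalar component are
differentiable in time. -/
theorem exists_energy (R : NodalElement d k) (hT : 0 < T) (hτ : ∀ K i, 0 < τ K i)
    {p δ δ' : ℝ → Fin N → E d → E d} {w e : ℝ → Fin N → E d → ℝ} {μ : ℝ → Set (E d) → E d → ℝ}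
    (hσ : ∀ t ∈ Ioc 0 T, IsErrorState k 𝒯 Ω τ (p t) (w t) (μ t) (δ t))
    (hδ : ∀ K, IsC1On T (body (𝒯.elem K)) (fun t => δ t K) (fun t => δ' t K))
    (hwc : ∀ K x, ContinuousOn (fun t => w t K x) (Icc 0 T))
    (hwd : ∀ t ∈ Ioc 0 T, ∀ K x, HasDerivWithinAt (fun t => w t K x) (e t K x) (Icc 0 T) t)
    (he : ∀ t ∈ Ioc 0 T, MemW k (e t)) (hw0 : ∀ K x, w 0 K x = 0) :
    ∃ A : ℝ → ℝ, ContinuousOn A (Icc 0 T) ∧ A 0 ≤ 𝒯.normSq (δ 0) ∧ ∀ t ∈ Ioc 0 T,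
      𝒯.normSq (p t) ≤ A t ∧
      A t = 𝒯.volInt (fun K x => inner ℝ (δ t K x) (p t K x)) +
        ∑ K, fluxRes 𝒯 τ (p t) (w t) (μ t) K (w t K) ∧
      HasDerivWithinAt A (2 * (𝒯.volInt (fun K x => inner ℝ (δ' t K x) (p t K x)) +
        ∑ K, fluxRes 𝒯 τ (p t) (w t) (μ t) K (e t K))) (Icc 0 T) t := by
  classical
  let σ : ℝ → errorStates k 𝒯 Ω τ := fun t =>
    if h : t ∈ Ioc 0 T then ⟨(p t, w t, μ t, δ t), hσ t h⟩ else 0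
  have hσt : ∀ t (h : t ∈ Ioc 0 T), σ t = ⟨(p t, w t, μ t, δ t), hσ t h⟩ := fun t h => dif_pos h
  let c : Coord N R → ℝ → ℝ := Sum.elim
    (fun a t => ∫ x in body (𝒯.elem a.1), nodal (𝒯.elem a.1) R a.2.1 x * δ t a.1 x a.2.2)
    (fun a t => w t a.1 (nodePt (𝒯.elem a.1) R a.2))
  let c' : Coord N R → ℝ → ℝ := Sum.elim
    (fun a t => ∫ x in body (𝒯.elem a.1), nodal (𝒯.elem a.1) R a.2.1 x * δ' t a.1 x a.2.2)
    (fun a t => e t a.1 (nodePt (𝒯.elem a.1) R a.2))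
  have hmom : ∀ K j (m : Fin d), ∀ t ∈ Icc 0 T, HasDerivWithinAt
      (fun t => ∫ x in body (𝒯.elem K), nodal (𝒯.elem K) R j x * δ t K x m)
      (∫ x in body (𝒯.elem K), nodal (𝒯.elem K) R j x * δ' t K x m) (Icc 0 T) t :=
    fun K j m t ht => by
    have h := hasDerivWithinAt_integral_param (isCompact_body (𝒯.elem K)) (ae_mem_body _)
      (((IsC1On.const (T := T) (g := nodal (𝒯.elem K) R j)
        (isPoly_nodal _ R j).continuous.continuousOn).mul ((hδ K).inner (IsC1On.const
          (g := fun _ => EuclideanSpace.single m (1 : ℝ)) continuousOn_const)))) ht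
    simpa [EuclideanSpace.inner_single_right] using h
  obtain ⟨o, hoc, ho, hA⟩ := exists_output_of_symmetric (stateData (𝒯 := 𝒯) (Ω := Ω) (τ := τ) R)
    (stateOutput R) (stateData_symm R) (stateOutput_eq_zero R hτ) (σ := σ) (c := c) (c' := c')
    (T := T)
    (fun t ht a => by
      rw [hσt t ht]
      rcases a with a | a <;> rfl)
    (fun a => by
      rcases a with ⟨K, j, m⟩ | ⟨K, j⟩
      · exact fun t ht => (hmom K j m t ht).continuousWithinAt
      · exact hwc K _)
    (fun t ht a => by
      rcases a with ⟨K, j, m⟩ | ⟨K, j⟩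
      · exact hmom K j m t ⟨ht.1.le, ht.2⟩
      · exact hwd t ht K _)
  have hcc : ∀ a, ContinuousOn (c a) (Icc 0 T) := fun a => by
    rcases a with ⟨K, j, m⟩ | ⟨K, j⟩
    · exact fun t ht => (hmom K j m t ht).continuousWithinAt
    · exact hwc K _
  have hob : ∀ t ∈ Ioc 0 T, ∀ a : Fin N × Fin R.card × Fin d,
      o (Sum.inl a) t = p t a.1 (nodePt (𝒯.elem a.1) R a.2.1) a.2.2 := fun t ht a => by
    rw [← ho t ht, hσt t ht]; rfl
  have hom : ∀ t ∈ Ioc 0 T, ∀ a : Fin N × Fin R.card, o (Sum.inr a) t =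
      fluxRes 𝒯 τ (p t) (w t) (μ t) a.1 (nodal (𝒯.elem a.1) R a.2) := fun t ht a => by
    rw [← ho t ht, hσt t ht]; rfl
  have hS : ∀ t ∈ Ioc 0 T, ∀ v : Fin N → E d → ℝ, MemW k v →
      ∑ a : Fin N × Fin R.card, v a.1 (nodePt (𝒯.elem a.1) R a.2) * o (Sum.inr a) t =
        ∑ K, fluxRes 𝒯 τ (p t) (w t) (μ t) K (v K) := fun t ht v hv => by
    rw [sum_fluxRes_eq_sum R (hσ t ht).mem_V (hσ t ht).mem_W (hσ t ht).mem_M hv]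
    exact Finset.sum_congr rfl fun a _ => by rw [hom t ht]
  have hAt : ∀ t ∈ Ioc 0 T, ∑ a, c a t * o a t =
      𝒯.volInt (fun K x => inner ℝ (δ t K x) (p t K x)) +
        ∑ K, fluxRes 𝒯 τ (p t) (w t) (μ t) K (w t K) := fun t ht => by
    rw [Fintype.sum_sum_type, volInt_inner_eq_sum R (hσ t ht).cont (hσ t ht).mem_V,
      ← hS t ht _ (hσ t ht).mem_W]
    congr 1
    exact Finset.sum_congr rfl fun a _ => by rw [hob t ht]; rfl
  have hPA : ∀ t ∈ Ioc 0 T, 𝒯.normSq (p t) ≤ ∑ a, c a t * o a t := fun t ht => by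
    rw [hAt t ht, (hσ t ht).energy (hσ t ht), ← 𝒯.normSq_eq]
    refine le_add_of_nonneg_right (𝒯.bdryInt_nonneg fun K i x _ => ?_)
    rw [mul_assoc]
    exact mul_nonneg (hτ K i).le (mul_self_nonneg _)
  have hAc : ContinuousOn (fun t => ∑ a, c a t * o a t) (Icc 0 T) :=
    continuousOn_finsetSum _ fun a _ => (hcc a).mul (hoc a)
  refine ⟨fun t => ∑ a, c a t * o a t, hAc, ?_, fun t ht => ⟨hPA t ht, hAt t ht, ?_⟩⟩
  -- Since 2(δ, p) ≤ ‖δ‖² + ‖p‖² ≤ ‖δ‖² + A, the energy is at most ‖δ‖² plus twice the pairing of w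
  -- with the flux moments. At t → 0 that pairing vanishes, because w does and the output stays
  -- continuous.
  · have hle : ∀ t ∈ Ioc 0 T, ∑ a, c a t * o a t ≤ 𝒯.normSq (δ t) +
        2 * ∑ a : Fin N × Fin R.card, c (Sum.inr a) t * o (Sum.inr a) t := fun t ht => by
      have h1 := hAt t ht
      have h2 := hPA t ht
      have h3 := 𝒯.volInt_inner_le one_pos (hσ t ht).cont
        fun K => ((hσ t ht).mem_V K).continuous.continuousOn
      have h4 : ∑ a : Fin N × Fin R.card, c (Sum.inr a) t * o (Sum.inr a) t = _ :=
        hS t ht _ (hσ t ht).mem_W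
      rw [one_mul, inv_one, one_mul] at h3
      rw [h4]
      linarith
    have h0 := le_on_closure (s := Ioc 0 T) hle (by rwa [closure_Ioc hT.ne])
      (by
        rw [closure_Ioc hT.ne]
        exact (𝒯.continuousOn_normSq fun K => (hδ K).cont).add (continuousOn_const.mul
          (continuousOn_finsetSum _ fun a _ => (hcc _).mul (hoc _))))
      (by rw [closure_Ioc hT.ne]; exact left_mem_Icc.2 hT.le)
    have hz : ∑ a : Fin N × Fin R.card, c (Sum.inr a) 0 * o (Sum.inr a) 0 = 0 :=
      Finset.sum_eq_zero fun a _ => by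
        rw [show c (Sum.inr a) 0 = 0 from hw0 _ _, zero_mul]
    rw [hz, mul_zero, add_zero] at h0
    exact h0
  · have h := hA t ht
    rw [Fintype.sum_sum_type] at h
    have hδ't : ∀ K, ContinuousOn (δ' t K) (body (𝒯.elem K)) := fun K =>
      slice_continuousOn (f := fun t => δ' t K) (hδ K).cont' ⟨ht.1.le, ht.2⟩
    rw [volInt_inner_eq_sum R hδ't (hσ t ht).mem_V, ← hS t ht _ (he t ht)]
    convert h using 3
    · exact Finset.sum_congr rfl fun a _ => by rw [hob t ht]; rfl
    · rfl

end

section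

variable {d k N : ℕ} [NeZero d]

/-! ### Preliminaries for the error estimate -/

/-- The projection is a choice governed by a predicate that sees u only on the simplex, so equal
data there give the same choice. This matches u(0) with u₀. -/
theorem hdgProj_congr (S : Simplex d) (τ : Fin (d + 1) → ℝ) (q : E d → E d) {u v : E d → ℝ}
    (h : ∀ x ∈ body S, u x = v x) : hdgProj k S τ q u = hdgProj k S τ q v := by
  have h1 : ∀ w : E d → ℝ, ∫ x in body S, u x * w x = ∫ x in body S, v x * w x := fun w =>
    setIntegral_congr_fun (measurableSet_body S) fun x hx => by simp only [h x hx]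
  have h2 : ∀ i (μ : E d → ℝ), faceInt S i (fun x => (inner ℝ (q x) (normal S i) + τ i * u x) * μ x) =
      faceInt S i (fun x => (inner ℝ (q x) (normal S i) + τ i * v x) * μ x) := fun i μ => by
    rw [faceInt_eq, faceInt_eq]
    refine integral_congr_ae ?_
    filter_upwards [faceMeasure_ae_mem S i] with x hx
    rw [h x (face_subset_body S i hx)]
  unfold hdgProj
  congr 1
  funext p
  refine propext ⟨fun H => ⟨H.poly_q, H.poly_u, H.orth_q, fun w hw => ?_, fun i μ hμ => ?_⟩,
    fun H => ⟨H.poly_q, H.poly_u, H.orth_q, fun w hw => ?_, fun i μ hμ => ?_⟩⟩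
  · rw [← h1]; exact H.orth_u w hw
  · rw [← h2]; exact H.orth_face i μ hμ
  · rw [h1]; exact H.orth_u w hw
  · rw [h2]; exact H.orth_face i μ hμ

theorem IsErrorState.sub {𝒯 : Mesh d N} {Ω : Set (E d)} {τ : Fin N → Fin (d + 1) → ℝ}
    {p p' δ δ' : Fin N → E d → E d} {w w' : Fin N → E d → ℝ} {μ μ' : Set (E d) → E d → ℝ}
    (h : IsErrorState k 𝒯 Ω τ p w μ δ) (h' : IsErrorState k 𝒯 Ω τ p' w' μ' δ') :
    IsErrorState k 𝒯 Ω τ (p - p') (w - w') (μ - μ') (δ - δ') := by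
  simpa [sub_eq_add_neg] using h.add (h'.smul (-1))

theorem fluxRes_sub {𝒯 : Mesh d N} {Ω : Set (E d)} {τ : Fin N → Fin (d + 1) → ℝ}
    {p p' δ δ' : Fin N → E d → E d} {w w' : Fin N → E d → ℝ} {μ μ' : Set (E d) → E d → ℝ}
    (h : IsErrorState k 𝒯 Ω τ p w μ δ) (h' : IsErrorState k 𝒯 Ω τ p' w' μ' δ')
    (K : Fin N) {v : E d → ℝ} (hv : IsPoly k v) :
    fluxRes 𝒯 τ (p - p') (w - w') (μ - μ') K v =
      fluxRes 𝒯 τ p w μ K v - fluxRes 𝒯 τ p' w' μ' K v := by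
  have h1 := fluxRes_add h (h'.smul (-1)) K hv
  rw [fluxRes_smul] at h1
  simpa [sub_eq_add_neg] using h1

theorem sum_fluxRes (𝒯 : Mesh d N) (τ : Fin N → Fin (d + 1) → ℝ) (p : Fin N → E d → E d)
    (w v : Fin N → E d → ℝ) (μ : Set (E d) → E d → ℝ) :
    ∑ K, fluxRes 𝒯 τ p w μ K (v K) =
      𝒯.bdryInt (fun K i x => numFlux 𝒯 τ p w μ K i x * v K x) -
        𝒯.volInt (fun K x => inner ℝ (p K x) (gradient (v K) x)) := by
  simp only [fluxRes, Finset.sum_sub_distrib]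
  rfl

/-- A square integrable function on `Ω` is integrable on the elements. -/
theorem Mesh.Partitions.integrableOn_body {𝒯 : Mesh d N} {Ω : Set (E d)} (h : 𝒯.Partitions Ω)
    {f : E d → ℝ} (hf : MemLp f 2 (volume.restrict Ω)) (K : Fin N) :
    IntegrableOn f (body (𝒯.elem K)) := by
  have hμ : volume.restrict (body (𝒯.elem K)) ≤ volume.restrict Ω := by
    rw [← Measure.restrict_congr_set (interior_body_ae_eq (𝒯.elem K))]
    exact Measure.restrict_mono (h.interior_body_subset K) le_rfl
  exact (hf.mono_measure hμ).integrable one_le_two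

section Polynomials

variable (R : NodalElement d k) {T : ℝ} {𝒯 : Mesh d N}

theorem continuousOn_interp (S : Simplex d) {V : Type} [NormedAddCommGroup V] [NormedSpace ℝ V]
    {g : ℝ → E d → V}
    (hg : ContinuousOn (fun p : ℝ × E d => g p.1 p.2) (Icc 0 T ×ˢ body S)) :
    ContinuousOn (fun p : ℝ × E d => interp R S (g p.1) p.2) (Icc 0 T ×ˢ body S) := by
  simp only [interp_eq]
  refine continuousOn_finsetSum _ fun j _ =>
    ((isPoly_nodal S R j).continuous.comp continuous_snd).continuousOn.smul ?_
  exact hg.comp (f := fun p : ℝ × E d => (p.1, nodePt S R j)) (by fun_prop)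
    fun p hp => ⟨hp.1, nodePt_mem S R j⟩

theorem continuousOn_errInterp {V : Type} [NormedAddCommGroup V] [NormedSpace ℝ V]
    {g : ℝ → E d → V}
    (hg : ∀ K, ContinuousOn (fun p : ℝ × E d => g p.1 p.2) (Icc 0 T ×ˢ body (𝒯.elem K))) :
    ContinuousOn (fun t => errInterp R 𝒯 (g t)) (Icc 0 T) :=
  𝒯.continuousOn_normSq (f := fun t K x => interp R (𝒯.elem K) (g t) x - g t x) fun K =>
    (continuousOn_interp R _ (hg K)).sub (hg K)

/-- The time derivative of a family of polynomials is a polynomial. -/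
theorem isPoly_derivWithin (R : NodalElement d k) {v : ℝ → E d → ℝ} (S : Simplex d) (hv : ∀ t ∈ Icc 0 T, IsPoly k (v t))
    {t : ℝ} (ht : t ∈ Icc 0 T)
    (hd : ∀ x, DifferentiableWithinAt ℝ (fun s => v s x) (Icc 0 T) t) :
    IsPoly k (fun x => derivWithin (fun s => v s x) (Icc 0 T) t) := by
  have h : (fun x => derivWithin (fun s => v s x) (Icc 0 T) t) = ∑ j,
      derivWithin (fun s => v s (nodePt S R j)) (Icc 0 T) t • nodal S R j := by
    funext x
    rw [derivWithin_congr (f := fun s => ∑ j, v s (nodePt S R j) * nodal S R j x)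
      (fun s hs => (hv s hs).eq_sum_nodal S R x) ((hv t ht).eq_sum_nodal S R x),
      derivWithin_fun_sum fun j _ => (hd _).mul_const _, Finset.sum_apply]
    exact Finset.sum_congr rfl fun j _ => derivWithin_mul_const (hd _) _
  rw [h]
  exact IsPoly.sum fun j _ => (isPoly_nodal S R j).smul _

/-- Reduces the broken inner product of polynomials to finitely many nodal values, so that pointwise
regularity in time is enough to differentiate it. -/
theorem volInt_mul_eq_sum {v w : Fin N → E d → ℝ} (hv : MemW k v) (hw : MemW k w) :
    𝒯.volInt (fun K x => v K x * w K x) = ∑ K, ∑ a : Fin R.card × Fin R.card,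
      v K (nodePt (𝒯.elem K) R a.1) * w K (nodePt (𝒯.elem K) R a.2) *
        ∫ x in body (𝒯.elem K), nodal (𝒯.elem K) R a.1 x * nodal (𝒯.elem K) R a.2 x := by
  refine Finset.sum_congr rfl fun K _ => ?_
  have hexp : ∀ x, v K x * w K x = ∑ a : Fin R.card × Fin R.card,
      v K (nodePt (𝒯.elem K) R a.1) * w K (nodePt (𝒯.elem K) R a.2) *
        (nodal (𝒯.elem K) R a.1 x * nodal (𝒯.elem K) R a.2 x) := fun x => by
    rw [(hv K).eq_sum_nodal (𝒯.elem K) R x, (hw K).eq_sum_nodal (𝒯.elem K) R x,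
      Finset.sum_mul_sum, Fintype.sum_prod_type]
    exact Finset.sum_congr rfl fun i _ => Finset.sum_congr rfl fun j _ => by ring
  simp only [hexp]
  rw [integral_finsetSum _ fun a _ => integrableOn_body _ (((isPoly_nodal _ R a.1).continuous.mul
    (isPoly_nodal _ R a.2).continuous).const_mul _).continuousOn]
  exact Finset.sum_congr rfl fun a _ => integral_const_mul _ _

variable {w e : ℝ → Fin N → E d → ℝ} (hw : ∀ t ∈ Icc 0 T, MemW k (w t))

include R hw

theorem continuousOn_normSq_poly (hwc : ∀ K x, ContinuousOn (fun t => w t K x) (Icc 0 T)) :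
    ContinuousOn (fun t => 𝒯.normSq (w t)) (Icc 0 T) := by
  have h : ∀ t ∈ Icc 0 T, 𝒯.normSq (w t) = _ := fun t ht =>
    (by simp [Mesh.normSq, sq] : 𝒯.normSq (w t) = 𝒯.volInt fun K x => w t K x * w t K x).trans
      (volInt_mul_eq_sum R (hw t ht) (hw t ht))
  refine ContinuousOn.congr ?_ h
  exact continuousOn_finsetSum _ fun K _ => continuousOn_finsetSum _ fun a _ =>
    ((hwc K _).mul (hwc K _)).mul continuousOn_const

theorem hasDerivWithinAt_normSq_poly {t : ℝ} (ht : t ∈ Icc 0 T) (he : MemW k (e t))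
    (hwd : ∀ K x, HasDerivWithinAt (fun t => w t K x) (e t K x) (Icc 0 T) t) :
    HasDerivWithinAt (fun t => 𝒯.normSq (w t)) (2 * 𝒯.volInt (fun K x => e t K x * w t K x))
      (Icc 0 T) t := by
  have h : ∀ t ∈ Icc 0 T, 𝒯.normSq (w t) = _ := fun t ht =>
    (by simp [Mesh.normSq, sq] : 𝒯.normSq (w t) = 𝒯.volInt fun K x => w t K x * w t K x).trans
      (volInt_mul_eq_sum R (hw t ht) (hw t ht))
  have hd : HasDerivWithinAt (fun t => ∑ K, ∑ a : Fin R.card × Fin R.card,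
      w t K (nodePt (𝒯.elem K) R a.1) * w t K (nodePt (𝒯.elem K) R a.2) *
        ∫ x in body (𝒯.elem K), nodal (𝒯.elem K) R a.1 x * nodal (𝒯.elem K) R a.2 x)
      (∑ K, ∑ a : Fin R.card × Fin R.card,
        (e t K (nodePt (𝒯.elem K) R a.1) * w t K (nodePt (𝒯.elem K) R a.2) +
          w t K (nodePt (𝒯.elem K) R a.1) * e t K (nodePt (𝒯.elem K) R a.2)) *
        ∫ x in body (𝒯.elem K), nodal (𝒯.elem K) R a.1 x * nodal (𝒯.elem K) R a.2 x)
      (Icc 0 T) t :=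
    HasDerivWithinAt.fun_sum fun K _ => HasDerivWithinAt.fun_sum fun a _ =>
      ((hwd K _).mul (hwd K _)).mul_const _
  refine (hd.congr h (h t ht)).congr_deriv ?_
  simp only [add_mul, Finset.sum_add_distrib]
  rw [← volInt_mul_eq_sum R he (hw t ht), ← volInt_mul_eq_sum R (hw t ht) he, two_mul]
  congr 1
  exact 𝒯.volInt_congr fun K x _ => mul_comm _ _

end Polynomials

/-- Young's inequality for the broken inner product of scalar functions. -/
theorem Mesh.abs_volInt_mul_le (𝒯 : Mesh d N) {f g : Fin N → E d → ℝ} {ε : ℝ} (hε : 0 < ε)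
    (hf : ∀ K, ContinuousOn (f K) (body (𝒯.elem K)))
    (hg : ∀ K, ContinuousOn (g K) (body (𝒯.elem K))) :
    2 * |𝒯.volInt (fun K x => f K x * g K x)| ≤ ε * 𝒯.normSq f + ε⁻¹ * 𝒯.normSq g := by
  have h1 := 𝒯.volInt_inner_le hε hf hg
  have h2 := 𝒯.volInt_inner_le hε (fun K => (hf K).neg) hg
  have e1 : 𝒯.volInt (fun K x => inner ℝ (f K x) (g K x)) = 𝒯.volInt fun K x => f K x * g K x :=
    𝒯.volInt_congr fun K x _ => by simp [mul_comm]
  have e2 : 𝒯.volInt (fun K x => inner ℝ ((-f K) x) (g K x)) =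
      -𝒯.volInt fun K x => f K x * g K x := by
    rw [← neg_one_mul, ← 𝒯.volInt_const_mul]
    exact 𝒯.volInt_congr fun K x _ => by simp [mul_comm]
  rw [e1] at h1
  rw [e2, show 𝒯.normSq (fun K => -f K) = 𝒯.normSq f from 𝒯.normSq_neg f] at h2
  rcases abs_cases (𝒯.volInt fun K x => f K x * g K x) with h | h <;> linarith [h.1]

/-- Growth bounds for the scalar error and the energy, from the energy identities. -/
theorem energy_rates {C G D P A Y N₂ r δ₂ e₂ M₂ dp d'p mw me ew Y' A' : ℝ} (hC : 0 < C)
    (hG : 0 ≤ G) (hD : 0 ≤ D) (hP : 0 ≤ P) (hY : 0 ≤ Y) (hPA : P ≤ A)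
    (hN : N₂ ≤ C * (G + P + Y)) (hM : M₂ ≤ 2 * N₂ + 2 * r) (hr0 : 0 ≤ r) (hrG : r + δ₂ ≤ G)
    (hδ0 : 0 ≤ δ₂) (hdp : 2 * dp ≤ 2 * δ₂ + 2⁻¹ * P) (hd'p : 2 * d'p ≤ D + P)
    (hmw : 2 * |mw| ≤ (4 * C)⁻¹ * M₂ + 4 * C * Y) (hme : 2 * |me| ≤ 2⁻¹ * M₂ + 2 * e₂)
    (hA : A = dp - mw - ew) (hY' : Y' = 2 * ew) (hA' : A' = 2 * (d'p - me - e₂)) :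
    Y' ≤ (3 + C⁻¹ + 4 * C) * (G + Y) ∧
      A' + Y' ≤ (5 + C⁻¹ + 5 * C) * (G + D + (A + Y)) := by
  have hCi : 0 < C⁻¹ := inv_pos.2 hC
  -- The weight 1/(4C) leaves only half of P from the nonlinear term. The other half comes from the
  -- pairing of δ and p.
  have h1 : (4 * C)⁻¹ * M₂ ≤ 2⁻¹ * (G + P + Y) + C⁻¹ * r := by
    have : (4 * C)⁻¹ * M₂ ≤ (4 * C)⁻¹ * (2 * (C * (G + P + Y)) + 2 * r) :=
      mul_le_mul_of_nonneg_left (by linarith) (by positivity)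
    refine this.trans ?_
    have e : (4 * C)⁻¹ * (2 * (C * (G + P + Y)) + 2 * r) = 2⁻¹ * (G + P + Y) + 2⁻¹ * (C⁻¹ * r) := by
      field_simp; ring
    rw [e]
    nlinarith [mul_nonneg hCi.le hr0]
  have h2 := neg_abs_le mw
  have h3 := neg_abs_le me
  have h4 : C⁻¹ * r ≤ C⁻¹ * G := mul_le_mul_of_nonneg_left (by linarith) hCi.le
  have n1 := mul_nonneg hC.le hG
  have n2 := mul_nonneg hC.le hY
  have n3 := mul_nonneg hCi.le hG
  have n4 := mul_nonneg hCi.le hY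
  have n5 := mul_nonneg hC.le (hP.trans hPA)
  have n6 := mul_nonneg hCi.le (hP.trans hPA)
  have n7 := mul_nonneg hC.le hD
  have n8 := mul_nonneg hCi.le hD
  have n9 := mul_le_mul_of_nonneg_left hPA hC.le
  -- Solving the energy identity for `ew` gives Y' = 2 dp - 2 mw - 2A. The two halves of P add up to
  -- P ≤ A and are absorbed by -2A.
  have hYb : Y' ≤ (3 + C⁻¹ + 4 * C) * (G + Y) := by nlinarith
  refine ⟨hYb, ?_⟩
  -- The term 2 e₂ from Young's inequality for `me` cancels the dissipation -2 e₂.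
  have hAb : A' ≤ D + P + C * (G + P + Y) + r := by linarith
  nlinarith

end

section

/-! ### The energy estimate -/

section Estimate

variable {d k N : ℕ} [NeZero d] {R : NodalElement d k} {L T : ℝ} {𝒯 : Mesh d N} {Ω : Set (E d)}
  {τ : Fin N → Fin (d + 1) → ℝ} {F : E d → ℝ → ℝ} {f : ℝ → E d → ℝ} {u₀ : E d → ℝ}
  {u ut : ℝ → E d → ℝ} {q qt : ℝ → E d → E d}
  {qh : ℝ → Fin N → E d → E d} {uh : ℝ → Fin N → E d → ℝ} {uhat : ℝ → Set (E d) → E d → ℝ}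

/-- The errors on the right-hand side of the estimate for the scalar variable. -/
abbrev totalErr (R : NodalElement d k) (𝒯 : Mesh d N) (τ : Fin N → Fin (d + 1) → ℝ)
    (F : E d → ℝ → ℝ) (u ut : E d → ℝ) (q qt : E d → E d) : ℝ :=
  errInterp R 𝒯 (fun x => F (-(q x)) (u x)) + errProjW k 𝒯 τ qt ut + errProjV k 𝒯 τ q u +
    errProjW k 𝒯 τ q u + errInterp R 𝒯 q + errInterp R 𝒯 u

theorem totalErr_nonneg (u ut : E d → ℝ) (q qt : E d → E d) :
    0 ≤ totalErr R 𝒯 τ F u ut q qt := by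
  have n1 : 0 ≤ errInterp R 𝒯 (fun x => F (-(q x)) (u x)) := 𝒯.normSq_nonneg _
  have n2 : 0 ≤ errInterp R 𝒯 q := 𝒯.normSq_nonneg _
  have n3 : 0 ≤ errInterp R 𝒯 u := 𝒯.normSq_nonneg _
  have n4 : 0 ≤ errProjW k 𝒯 τ qt ut := 𝒯.normSq_nonneg _
  have n5 : 0 ≤ errProjW k 𝒯 τ q u := 𝒯.normSq_nonneg _
  have n6 : 0 ≤ errProjV k 𝒯 τ q u := 𝒯.normSq_nonneg _
  unfold totalErr
  linarith

theorem IsExactSolution.isC1On_u (hE : IsExactSolution Ω F f u₀ T u ut q qt)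
    (h𝒯 : 𝒯.Partitions Ω) (K : Fin N) : IsC1On T (body (𝒯.elem K)) u ut :=
  (⟨hE.cont_u, hE.cont_ut, hE.deriv_u⟩ : IsC1On T (closure Ω) u ut).mono
    (h𝒯.body_subset_closure K)

theorem IsExactSolution.isC1On_q (hE : IsExactSolution Ω F f u₀ T u ut q qt)
    (h𝒯 : 𝒯.Partitions Ω) (K : Fin N) : IsC1On T (body (𝒯.elem K)) q qt :=
  (⟨hE.cont_q, hE.cont_qt, hE.deriv_q⟩ : IsC1On T (closure Ω) q qt).mono
    (h𝒯.body_subset_closure K)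

theorem IsExactSolution.isC1On_errV (hE : IsExactSolution Ω F f u₀ T u ut q qt)
    (h𝒯 : 𝒯.Partitions Ω) (R : NodalElement d k) (hτ : ∀ K i, 0 < τ K i) (K : Fin N) :
    IsC1On T (body (𝒯.elem K)) (fun t x => projV k 𝒯 τ (q t) (u t) K x - q t x)
      (fun t x => projV k 𝒯 τ (qt t) (ut t) K x - qt t x) :=
  ((isC1On_hdgProj_fst _ R (hτ K) (hE.isC1On_u h𝒯 K) (hE.isC1On_q h𝒯 K)).mono
    (subset_univ _)).sub (hE.isC1On_q h𝒯 K)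

theorem IsExactSolution.isC1On_errW (hE : IsExactSolution Ω F f u₀ T u ut q qt)
    (h𝒯 : 𝒯.Partitions Ω) (R : NodalElement d k) (hτ : ∀ K i, 0 < τ K i) (K : Fin N) :
    IsC1On T (body (𝒯.elem K)) (fun t x => projW k 𝒯 τ (q t) (u t) K x - u t x)
      (fun t x => projW k 𝒯 τ (qt t) (ut t) K x - ut t x) :=
  ((isC1On_hdgProj_snd _ R (hτ K) (hE.isC1On_u h𝒯 K) (hE.isC1On_q h𝒯 K)).mono
    (subset_univ _)).sub (hE.isC1On_u h𝒯 K)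

theorem IsExactSolution.continuousOn_totalErr (hE : IsExactSolution Ω F f u₀ T u ut q qt)
    (h𝒯 : 𝒯.Partitions Ω) (R : NodalElement d k) (hτ : ∀ K i, 0 < τ K i)
    (hF : Continuous fun z : E d × ℝ => F z.1 z.2) :
    ContinuousOn (fun t => totalErr R 𝒯 τ F (u t) (ut t) (q t) (qt t)) (Icc 0 T) := by
  have h1 := continuousOn_errInterp R (𝒯 := 𝒯) (g := fun t x => F (-(q t x)) (u t x))
    fun K => hF.comp_continuousOn
      ((hE.isC1On_q h𝒯 K).cont.neg.prodMk (hE.isC1On_u h𝒯 K).cont)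
  have h2 := continuousOn_errInterp R (𝒯 := 𝒯) fun K => (hE.isC1On_q h𝒯 K).cont
  have h3 := continuousOn_errInterp R (𝒯 := 𝒯) fun K => (hE.isC1On_u h𝒯 K).cont
  have h4 := 𝒯.continuousOn_normSq
    (f := fun t K x => projV k 𝒯 τ (q t) (u t) K x - q t x) fun K => (hE.isC1On_errV h𝒯 R hτ K).cont
  have h5 := 𝒯.continuousOn_normSq
    (f := fun t K x => projW k 𝒯 τ (q t) (u t) K x - u t x) fun K => (hE.isC1On_errW h𝒯 R hτ K).cont
  have h6 := 𝒯.continuousOn_normSq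
    (f := fun t K x => projW k 𝒯 τ (qt t) (ut t) K x - ut t x) fun K => (hE.isC1On_errW h𝒯 R hτ K).cont'
  exact ((((h1.add h6).add h4).add h5).add h2).add h3

/-- The energy argument: the discrete error of the scalar variable, and an energy that controls
the discrete error of the flux, grow at a rate bounded by the projection and interpolation
errors. -/
theorem exists_energy_estimate (R : NodalElement d k) (L : ℝ) : ∃ C : ℝ, 0 < C ∧
    ∀ (N : ℕ) (𝒯 : Mesh d N) (Ω : Set (E d)) (τ : Fin N → Fin (d + 1) → ℝ)
      (F : E d → ℝ → ℝ) (f : ℝ → E d → ℝ) (u₀ : E d → ℝ)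
      (u ut : ℝ → E d → ℝ) (q qt : ℝ → E d → E d)
      (qh : ℝ → Fin N → E d → E d) (uh : ℝ → Fin N → E d → ℝ)
      (uhat : ℝ → Set (E d) → E d → ℝ) (T : ℝ), 0 < T →
      𝒯.Partitions Ω → (∀ K i, 0 < τ K i) →
      (∀ p r v w, |F p v - F r w| ≤ L * (‖p - r‖ + |v - w|)) →
      IsExactSolution Ω F f u₀ T u ut q qt →
      IsInterpolatoryHDGSolution R 𝒯 Ω τ F f T
        (fun K => (hdgProj k (𝒯.elem K) (τ K) (q 0) u₀).2) qh uh uhat →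
      ∃ A Y A' Y' : ℝ → ℝ, ContinuousOn A (Icc 0 T) ∧ ContinuousOn Y (Icc 0 T) ∧
        A 0 ≤ errProjV k 𝒯 τ (q 0) (u 0) ∧ Y 0 = 0 ∧ ∀ t ∈ Ioc 0 T,
          𝒯.normSq (fun K x => projV k 𝒯 τ (q t) (u t) K x - qh t K x) ≤ A t ∧
          𝒯.normSq (fun K x => projW k 𝒯 τ (q t) (u t) K x - uh t K x) = Y t ∧
          HasDerivWithinAt A (A' t) (Icc 0 T) t ∧ HasDerivWithinAt Y (Y' t) (Icc 0 T) t ∧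
          Y' t ≤ C * (totalErr R 𝒯 τ F (u t) (ut t) (q t) (qt t) + Y t) ∧
          A' t + Y' t ≤ C * (totalErr R 𝒯 τ F (u t) (ut t) (q t) (qt t) +
            errProjV k 𝒯 τ (qt t) (ut t) + (A t + Y t)) := by
  obtain ⟨C, hC, hnl⟩ := exists_nonlinear_bound R L
  refine ⟨5 + C⁻¹ + 5 * C, by positivity, ?_⟩
  intro N 𝒯 Ω τ F f u₀ u ut q qt qh uh uhat T hT h𝒯 hτ hF hE hS
  have hFc := continuous_of_lipschitz hF
  have hIcc : ∀ {t}, t ∈ Ioc 0 T → t ∈ Icc 0 T := fun h => ⟨h.1.le, h.2⟩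
  have hδ := hE.isC1On_errV h𝒯 R hτ
  have hη := hE.isC1On_errW h𝒯 R hτ
  have hPW : ∀ K, IsC1On T univ (fun t => projW k 𝒯 τ (q t) (u t) K)
      (fun t => projW k 𝒯 τ (qt t) (ut t) K) := fun K =>
    isC1On_hdgProj_snd _ R (hτ K) (hE.isC1On_u h𝒯 K) (hE.isC1On_q h𝒯 K)
  have hqc : ∀ t ∈ Icc 0 T, ContinuousOn (q t) (closure Ω) := fun t ht =>
    slice_continuousOn hE.cont_q ht
  have huc : ∀ t ∈ Icc 0 T, ContinuousOn (u t) (closure Ω) := fun t ht =>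
    slice_continuousOn hE.cont_u ht
  have hspec : ∀ t ∈ Icc 0 T, ∀ K, IsHDGProjection k (𝒯.elem K) (τ K) (q t) (u t)
      (projV k 𝒯 τ (q t) (u t) K) (projW k 𝒯 τ (q t) (u t) K) := fun t ht =>
    projection_spec h𝒯 hτ (hqc t ht) (huc t ht)
  have hspec' : ∀ t ∈ Icc 0 T, ∀ K, IsHDGProjection k (𝒯.elem K) (τ K) (qt t) (ut t)
      (projV k 𝒯 τ (qt t) (ut t) K) (projW k 𝒯 τ (qt t) (ut t) K) := fun t ht =>
    projection_spec h𝒯 hτ (slice_continuousOn hE.cont_qt ht) (slice_continuousOn hE.cont_ut ht)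
  -- `w` is the discrete scalar error and `e` its time derivative, since the projection commutes
  -- with differentiation in time.
  let dh : ℝ → Fin N → E d → ℝ := fun t K x => derivWithin (fun s => uh s K x) (Icc 0 T) t
  let w : ℝ → Fin N → E d → ℝ := fun t K x => projW k 𝒯 τ (q t) (u t) K x - uh t K x
  let e : ℝ → Fin N → E d → ℝ := fun t K x => projW k 𝒯 τ (qt t) (ut t) K x - dh t K x
  have hdh : ∀ t ∈ Ioc 0 T, MemW k (dh t) := fun t ht K =>
    isPoly_derivWithin R (𝒯.elem K) (v := fun s => uh s K) (fun s hs => hS.mem_W s hs K) (hIcc ht)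
      fun x => hS.diff t ht K x
  have hwm : ∀ t ∈ Icc 0 T, MemW k (w t) := fun t ht K => (hspec t ht K).poly_u.sub (hS.mem_W t ht K)
  have hem : ∀ t ∈ Ioc 0 T, MemW k (e t) := fun t ht K =>
    (hspec' t (hIcc ht) K).poly_u.sub (hdh t ht K)
  have hwc : ∀ K x, ContinuousOn (fun t => w t K x) (Icc 0 T) := fun K x =>
    ContinuousOn.sub (fun t ht => ((hPW K).deriv t ht x (mem_univ x)).continuousWithinAt)
      (hS.cont K x)
  have hwd : ∀ t ∈ Ioc 0 T, ∀ K x, HasDerivWithinAt (fun t => w t K x) (e t K x) (Icc 0 T) t :=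
    fun t ht K x => ((hPW K).deriv t (hIcc ht) x (mem_univ x)).sub
      (hS.diff t ht K x).hasDerivWithinAt
  have hw0 : ∀ K x, w 0 K x = 0 := fun K x => by
    have h0 : hdgProj k (𝒯.elem K) (τ K) (q 0) (u 0) = hdgProj k (𝒯.elem K) (τ K) (q 0) u₀ :=
      hdgProj_congr _ _ _ fun x hx => hE.initial x (h𝒯.body_subset_closure K hx)
    change (hdgProj k (𝒯.elem K) (τ K) (q 0) (u 0)).2 x - uh 0 K x = 0
    rw [hS.initial, h0, sub_self]
  have hsp : ∀ t ∈ Ioc 0 T, IsErrorState k 𝒯 Ω τ (projV k 𝒯 τ (q t) (u t))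
      (projW k 𝒯 τ (q t) (u t)) (traceProj k Ω (u t))
      (fun K x => projV k 𝒯 τ (q t) (u t) K x - q t x) := fun t ht =>
    isErrorState_proj h𝒯 hτ (hqc t (hIcc ht)) (huc t (hIcc ht)) (hE.flux t ht) (hE.boundary t ht)
  have hsd : ∀ t ∈ Ioc 0 T, IsErrorState k 𝒯 Ω τ (qh t) (uh t) (uhat t) 0 := fun t ht =>
    isErrorState_discrete (hS.mem_V t ht) (hS.mem_W t (hIcc ht)) (hS.mem_M t ht)
      (hS.eq_flux t ht) (hS.eq_trace t ht)
  have hσ : ∀ t ∈ Ioc 0 T, IsErrorState k 𝒯 Ω τ (projV k 𝒯 τ (q t) (u t) - qh t) (w t)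
      (traceProj k Ω (u t) - uhat t) (fun K x => projV k 𝒯 τ (q t) (u t) K x - q t x) :=
    fun t ht => by
      have h := (hsp t ht).sub (hsd t ht)
      rwa [sub_zero] at h
  obtain ⟨A, hAc, hA0, hA⟩ := exists_energy R hT hτ hσ hδ hwc hwd hem hw0
  refine ⟨A, fun t => 𝒯.normSq (w t), _, fun t => 2 * 𝒯.volInt (fun K x => e t K x * w t K x), hAc,
    continuousOn_normSq_poly R hwm hwc, hA0, ?_, fun t ht => ⟨(hA t ht).1, rfl, (hA t ht).2.2,
      hasDerivWithinAt_normSq_poly R hwm (hIcc ht) (hem t ht) (hwd t ht), ?_⟩⟩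
  · simp [Mesh.normSq, Mesh.volInt, hw0]
  have ht' := hIcc ht
  have hqK : ∀ K, ContinuousOn (q t) (body (𝒯.elem K)) := fun K =>
    (hqc t ht').mono (h𝒯.body_subset_closure K)
  have huK : ∀ K, ContinuousOn (u t) (body (𝒯.elem K)) := fun K =>
    (huc t ht').mono (h𝒯.body_subset_closure K)
  have hutK : ∀ K, ContinuousOn (ut t) (body (𝒯.elem K)) := fun K =>
    slice_continuousOn (hE.isC1On_u h𝒯 K).cont' ht'
  have hFK : ∀ K, ContinuousOn (fun x => F (-(q t x)) (u t x)) (body (𝒯.elem K)) := fun K =>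
    hFc.comp_continuousOn ((hqK K).neg.prodMk (huK K))
  let Fh : Fin N → E d → ℝ := fun K =>
    interp R (𝒯.elem K) (fun y => F (-(qh t K y)) (uh t K y))
  have hFh : MemW k Fh := fun K => isPoly_interp _ R _
  let ρ : Fin N → E d → ℝ := fun K x => projW k 𝒯 τ (qt t) (ut t) K x - ut t x
  have hρc : ∀ K, ContinuousOn (ρ K) (body (𝒯.elem K)) := fun K =>
    (hspec' t ht' K).poly_u.continuous.continuousOn.sub (hutK K)
  let Nl : Fin N → E d → ℝ := fun K x => F (-(q t x)) (u t x) - Fh K x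
  have hNc : ∀ K, ContinuousOn (Nl K) (body (𝒯.elem K)) := fun K =>
    (hFK K).sub (hFh K).continuous.continuousOn
  -- The consistency defect in the scalar error equation: the nonlinear difference minus the
  -- projection error of u_t.
  let M : Fin N → E d → ℝ := fun K x => Nl K x - ρ K x
  have hMc : ∀ K, ContinuousOn (M K) (body (𝒯.elem K)) := fun K => (hNc K).sub (hρc K)
  have hfi : ∀ K, IntegrableOn (f t) (body (𝒯.elem K)) := h𝒯.integrableOn_body (hE.source t ht)
  have hgi : ∀ K, IntegrableOn (fun x => f t x - ut t x - F (-(q t x)) (u t x))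
      (body (𝒯.elem K)) := fun K =>
    ((hfi K).sub (integrableOn_body _ (hutK K))).sub (integrableOn_body _ (hFK K))
  -- The scalar error equation, from subtracting the discrete equation from the projected exact one.
  -- The source f cancels.
  have hscal : ∀ v, MemW k v → ∑ K, fluxRes 𝒯 τ (projV k 𝒯 τ (q t) (u t) - qh t) (w t)
      (traceProj k Ω (u t) - uhat t) K (v K) =
      -𝒯.volInt (fun K x => M K x * v K x) - 𝒯.volInt (fun K x => e t K x * v K x) := by
    intro v hv
    have h1 : ∑ K, fluxRes 𝒯 τ (projV k 𝒯 τ (q t) (u t) - qh t) (w t)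
        (traceProj k Ω (u t) - uhat t) K (v K) =
        ∑ K, fluxRes 𝒯 τ (projV k 𝒯 τ (q t) (u t)) (projW k 𝒯 τ (q t) (u t))
          (traceProj k Ω (u t)) K (v K) - ∑ K, fluxRes 𝒯 τ (qh t) (uh t) (uhat t) K (v K) := by
      rw [← Finset.sum_sub_distrib]
      exact Finset.sum_congr rfl fun K _ => fluxRes_sub (hsp t ht) (hsd t ht) K (hv K)
    have h2 := volInt_add_fluxRes_proj h𝒯 hτ (hqc t ht') (huc t ht') (hE.equation t ht) hgi
      (hE.boundary t ht) hv
    have h3 := hS.eq_scalar t ht v hv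
    have h4 := sum_fluxRes 𝒯 τ (qh t) (uh t) v (uhat t)
    have iv : ∀ {g : Fin N → E d → ℝ}, (∀ K, IntegrableOn (g K) (body (𝒯.elem K))) →
        ∀ K, IntegrableOn (fun x => g K x * v K x) (body (𝒯.elem K)) := fun hg K =>
      (hg K).mul_continuousOn (hv K).continuous.continuousOn (isCompact_body _)
    have iM := iv fun K => integrableOn_body _ (hMc K)
    have ie := iv fun K => integrableOn_body _ (hem t ht K).continuous.continuousOn
    have id := iv fun K => integrableOn_body _ (hdh t ht K).continuous.continuousOn
    have iF := iv fun K => integrableOn_body _ (hFh K).continuous.continuousOn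
    have i_f := iv (g := fun _ => f t) hfi
    have ig := iv (g := fun _ x => f t x - ut t x - F (-(q t x)) (u t x)) hgi
    have h5 : 𝒯.volInt (fun K x => (f t x - ut t x - F (-(q t x)) (u t x)) * v K x) +
        𝒯.volInt (fun K x => M K x * v K x) + 𝒯.volInt (fun K x => e t K x * v K x) +
        𝒯.volInt (fun K x => dh t K x * v K x) + 𝒯.volInt (fun K x => Fh K x * v K x) =
        𝒯.volInt (fun K x => f t x * v K x) := by
      rw [← 𝒯.volInt_add ig iM,
        ← 𝒯.volInt_add (f := fun K x => (f t x - ut t x - F (-(q t x)) (u t x)) * v K x +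
          M K x * v K x) (fun K => (ig K).add (iM K)) ie,
        ← 𝒯.volInt_add (f := fun K x => (f t x - ut t x - F (-(q t x)) (u t x)) * v K x +
          M K x * v K x + e t K x * v K x) (fun K => ((ig K).add (iM K)).add (ie K)) id,
        ← 𝒯.volInt_add (f := fun K x => (f t x - ut t x - F (-(q t x)) (u t x)) * v K x +
          M K x * v K x + e t K x * v K x + dh t K x * v K x)
          (fun K => (((ig K).add (iM K)).add (ie K)).add (id K)) iF]
      refine 𝒯.volInt_congr fun K x _ => ?_
      simp only [M, Nl, ρ, e]
      ring
    change 𝒯.volInt (fun K x => dh t K x * v K x) - _ + _ +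
      𝒯.volInt (fun K x => Fh K x * v K x) = _ at h3
    linarith
  obtain ⟨hPA, hAe, -⟩ := hA t ht
  have hδt : ∀ K, ContinuousOn (fun x => projV k 𝒯 τ (q t) (u t) K x - q t x)
    (body (𝒯.elem K)) := (hσ t ht).cont
  have hδt' : ∀ K, ContinuousOn (fun x => projV k 𝒯 τ (qt t) (ut t) K x - qt t x)
    (body (𝒯.elem K)) := fun K => slice_continuousOn
      (f := fun t x => projV k 𝒯 τ (qt t) (ut t) K x - qt t x) (hδ K).cont' ht'
  have hpc : ∀ K, ContinuousOn ((projV k 𝒯 τ (q t) (u t) - qh t) K) (body (𝒯.elem K)) := fun K =>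
    ((hσ t ht).mem_V K).continuous.continuousOn
  have hdp := 𝒯.volInt_inner_le two_pos hδt hpc
  have hd'p := 𝒯.volInt_inner_le one_pos hδt' hpc
  have hec : ∀ K, ContinuousOn (e t K) (body (𝒯.elem K)) := fun K =>
    (hem t ht K).continuous.continuousOn
  have hwtc : ∀ K, ContinuousOn (w t K) (body (𝒯.elem K)) := fun K =>
    (hwm t ht' K).continuous.continuousOn
  -- The Young weights are those that `energy_rates` needs for the absorption: 1/(4C) against w and
  -- 1/2 against w_t.
  have hmw := 𝒯.abs_volInt_mul_le (ε := (4 * C)⁻¹) (by positivity) hMc hwtc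
  have hme := 𝒯.abs_volInt_mul_le (ε := 2⁻¹) (by positivity) hMc hec
  rw [inv_inv] at hmw hme
  rw [one_mul, inv_one, one_mul] at hd'p
  have hee : 𝒯.volInt (fun K x => e t K x * e t K x) = 𝒯.normSq (e t) := by
    simp [Mesh.normSq, sq]
  rw [hscal _ (hwm t ht')] at hAe
  rw [hscal _ (hem t ht), hee]
  have hN := hnl N 𝒯 F (q t) (u t) (projV k 𝒯 τ (q t) (u t)) (qh t) (projW k 𝒯 τ (q t) (u t))
    (uh t) hF hqK huK (hsp t ht).mem_V (hS.mem_V t ht) (hsp t ht).mem_W (hS.mem_W t ht')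
  have n1 : 0 ≤ errInterp R 𝒯 (fun x => F (-(q t x)) (u t x)) := 𝒯.normSq_nonneg _
  have n2 : 0 ≤ errInterp R 𝒯 (q t) := 𝒯.normSq_nonneg _
  have n3 : 0 ≤ errInterp R 𝒯 (u t) := 𝒯.normSq_nonneg _
  have n4 : 0 ≤ errProjW k 𝒯 τ (qt t) (ut t) := 𝒯.normSq_nonneg _
  have n5 : 0 ≤ errProjW k 𝒯 τ (q t) (u t) := 𝒯.normSq_nonneg _
  have hrates := energy_rates (C := C) (G := totalErr R 𝒯 τ F (u t) (ut t) (q t) (qt t))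
    (D := errProjV k 𝒯 τ (qt t) (ut t)) (P := 𝒯.normSq (projV k 𝒯 τ (q t) (u t) - qh t))
    (A := A t) (Y := 𝒯.normSq (w t)) (N₂ := 𝒯.normSq Nl) (r := errProjW k 𝒯 τ (qt t) (ut t))
    (δ₂ := errProjV k 𝒯 τ (q t) (u t)) (e₂ := 𝒯.normSq (e t)) (M₂ := 𝒯.normSq M)
    (ew := 𝒯.volInt fun K x => e t K x * w t K x)
    hC (totalErr_nonneg _ _ _ _) (𝒯.normSq_nonneg _) (𝒯.normSq_nonneg _) (𝒯.normSq_nonneg _) hPA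
    (hN.trans (mul_le_mul_of_nonneg_left (by
      change errInterp R 𝒯 (fun x => F (-(q t x)) (u t x)) + errProjV k 𝒯 τ (q t) (u t) +
        errProjW k 𝒯 τ (q t) (u t) + errInterp R 𝒯 (q t) + errInterp R 𝒯 (u t) +
        𝒯.normSq (projV k 𝒯 τ (q t) (u t) - qh t) + 𝒯.normSq (w t) ≤ _
      unfold totalErr
      linarith) hC.le))
    (𝒯.normSq_sub_le hNc hρc) (𝒯.normSq_nonneg _) (by unfold totalErr; linarith)
    (𝒯.normSq_nonneg _) hdp hd'p hmw hme (hAe.trans (by ring)) rfl rfl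
  have hG := totalErr_nonneg (R := R) (𝒯 := 𝒯) (τ := τ) (F := F) (u t) (ut t) (q t) (qt t)
  have hY := 𝒯.normSq_nonneg (w t)
  refine ⟨hrates.1.trans (mul_le_mul_of_nonneg_right (by linarith) (by linarith)), ?_⟩
  refine le_trans (le_of_eq ?_) hrates.2
  ring

end Estimate

end

end HDG

end

/-! ### The three error estimates -/

theorem theorem4p1 (d k : ℕ) [NeZero d] (hd : 2 ≤ d) (R : NodalElement d k)
    (σ L T : ℝ) (hL : 0 < L) (hT : 0 < T) :
    ∃ C : ℝ, 0 < C ∧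
      ∀ (N : ℕ) (𝒯 : Mesh d N) (Ω : Set (E d)) (τ : Fin N → Fin (d + 1) → ℝ)
        (F : E d → ℝ → ℝ) (f : ℝ → E d → ℝ) (u₀ : E d → ℝ)
        (u ut : ℝ → E d → ℝ) (q qt : ℝ → E d → E d)
        (qh : ℝ → Fin N → E d → E d) (uh : ℝ → Fin N → E d → ℝ)
        (uhat : ℝ → Set (E d) → E d → ℝ),
        𝒯.Partitions Ω → 𝒯.ShapeRegular σ → (∀ K i, 0 < τ K i) →
        (∀ p r v w, |F p v - F r w| ≤ L * (‖p - r‖ + |v - w|)) →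
        IsExactSolution Ω F f u₀ T u ut q qt →
        IsInterpolatoryHDGSolution R 𝒯 Ω τ F f T
          (fun K => (hdgProj k (𝒯.elem K) (τ K) (q 0) u₀).2) qh uh uhat →
        ∀ t ∈ Set.Ioc 0 T,
          𝒯.normSq (fun K x => q t x - qh t K x) ≤
              C * errProjV k 𝒯 τ (q 0) (u 0)
                + C * ∫ s in (0 : ℝ)..t,
                    (errInterp R 𝒯 (fun x => F (-(q s x)) (u s x))
                      + errProjW k 𝒯 τ (qt s) (ut s) + errProjV k 𝒯 τ (qt s) (ut s)
                      + errProjV k 𝒯 τ (q s) (u s) + errProjW k 𝒯 τ (q s) (u s)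
                      + errInterp R 𝒯 (q s) + errInterp R 𝒯 (u s)) ∧
          𝒯.normSq (fun K x => u t x - uh t K x) ≤
              C * errProjW k 𝒯 τ (q 0) (u 0)
                + C * ∫ s in (0 : ℝ)..t,
                    (errInterp R 𝒯 (fun x => F (-(q s x)) (u s x))
                      + errProjW k 𝒯 τ (qt s) (ut s)
                      + errProjV k 𝒯 τ (q s) (u s) + errProjW k 𝒯 τ (q s) (u s)
                      + errInterp R 𝒯 (q s) + errInterp R 𝒯 (u s)) ∧
          𝒯.normSq (fun K x => u t x - uh t K x) ≤
              C * (1 + 1 / t) * ∫ s in (0 : ℝ)..t,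
                    (errInterp R 𝒯 (fun x => F (-(q s x)) (u s x))
                      + errProjW k 𝒯 τ (qt s) (ut s)
                      + errProjV k 𝒯 τ (q s) (u s) + errProjW k 𝒯 τ (q s) (u s)
                      + errInterp R 𝒯 (q s) + errInterp R 𝒯 (u s)) := by
  obtain ⟨C, hC, hen⟩ := exists_energy_estimate R L
  set B := Real.exp (C * T)
  have hB : 0 < B := Real.exp_pos _
  -- The triangle inequality doubles everything: Gronwall contributes at most 2B(1 + C), with B a
  -- bound of the exponential factor on [0, T], and the projection error at time t contributes 2.
  refine ⟨2 * B * (1 + C) + 2, by positivity, ?_⟩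
  intro N 𝒯 Ω τ F f u₀ u ut q qt qh uh uhat h𝒯 _ hτ hF hE hS t ht
  obtain ⟨A, Y, A', Y', hAc, hYc, hA0, hY0, h⟩ :=
    hen N 𝒯 Ω τ F f u₀ u ut q qt qh uh uhat T hT h𝒯 hτ hF hE hS
  have ht' : t ∈ Icc 0 T := ⟨ht.1.le, ht.2⟩
  have hδ := hE.isC1On_errV h𝒯 R hτ
  have hη := hE.isC1On_errW h𝒯 R hτ
  let G : ℝ → ℝ := fun s => totalErr R 𝒯 τ F (u s) (ut s) (q s) (qt s)
  let D : ℝ → ℝ := fun s => errProjV k 𝒯 τ (qt s) (ut s)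
  let V : ℝ → ℝ := fun s => errProjV k 𝒯 τ (q s) (u s)
  let W : ℝ → ℝ := fun s => errProjW k 𝒯 τ (q s) (u s)
  let W' : ℝ → ℝ := fun s => errProjW k 𝒯 τ (qt s) (ut s)
  have hGc : ContinuousOn G (Icc 0 T) :=
    hE.continuousOn_totalErr h𝒯 R hτ (continuous_of_lipschitz hF)
  have hDc : ContinuousOn D (Icc 0 T) := 𝒯.continuousOn_normSq
    (f := fun t K x => projV k 𝒯 τ (qt t) (ut t) K x - qt t x) fun K => (hδ K).cont'
  have hVc : ContinuousOn V (Icc 0 T) := 𝒯.continuousOn_normSq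
    (f := fun t K x => projV k 𝒯 τ (q t) (u t) K x - q t x) fun K => (hδ K).cont
  have hWc : ContinuousOn W (Icc 0 T) := 𝒯.continuousOn_normSq
    (f := fun t K x => projW k 𝒯 τ (q t) (u t) K x - u t x) fun K => (hη K).cont
  have hWc' : ContinuousOn W' (Icc 0 T) := 𝒯.continuousOn_normSq
    (f := fun t K x => projW k 𝒯 τ (qt t) (ut t) K x - ut t x) fun K => (hη K).cont'
  have hG0 : ∀ s, 0 ≤ G s := fun s => totalErr_nonneg _ _ _ _
  have hD0 : ∀ s, 0 ≤ D s := fun s => 𝒯.normSq_nonneg _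
  have hV0 : ∀ s, 0 ≤ V s := fun s => 𝒯.normSq_nonneg _
  have hW0 : ∀ s, 0 ≤ W s := fun s => 𝒯.normSq_nonneg _
  have hW0' : ∀ s, 0 ≤ W' s := fun s => 𝒯.normSq_nonneg _
  have hcomp : ∀ s, V s ≤ G s ∧ W s + W' s ≤ G s := fun s => by
    have n1 : 0 ≤ errInterp R 𝒯 (fun x => F (-(q s x)) (u s x)) := 𝒯.normSq_nonneg _
    have n2 : 0 ≤ errInterp R 𝒯 (q s) := 𝒯.normSq_nonneg _
    have n3 : 0 ≤ errInterp R 𝒯 (u s) := 𝒯.normSq_nonneg _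
    have n4 := hV0 s
    have n5 := hW0 s
    have n6 := hW0' s
    constructor <;> simp only [G, V, W, W', totalErr] at * <;> linarith
  have hint : ∀ {g : ℝ → ℝ}, ContinuousOn g (Icc 0 T) → ∀ {a b : ℝ}, 0 ≤ a → a ≤ b → b ≤ T →
      IntervalIntegrable g volume a b := fun hg a b ha hab hb =>
    (hg.mono (by rw [uIcc_of_le hab]; exact Icc_subset_Icc ha hb)).intervalIntegrable
  have hexpt : Real.exp (C * t) ≤ B := Real.exp_le_exp.2 (mul_le_mul_of_nonneg_left ht.2 hC.le)
  set I := ∫ s in (0 : ℝ)..t, G s with hI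
  set J := ∫ s in (0 : ℝ)..t, (G s + D s) with hJ
  have hI0 : 0 ≤ I := intervalIntegral.integral_nonneg ht.1.le fun s _ => hG0 s
  have hJ0 : 0 ≤ J := intervalIntegral.integral_nonneg ht.1.le fun s _ => add_nonneg (hG0 s) (hD0 s)
  -- Y obeys a closed inequality of its own, which keeps the error of Π_V q_t out of the estimate
  -- for u.
  have hYt : Y t ≤ B * (C * I) := by
    have hg := gronwall_of_deriv_le hC.le hYc (fun s hs => (h s hs).2.2.2.1) hGc
      (fun s _ => hG0 s) (fun s hs => (h s hs).2.2.2.2.1) ht'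
    rw [hY0, zero_add] at hg
    exact hg.trans (mul_le_mul_of_nonneg_right hexpt (by positivity))
  have hYnn : 0 ≤ Y t := by
    rw [← (h t ht).2.1]
    exact 𝒯.normSq_nonneg _
  -- Gronwall for A + Y, as the rate of A also involves Y. The initial value is at most that of the
  -- flux projection error.
  have hAt : A t ≤ B * (V 0 + C * J) := by
    have hg := gronwall_of_deriv_le (Z := fun s => A s + Y s) hC.le (hAc.add hYc)
      (fun s hs => (h s hs).2.2.1.add (h s hs).2.2.2.1) (hGc.add hDc)
      (fun s _ => add_nonneg (hG0 s) (hD0 s)) (fun s hs => (h s hs).2.2.2.2.2) ht'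
    have h1 : A 0 + Y 0 + C * J ≤ V 0 + C * J := by
      rw [hY0]
      have : A 0 ≤ V 0 := hA0
      linarith
    have h2 := mul_le_mul_of_nonneg_left h1 (Real.exp_pos (C * t)).le
    have h3 : Real.exp (C * t) * (V 0 + C * J) ≤ B * (V 0 + C * J) :=
      mul_le_mul_of_nonneg_right hexpt (add_nonneg (hV0 0) (by positivity))
    have h4 : A t + Y t ≤ Real.exp (C * t) * (A 0 + Y 0 + C * J) := hg
    linarith
  have hVt : V t ≤ V 0 + J := by
    have h1 := 𝒯.normSq_le_add_integral (f := fun t K x => projV k 𝒯 τ (q t) (u t) K x - q t x)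
      (f' := fun t K x => projV k 𝒯 τ (qt t) (ut t) K x - qt t x) hδ le_rfl ht.1.le ht.2
    have h2 : ∫ s in (0 : ℝ)..t, (V s + D s) ≤ J :=
      intervalIntegral.integral_mono_on ht.1.le (hint (hVc.add hDc) le_rfl ht.1.le ht.2)
        (hint (hGc.add hDc) le_rfl ht.1.le ht.2) fun s _ => add_le_add_left (hcomp s).1 _
    exact h1.trans (add_le_add_right h2 _)
  -- The starting time s is kept free: s = 0 serves the second estimate, the average over s the
  -- third.
  have hWst : ∀ s ∈ Icc 0 t, W t ≤ W s + I := fun s hs => by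
    have h1 := 𝒯.normSq_le_add_integral (f := fun t K x => projW k 𝒯 τ (q t) (u t) K x - u t x)
      (f' := fun t K x => projW k 𝒯 τ (qt t) (ut t) K x - ut t x) hη hs.1 hs.2 ht.2
    have h2 : ∫ s in s..t, (W s + W' s) ≤ ∫ s in s..t, G s :=
      intervalIntegral.integral_mono_on hs.2 (hint (hWc.add hWc') hs.1 hs.2 ht.2)
        (hint hGc hs.1 hs.2 ht.2) fun s _ => (hcomp s).2
    have h3 : (∫ r in (0 : ℝ)..s, G r) + ∫ r in s..t, G r = I :=
      intervalIntegral.integral_add_adjacent_intervals (hint hGc le_rfl hs.1 (hs.2.trans ht.2))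
        (hint hGc hs.1 hs.2 ht.2)
    have h4 : 0 ≤ ∫ r in (0 : ℝ)..s, G r :=
      intervalIntegral.integral_nonneg hs.1 fun s _ => hG0 s
    have h5 : W t ≤ W s + ∫ s in s..t, (W s + W' s) := h1
    linarith
  -- Integrating over s in [0, t] gives t W(t) ≤ ∫ W + t I ≤ (1 + t) I, so no initial value is
  -- needed.
  have hWavg : W t ≤ (1 + 1 / t) * I := by
    have h1 : ∫ s in (0 : ℝ)..t, W t ≤ ∫ s in (0 : ℝ)..t, (W s + I) :=
      intervalIntegral.integral_mono_on ht.1.le intervalIntegrable_const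
        (hint (hWc.add continuousOn_const) le_rfl ht.1.le ht.2) hWst
    rw [intervalIntegral.integral_add (hint hWc le_rfl ht.1.le ht.2) intervalIntegrable_const,
      intervalIntegral.integral_const, intervalIntegral.integral_const, sub_zero, smul_eq_mul,
      smul_eq_mul] at h1
    have h2 : ∫ s in (0 : ℝ)..t, W s ≤ I :=
      intervalIntegral.integral_mono_on ht.1.le (hint hWc le_rfl ht.1.le ht.2)
        (hint hGc le_rfl ht.1.le ht.2) fun s _ => by linarith [(hcomp s).2, hW0' s]
    have h3 : t * W t ≤ t * ((1 + 1 / t) * I) := by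
      have : t * ((1 + 1 / t) * I) = t * I + I := by
        have := ht.1.ne'
        field_simp
      linarith
    exact le_of_mul_le_mul_left h3 ht.1
  have hqerr : 𝒯.normSq (fun K x => q t x - qh t K x) ≤ 2 * A t + 2 * V t := by
    have hq : ∀ K, Continuous (projV k 𝒯 τ (q t) (u t) K) := fun K =>
      (hdgProj_spec _ (hτ K) (slice_continuousOn (hE.isC1On_q h𝒯 K).cont ht')
        (slice_continuousOn (hE.isC1On_u h𝒯 K).cont ht')).poly_q.continuous
    have h1 := 𝒯.normSq_sub_le (f := fun K x => projV k 𝒯 τ (q t) (u t) K x - qh t K x)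
      (g := fun K x => projV k 𝒯 τ (q t) (u t) K x - q t x)
      (fun K => ((hq K).sub (hS.mem_V t ht K).continuous).continuousOn)
      (fun K => (hq K).continuousOn.sub (slice_continuousOn (hE.isC1On_q h𝒯 K).cont ht'))
    simp only [sub_sub_sub_cancel_left] at h1
    have h2 := (h t ht).1
    change _ ≤ _ + 2 * V t at h1
    linarith
  have huerr : 𝒯.normSq (fun K x => u t x - uh t K x) ≤ 2 * Y t + 2 * W t := by
    have hu : ∀ K, Continuous (projW k 𝒯 τ (q t) (u t) K) := fun K =>
      (hdgProj_spec _ (hτ K) (slice_continuousOn (hE.isC1On_q h𝒯 K).cont ht')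
        (slice_continuousOn (hE.isC1On_u h𝒯 K).cont ht')).poly_u.continuous
    have h1 := 𝒯.normSq_sub_le (f := fun K x => projW k 𝒯 τ (q t) (u t) K x - uh t K x)
      (g := fun K x => projW k 𝒯 τ (q t) (u t) K x - u t x)
      (fun K => ((hu K).sub (hS.mem_W t ht' K).continuous).continuousOn)
      (fun K => (hu K).continuousOn.sub (slice_continuousOn (hE.isC1On_u h𝒯 K).cont ht'))
    simp only [sub_sub_sub_cancel_left] at h1
    have h2 := (h t ht).2.1
    change _ ≤ _ + 2 * W t at h1
    linarith
  have hBC : 0 ≤ B * C := by positivity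
  refine ⟨?_, ?_, ?_⟩
  · have e : ∫ s in (0 : ℝ)..t, (errInterp R 𝒯 (fun x => F (-(q s x)) (u s x))
        + errProjW k 𝒯 τ (qt s) (ut s) + errProjV k 𝒯 τ (qt s) (ut s)
        + errProjV k 𝒯 τ (q s) (u s) + errProjW k 𝒯 τ (q s) (u s)
        + errInterp R 𝒯 (q s) + errInterp R 𝒯 (u s)) = J :=
      intervalIntegral.integral_congr fun s _ => by
        simp only [G, D, totalErr]
        ring
    rw [e]
    change _ ≤ _ * V 0 + _
    nlinarith [hV0 0, mul_nonneg hB.le (hV0 0), mul_nonneg hB.le hJ0, mul_nonneg hBC (hV0 0)]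
  · change _ ≤ _ * W 0 + _ * I
    have h1 := hWst 0 ⟨le_rfl, ht.1.le⟩
    nlinarith [hW0 0, mul_nonneg hB.le (hW0 0), mul_nonneg hB.le hI0, mul_nonneg hBC (hW0 0)]
  · have h1 : 0 ≤ 1 / t * I := mul_nonneg (one_div_nonneg.2 ht.1.le) hI0
    nlinarith [mul_nonneg hB.le hI0, mul_nonneg hB.le h1, mul_nonneg hBC h1]
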